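/- A log variety over $\mathbb{C}$ is a fine and saturated log scheme $X=(X^\circ,M_X,\alpha)$ over $\operatorname{Spec}\mathbb{C}$ (with trivial log structure, all log structures being on the étale site) whose underlying scheme $X^\circ$ is separated and of finite type over $\mathbb{C}$. For a log variety $X$ whose underlying scheme is smooth and projective over $\mathbb{C}$ let $$E^{\log}(X)=\sum_{p,q\ge 0}\dim_{\mathbb{C}}H^q\bigl(X,\textstyle\bigwedge^p\Omega^{\log}_X\bigr)\,u^pv^q,$$ where $\Omega^{\log}_X$ is the sheaf of log differentials of $X$ over $\mathbb{C}$. Then there is no map $\phi$ from log varieties over $\mathbb{C}$ to $\mathbb{Z}[u,v]$ that satisfies both of the following conditions: 1. $\phi(X)=\phi(Z)+\phi(X\setminus Z)$ for every log variety $X$ and every strict closed immersion $Z\to X$, where $X\setminus Z$ is the complementary open subscheme with the restricted log structure (well defined up to isomorphism; the equation is required for every representative of it); 2. $\phi(X)=E^{\log}(X)$ for every log variety $X$ that is log smooth over $\mathbb{C}$ and whose underlying scheme is smooth and projective over $\mathbb{C}$. -/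

import Mathlib

open CategoryTheory Opposite AlgebraicGeometry Limits

noncomputable section
namespace LogGeom

/-! ### Log differentials of a ring with a monoid -/

section Algebra

variable (k : Type) [CommRing k]
variable {A : Type} [CommRing A] [Algebra k A] {M : Type} [CommMonoid M] (α : M →* A)
variable {B : Type} [CommRing B] [Algebra k B] {N : Type} [CommMonoid N] (β : N →* B)
variable {C : Type} [CommRing C] [Algebra k C] {P : Type} [CommMonoid P] (γ : P →* C)

/-- The relations `d(α(m)) = α(m) dlog(m)` and `dlog(mn) = dlog(m) + dlog(n)`. -/
def logRel : Submodule A (Ω[A⁄k] × (M →₀ A)) :=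
  Submodule.span A
    ({x | ∃ m : M, x = (KaehlerDifferential.D k A (α m), -Finsupp.single m (α m))} ∪
     {x | ∃ m n : M, x = (0, Finsupp.single (m * n) 1 - Finsupp.single m 1 - Finsupp.single n 1)})

/-- The module of log differentials of `α : M → A` over `k` (with the trivial log structure on `k`):
the quotient of `Ω_{A/k} ⊕ (A ⊗ M^gp)` by `(d(α(m)), -α(m) ⊗ m)`. Here `A ⊗ M^gp` is presented as
the free module on `M` modulo the relations making `m ↦ 1 ⊗ m` additive. -/
abbrev LogDiff : Type := (Ω[A⁄k] × (M →₀ A)) ⧸ logRel k α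

/-- The differential `d a`. -/
def dd (a : A) : LogDiff k α := (logRel k α).mkQ (KaehlerDifferential.D k A a, 0)

/-- The logarithmic differential `dlog m`. -/
def dlog (m : M) : LogDiff k α := (logRel k α).mkQ (0, Finsupp.single m 1)

lemma dlog_mul (m n : M) : dlog k α (m * n) = dlog k α m + dlog k α n := by
  rw [dlog, dlog, dlog, ← map_add, ← sub_eq_zero, ← map_sub, Submodule.mkQ_apply,
    Submodule.Quotient.mk_eq_zero]
  refine Submodule.subset_span (Or.inr ⟨m, n, ?_⟩)
  ext <;> simp [sub_sub]

lemma dd_eq (m : M) : dd k α (α m) = α m • dlog k α m := by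
  rw [dd, dlog, ← map_smul, ← sub_eq_zero, ← map_sub, Submodule.mkQ_apply,
    Submodule.Quotient.mk_eq_zero]
  refine Submodule.subset_span (Or.inl ⟨m, ?_⟩)
  ext <;> simp

lemma span_gen : Submodule.span A (Set.range (dd k α) ∪ Set.range (dlog k α)) = ⊤ := by
  rw [eq_top_iff]
  rintro x -
  obtain ⟨⟨w, c⟩, rfl⟩ := (logRel k α).mkQ_surjective x
  have h1 : (logRel k α).mkQ (w, 0) ∈ Submodule.span A (Set.range (dd k α) ∪ Set.range (dlog k α)) := by
    have hw : w ∈ Submodule.span A (Set.range (KaehlerDifferential.D k A)) := by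
      rw [KaehlerDifferential.span_range_derivation]; trivial
    have := Submodule.mem_map_of_mem (f := (logRel k α).mkQ ∘ₗ LinearMap.inl A _ (M →₀ A)) hw
    rw [Submodule.map_span] at this
    refine Submodule.span_mono ?_ this
    rintro _ ⟨_, ⟨a, rfl⟩, rfl⟩
    exact Or.inl ⟨a, rfl⟩
  have h2 : (logRel k α).mkQ (0, c) ∈ Submodule.span A (Set.range (dd k α) ∪ Set.range (dlog k α)) := by
    have hc : c ∈ Submodule.span A (Set.range fun m : M ↦ Finsupp.single m (1 : A)) := by
      have := (Finsupp.basisSingleOne (R := A) (ι := M)).span_eq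
      rw [Finsupp.coe_basisSingleOne] at this
      rw [this]; trivial
    have := Submodule.mem_map_of_mem (f := (logRel k α).mkQ ∘ₗ LinearMap.inr A (Ω[A⁄k]) _) hc
    rw [Submodule.map_span] at this
    refine Submodule.span_mono ?_ this
    rintro _ ⟨_, ⟨a, rfl⟩, rfl⟩
    exact Or.inr ⟨a, rfl⟩
  have : (w, c) = (w, 0) + (0, c) := by simp
  rw [this, map_add]
  exact add_mem h1 h2

variable {k α β γ}

/-- A morphism from `α : M → A` to `β : N → B` over `k`. -/
@[ext] structure PreLogHom (k : Type) [CommRing k]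
    {A : Type} [CommRing A] [Algebra k A] {M : Type} [CommMonoid M] (α : M →* A)
    {B : Type} [CommRing B] [Algebra k B] {N : Type} [CommMonoid N] (β : N →* B) where
  ring : A →ₐ[k] B
  mon : M →* N
  comm : ∀ m, β (mon m) = ring (α m)

/-- The semilinear map on log differentials, `d a ↦ d (f a)` and `dlog m ↦ dlog (f m)`. -/
def LogDiff.map (f : PreLogHom k α β) : LogDiff k α →ₛₗ[f.ring.toRingHom] LogDiff k β :=
  letI : Algebra A B := f.ring.toRingHom.toAlgebra
  haveI : IsScalarTower k A B := .of_algebraMap_eq fun r ↦ (f.ring.commutes r).symm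
  let φ : (Ω[A⁄k] × (M →₀ A)) →ₗ[A] LogDiff k β :=
    LinearMap.coprod
      ((((logRel k β).mkQ ∘ₗ LinearMap.inl B (Ω[B⁄k]) (N →₀ B)).restrictScalars A) ∘ₗ
        KaehlerDifferential.map k k A B)
      (Finsupp.linearCombination A fun m ↦ dlog k β (f.mon m))
  let ψ : LogDiff k α →ₗ[A] LogDiff k β := (logRel k α).liftQ φ (by
    rw [logRel, Submodule.span_le]
    rintro _ (⟨m, rfl⟩ | ⟨m, n, rfl⟩)
    · have h := dd_eq k β (f.mon m)
      have h2 : (algebraMap A B) (α m) = β (f.mon m) := (f.comm m).symm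
      simp only [SetLike.mem_coe, LinearMap.mem_ker, φ, LinearMap.coprod_apply, map_neg,
        LinearMap.comp_apply, LinearMap.restrictScalars_apply, KaehlerDifferential.map_D,
        Finsupp.linearCombination_single]
      rw [h2, ← algebraMap_smul B (α m), h2, ← h]
      exact add_neg_cancel _
    · simp only [SetLike.mem_coe, LinearMap.mem_ker, φ, LinearMap.coprod_apply, map_sub, map_zero,
        Finsupp.linearCombination_single, one_smul, dlog_mul, f.mon.map_mul]
      abel)
  { toFun := ψ
    map_add' := map_add ψ
    map_smul' := fun a x ↦ by
      rw [map_smul]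
      exact (algebraMap_smul B a (ψ x)).symm }

lemma LogDiff.map_dd (f : PreLogHom k α β) (a : A) :
    LogDiff.map f (dd k α a) = dd k β (f.ring a) := by
  let : Algebra A B := f.ring.toRingHom.toAlgebra
  have : IsScalarTower k A B := .of_algebraMap_eq fun r ↦ (f.ring.commutes r).symm
  have := KaehlerDifferential.map_D k k A B a
  simp only [LogDiff.map, dd, LinearMap.coe_mk, AddHom.coe_mk, Submodule.mkQ_apply, Submodule.liftQ_apply, LinearMap.coprod_apply, LinearMap.comp_apply, this, map_zero, add_zero]
  rfl

lemma LogDiff.map_dlog (f : PreLogHom k α β) (m : M) :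
    LogDiff.map f (dlog k α m) = dlog k β (f.mon m) := by
  simp only [LogDiff.map, dlog, LinearMap.coe_mk, AddHom.coe_mk, Submodule.mkQ_apply,
    Submodule.liftQ_apply, LinearMap.coprod_apply, map_zero, zero_add,
    Finsupp.linearCombination_single, one_smul]

variable (k α) in
/-- The `p`-th exterior power over `A` of the module of log differentials. -/
abbrev LogForms (p : ℕ) : Type := ⋀[A]^p (LogDiff k α)


/-- The exterior power of a semilinear map. -/
def extMap {σ : A →+* B} {E F : Type} [AddCommGroup E] [Module A E] [AddCommGroup F] [Module B F]
    (s : E →ₛₗ[σ] F) (p : ℕ) : (⋀[A]^p E) →ₛₗ[σ] (⋀[B]^p F) :=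
  letI : Module A F := Module.compHom F σ
  letI : Module A (⋀[B]^p F) := Module.compHom _ σ
  let s' : E →ₗ[A] F :=
    { toFun := s, map_add' := s.map_add, map_smul' := fun a x ↦ s.map_smulₛₗ a x }
  let μ : E [⋀^Fin p]→ₗ[A] (⋀[B]^p F) :=
    { toFun := fun v ↦ exteriorPower.ιMulti B p (s ∘ v)
      map_update_add' := fun v i x y ↦ by
        simp only [Function.comp_update, map_add, AlternatingMap.map_update_add]
      map_update_smul' := fun v i a x ↦ by
        simp only [Function.comp_update, map_smulₛₗ, AlternatingMap.map_update_smul]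
        rfl
      map_eq_zero_of_eq' := fun v i j h hij ↦
        (exteriorPower.ιMulti B p).map_eq_zero_of_eq _ (congrArg s h) hij }
  let ψ := exteriorPower.alternatingMapLinearEquiv μ
  { toFun := ψ, map_add' := map_add ψ, map_smul' := fun a x ↦ map_smul ψ a x }

lemma extMap_ιMulti {σ : A →+* B} {E F : Type} [AddCommGroup E] [Module A E] [AddCommGroup F]
    [Module B F] (s : E →ₛₗ[σ] F) (p : ℕ) (v : Fin p → E) :
    extMap s p (exteriorPower.ιMulti A p v) = exteriorPower.ιMulti B p (s ∘ v) := by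
  let : Module A (⋀[B]^p F) := Module.compHom _ σ
  exact exteriorPower.alternatingMapLinearEquiv_apply_ιMulti _ _

/-- The `k`-linear map on log forms induced by a morphism. -/
def LogForms.map (f : PreLogHom k α β) (p : ℕ) : LogForms k α p →ₗ[k] LogForms k β p where
  toFun := extMap (LogDiff.map f) p
  map_add' := map_add _
  map_smul' r x := by
    rw [← algebraMap_smul A r x, map_smulₛₗ]
    simp only [AlgHom.toRingHom_eq_coe, RingHom.coe_coe, AlgHom.commutes, algebraMap_smul, RingHom.id_apply]

/-- The identity morphism. -/
def PreLogHom.id : PreLogHom k α α := ⟨.id k A, .id M, fun _ ↦ rfl⟩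

/-- Composition of morphisms. -/
def PreLogHom.comp (g : PreLogHom k β γ) (f : PreLogHom k α β) : PreLogHom k α γ :=
  ⟨g.ring.comp f.ring, g.mon.comp f.mon, fun m ↦ by simp [g.comm, f.comm]⟩

lemma LogDiff.map_id (x : LogDiff k α) : LogDiff.map PreLogHom.id x = x := by
  have hx : x ∈ Submodule.span A (Set.range (dd k α) ∪ Set.range (dlog k α)) := by
    rw [span_gen]; trivial
  induction hx using Submodule.span_induction with
  | mem x h =>
    rcases h with ⟨a, rfl⟩ | ⟨m, rfl⟩
    · exact LogDiff.map_dd _ _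
    · exact LogDiff.map_dlog _ _
  | zero => exact map_zero _
  | add x y _ _ hx hy => rw [map_add, hx, hy]
  | smul a x _ hx => rw [map_smulₛₗ, hx]; rfl

lemma LogDiff.map_comp (g : PreLogHom k β γ) (f : PreLogHom k α β) (x : LogDiff k α) :
    LogDiff.map (g.comp f) x = LogDiff.map g (LogDiff.map f x) := by
  have hx : x ∈ Submodule.span A (Set.range (dd k α) ∪ Set.range (dlog k α)) := by
    rw [span_gen]; trivial
  induction hx using Submodule.span_induction with
  | mem x h =>
    rcases h with ⟨a, rfl⟩ | ⟨m, rfl⟩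
    · simp only [LogDiff.map_dd]; rfl
    · simp only [LogDiff.map_dlog]; rfl
  | zero => simp only [map_zero]
  | add x y _ _ hx hy => simp only [map_add, hx, hy]
  | smul a x _ hx => simp only [map_smulₛₗ, hx]; rfl

lemma LogForms.map_ιMulti (f : PreLogHom k α β) (p : ℕ) (v : Fin p → LogDiff k α) :
    LogForms.map f p (exteriorPower.ιMulti A p v) =
      exteriorPower.ιMulti B p (LogDiff.map f ∘ v) :=
  extMap_ιMulti _ _ _

lemma LogForms.map_smul (f : PreLogHom k α β) (p : ℕ) (a : A) (x : LogForms k α p) :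
    LogForms.map f p (a • x) = f.ring a • LogForms.map f p x :=
  (extMap (LogDiff.map f) p).map_smulₛₗ a x

lemma LogForms.map_id (p : ℕ) : LogForms.map (PreLogHom.id (k := k) (α := α)) p = .id := by
  ext1 x
  have hx : x ∈ Submodule.span A (Set.range (exteriorPower.ιMulti A p (M := LogDiff k α))) := by
    rw [exteriorPower.ιMulti_span]; trivial
  induction hx using Submodule.span_induction with
  | mem x h =>
    obtain ⟨v, rfl⟩ := h
    rw [LogForms.map_ιMulti]
    exact congrArg _ (funext fun i ↦ LogDiff.map_id _)
  | zero => exact map_zero _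
  | add x y _ _ hx hy => rw [map_add, hx, hy]; rfl
  | smul a x _ hx => rw [LogForms.map_smul, hx]; rfl

lemma LogForms.map_comp (g : PreLogHom k β γ) (f : PreLogHom k α β) (p : ℕ) :
    LogForms.map (g.comp f) p = LogForms.map g p ∘ₗ LogForms.map f p := by
  ext1 x
  rw [LinearMap.comp_apply]
  have hx : x ∈ Submodule.span A (Set.range (exteriorPower.ιMulti A p (M := LogDiff k α))) := by
    rw [exteriorPower.ιMulti_span]; trivial
  induction hx using Submodule.span_induction with
  | mem x h =>
    obtain ⟨v, rfl⟩ := h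
    simp only [LogForms.map_ιMulti]
    exact congrArg _ (funext fun i ↦ LogDiff.map_comp _ _ _)
  | zero => simp only [map_zero]
  | add x y _ _ hx hy => simp only [map_add, hx, hy]
  | smul a x _ hx => simp only [LogForms.map_smul, hx]; rfl
end Algebra

/-! ### Log schemes over `ℂ` -/

section Site

variable {X : Scheme.{0}}

/-- The total space of an étale `X`-scheme. -/
def dom (U : X.Etale) : Scheme.{0} := U.left

/-- The structure morphism of an étale `X`-scheme. -/
def proj (U : X.Etale) : dom U ⟶ X := U.hom

instance (U : X.Etale) : Etale (proj U) := U.prop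

/-- The morphism of schemes underlying a morphism of étale `X`-schemes. -/
def left {U V : X.Etale} (b : V ⟶ U) : dom V ⟶ dom U := b.left

lemma left_proj {U V : X.Etale} (b : V ⟶ U) : left b ≫ proj U = proj V :=
  Over.w ((Scheme.Etale.forget X).map b)

/-- The morphism of étale `X`-schemes given by a compatible morphism of schemes. -/
def homOfLeft {U V : X.Etale} (b : dom V ⟶ dom U) (hb : b ≫ proj U = proj V) : V ⟶ U :=
  MorphismProperty.Over.homMk b hb

variable (X) in
/-- The structure sheaf `U ↦ Γ(U, 𝒪_U)` on the small étale site of `X`. -/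
def etaleO : X.Etaleᵒᵖ ⥤ CommRingCat.{0} :=
  (Scheme.Etale.forget X ⋙ Over.forget X).op ⋙ Scheme.Γ

end Site

/-- A log scheme over `Spec ℂ`, the latter with its trivial log structure: a scheme `X` over `ℂ`
with an étale sheaf of commutative monoids `M` and a map `α : M → 𝒪_X` to the multiplicative
monoid of the structure sheaf that restricts to an isomorphism `α⁻¹ 𝒪_X^* → 𝒪_X^*`. -/
structure LogScheme where
  X : Scheme.{0}
  str : X ⟶ Spec (.of ℂ)
  M : Sheaf X.smallEtaleTopology CommMonCat.{0}
  α : M.obj ⟶ etaleO X ⋙ forget₂ CommRingCat CommMonCat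
  unit : ∀ (U : X.Etale) (x : (etaleO X).obj (op U)), IsUnit x →
    ∃! m : M.obj.obj (op U), α.app (op U) m = x

namespace LogScheme

/-- The ring of functions on an étale `X`-scheme. -/
def Fn (X : LogScheme) (U : X.X.Etale) : Type := Γ(dom U, ⊤)

instance (X : LogScheme) (U : X.X.Etale) : CommRing (X.Fn U) :=
  inferInstanceAs (CommRing Γ(dom U, ⊤))

instance (X : LogScheme) (U : X.X.Etale) : Algebra ℂ (X.Fn U) :=
  ((Scheme.ΓSpecIso (.of ℂ)).inv ≫ (proj U ≫ X.str).appTop).hom.toAlgebra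

/-- The monoid of sections of `M` over an étale `X`-scheme. -/
abbrev Mon (X : LogScheme) (U : X.X.Etale) : Type := X.M.obj.obj (op U)

/-- Restriction of sections of `M`. -/
def res (X : LogScheme) {U V : X.X.Etale} (b : V ⟶ U) : X.Mon U →* X.Mon V :=
  (X.M.obj.map b.op).hom

/-- The map `α` on sections. -/
def toFn (X : LogScheme) (U : X.X.Etale) : X.Mon U →* X.Fn U := (X.α.app (op U)).hom

/-- Restriction of functions. -/
def resFn (X : LogScheme) {U V : X.X.Etale} (b : V ⟶ U) : X.Fn U →ₐ[ℂ] X.Fn V where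
  __ := (left b).appTop.hom
  commutes' r := by
    have h : (proj U ≫ X.str).appTop ≫ (left b).appTop = (proj V ≫ X.str).appTop := by
      rw [← Scheme.Hom.comp_appTop, ← Category.assoc, left_proj]
    exact congr($h _)

lemma toFn_res (X : LogScheme) {U V : X.X.Etale} (b : V ⟶ U) (m : X.Mon U) :
    X.toFn V (X.res b m) = X.resFn b (X.toFn U m) :=
  congr($(X.α.naturality b.op) m)

/-- The restriction maps of functions and of sections of `M` together. -/
def resPre (X : LogScheme) {U V : X.X.Etale} (b : V ⟶ U) :
    PreLogHom ℂ (X.toFn U) (X.toFn V) := ⟨X.resFn b, X.res b, X.toFn_res b⟩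

lemma resPre_id (X : LogScheme) (U : X.X.Etale) : X.resPre (𝟙 U) = PreLogHom.id := by
  ext x
  · exact congr($((etaleO X.X).map_id (op U)) x)
  · exact congr($(X.M.obj.map_id (op U)) x)

lemma resPre_comp (X : LogScheme) {U V W : X.X.Etale} (b : V ⟶ U) (c : W ⟶ V) :
    X.resPre (c ≫ b) = (X.resPre c).comp (X.resPre b) := by
  ext x
  · exact congr($((etaleO X.X).map_comp b.op c.op) x)
  · exact congr($(X.M.obj.map_comp b.op c.op) x)

/-- The presheaf `U ↦ ⋀^p Ω^log(𝒪(U), M(U))` of complex vector spaces. -/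
def formsPresheaf (X : LogScheme) (p : ℕ) : X.X.Etaleᵒᵖ ⥤ ModuleCat.{0} ℂ where
  obj U := ModuleCat.of ℂ (LogForms ℂ (X.toFn U.unop) p)
  map b := ModuleCat.ofHom (LogForms.map (X.resPre b.unop) p)
  map_id U := by
    rw [unop_id, resPre_id, LogForms.map_id]; rfl
  map_comp b c := by
    rw [unop_comp, resPre_comp, LogForms.map_comp]; rfl

/-- The sheaf `⋀^p Ω^log_X` of log `p`-forms on the small étale site. It is the sheaf associated
with the presheaf of exterior powers of the presheaf of log differentials. -/
def forms (X : LogScheme) (p : ℕ) : Sheaf X.X.smallEtaleTopology (ModuleCat.{0} ℂ) :=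
  (presheafToSheaf _ _).obj (X.formsPresheaf p)

/-- The cohomology `H^q(X, F)` of a sheaf of complex vector spaces, `Ext^q(ℂ_X, F)` with `ℂ_X` the
constant sheaf. -/
abbrev H (X : LogScheme) (F : Sheaf X.X.smallEtaleTopology (ModuleCat.{0} ℂ)) (q : ℕ) : Type :=
  Abelian.Ext ((constantSheaf X.X.smallEtaleTopology (ModuleCat.{0} ℂ)).obj (ModuleCat.of ℂ ℂ)) F q

/-- The log Hodge number `dim H^q(X, ⋀^p Ω^log_X)`. -/
def hodge (X : LogScheme) (p q : ℕ) : ℕ := Module.finrank ℂ (X.H (X.forms p) q)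

/-- The log e-polynomial `∑ dim H^q(X, ⋀^p Ω^log_X) u^p v^q`, with `u` and `v` the variables `0` and
`1`, as a formal power series: its coefficient at the exponent `d` is the log Hodge number for
`p = d 0` and `q = d 1`. -/
def ePoly (X : LogScheme) : MvPowerSeries (Fin 2) ℤ := fun d ↦ X.hodge (d 0) (d 1)

/-- A morphism of log schemes over `ℂ`: a morphism `f : X → Y` of schemes over `ℂ` with a map
`M_Y → f_* M_X` compatible with `𝒪_Y → f_* 𝒪_X`. The map is given by the pullbacks
`M_Y(U) → M_X(V)` along all `g : V → U` over `f`, for `U` étale over `Y` and `V` étale over `X`,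
compatibly with restriction on both sides. -/
@[ext] structure Hom (X Y : LogScheme) where
  f : X.X ⟶ Y.X
  w : f ≫ Y.str = X.str
  pull : ∀ {U : Y.X.Etale} {V : X.X.Etale} (g : dom V ⟶ dom U), g ≫ proj U = proj V ≫ f →
    (Y.Mon U →* X.Mon V)
  res_pull : ∀ {U : Y.X.Etale} {V V' : X.X.Etale} (g : dom V ⟶ dom U)
    (hg : g ≫ proj U = proj V ≫ f) (b : V' ⟶ V) (hg' : (left b ≫ g) ≫ proj U = proj V' ≫ f)
    (m : Y.Mon U), X.res b (pull g hg m) = pull (left b ≫ g) hg' m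
  pull_res : ∀ {U U' : Y.X.Etale} {V : X.X.Etale} (g : dom V ⟶ dom U')
    (hg : g ≫ proj U' = proj V ≫ f) (a : U' ⟶ U) (hg' : (g ≫ left a) ≫ proj U = proj V ≫ f)
    (m : Y.Mon U), pull g hg (Y.res a m) = pull (g ≫ left a) hg' m
  toFn_pull : ∀ {U : Y.X.Etale} {V : X.X.Etale} (g : dom V ⟶ dom U)
    (hg : g ≫ proj U = proj V ≫ f) (m : Y.Mon U),
    X.toFn V (pull g hg m) = g.appTop.hom (Y.toFn U m)

namespace Hom

variable {X Y Z : LogScheme}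

/-- The base change `U ×_Y X`, étale over `X`. -/
def base (f : X.Hom Y) (U : Y.X.Etale) : X.X.Etale := Scheme.Etale.mk (pullback.snd (proj U) f.f)

/-- The projection `U ×_Y X → U`. -/
def baseFst (f : X.Hom Y) (U : Y.X.Etale) : dom (f.base U) ⟶ dom U := pullback.fst (proj U) f.f

lemma baseFst_proj (f : X.Hom Y) (U : Y.X.Etale) :
    f.baseFst U ≫ proj U = proj (f.base U) ≫ f.f := pullback.condition

/-- The universal property of `U ×_Y X`. -/
def toBase (f : X.Hom Y) (U : Y.X.Etale) {T : Scheme.{0}} (g : T ⟶ dom U) (h : T ⟶ X.X)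
    (e : g ≫ proj U = h ≫ f.f) : T ⟶ dom (f.base U) := pullback.lift g h e

@[simp] lemma toBase_fst (f : X.Hom Y) (U : Y.X.Etale) {T : Scheme.{0}} (g : T ⟶ dom U)
    (h : T ⟶ X.X) (e : g ≫ proj U = h ≫ f.f) : f.toBase U g h e ≫ f.baseFst U = g :=
  pullback.lift_fst _ _ _

@[simp] lemma toBase_proj (f : X.Hom Y) (U : Y.X.Etale) {T : Scheme.{0}} (g : T ⟶ dom U)
    (h : T ⟶ X.X) (e : g ≫ proj U = h ≫ f.f) : f.toBase U g h e ≫ proj (f.base U) = h :=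
  pullback.lift_snd _ _ _

lemma base_ext (f : X.Hom Y) (U : Y.X.Etale) {T : Scheme.{0}} {g h : T ⟶ dom (f.base U)}
    (h1 : g ≫ f.baseFst U = h ≫ f.baseFst U)
    (h2 : g ≫ proj (f.base U) = h ≫ proj (f.base U)) : g = h :=
  pullback.hom_ext h1 h2

lemma pull_eq (f : X.Hom Y) {U : Y.X.Etale} {V : X.X.Etale} {g g' : dom V ⟶ dom U} (h : g = g')
    (hg : g ≫ proj U = proj V ≫ f.f) (hg' : g' ≫ proj U = proj V ≫ f.f) (m : Y.Mon U) :
    f.pull g hg m = f.pull g' hg' m := by subst h; rfl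

/-- Composition of morphisms (`k` first): sections over `U` are pulled back to `U ×_Y X` first. -/
def comp (k : Z.Hom X) (f : X.Hom Y) : Z.Hom Y where
  f := k.f ≫ f.f
  w := by rw [Category.assoc, f.w, k.w]
  pull {U W} g hg :=
    (k.pull (f.toBase U g (proj W ≫ k.f) (by rw [hg, Category.assoc])) (f.toBase_proj _ _ _ _)).comp
      (f.pull (f.baseFst U) (f.baseFst_proj U))
  res_pull {U V V'} g hg b hg' m := by
    have e : left b ≫ f.toBase U g (proj V ≫ k.f) (by rw [hg, Category.assoc]) =
        f.toBase U (left b ≫ g) (proj V' ≫ k.f) (by rw [hg', Category.assoc]) :=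
      f.base_ext U (by simp) (by simp [← left_proj b])
    exact (k.res_pull _ _ b (by rw [e, toBase_proj]) _).trans (k.pull_eq e _ _ _)
  pull_res {U U' V} g hg a hg' m := by
    have e1 : (f.baseFst U' ≫ left a) ≫ proj U = proj (f.base U') ≫ f.f := by
      rw [Category.assoc, left_proj, baseFst_proj]
    let c : f.base U' ⟶ f.base U := homOfLeft (f.toBase U (f.baseFst U' ≫ left a) _ e1)
      (f.toBase_proj _ _ _ _)
    have hc : left c = f.toBase U (f.baseFst U' ≫ left a) _ e1 := rfl
    have e2 : left c ≫ f.baseFst U = f.baseFst U' ≫ left a := by rw [hc, toBase_fst]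
    have h1 := f.pull_res (f.baseFst U') (f.baseFst_proj U') a e1 m
    have h2 := f.res_pull (f.baseFst U) (f.baseFst_proj U) c (by rw [e2, e1]) m
    have e3 : f.toBase U' g (proj V ≫ k.f) (by rw [hg, Category.assoc]) ≫ left c =
        f.toBase U (g ≫ left a) (proj V ≫ k.f) (by rw [hg', Category.assoc]) :=
      f.base_ext U (by rw [Category.assoc, e2]; simp [← Category.assoc]) (by simp [left_proj])
    rw [MonoidHom.comp_apply, MonoidHom.comp_apply, h1, ← f.pull_eq e2 (by rw [e2, e1]) e1, ← h2]
    exact (k.pull_res _ _ c (by rw [e3, toBase_proj]) _).trans (k.pull_eq e3 _ _ _)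
  toFn_pull {U V} g hg m := by
    rw [MonoidHom.comp_apply, k.toFn_pull, f.toFn_pull]
    have e := f.toBase_fst U g (proj V ≫ k.f) (by rw [hg, Category.assoc])
    conv_rhs => rw [← e, Scheme.Hom.comp_appTop]
    rfl

end Hom

/-! ### Local conditions, strict morphisms and charts -/

/-- `Q` holds étale locally on `V`: there is a covering sieve of `V` in the small étale site
on all of whose members `Q` holds. -/
def LocallyOn {X : Scheme.{0}} (V : X.Etale) (Q : ∀ ⦃W : X.Etale⦄, (W ⟶ V) → Prop) : Prop :=
  ∃ S ∈ X.smallEtaleTopology V, ∀ ⦃W : X.Etale⦄ (b : W ⟶ V), S b → Q b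

/-- `f : X ⟶ Y` is strict: the map from the inverse image log structure, i.e. the pushout of
`f⁻¹ M_Y ← f⁻¹ 𝒪_Y^* → 𝒪_X^*`, to `M_X` is an isomorphism. The first clause is its surjectivity
and the second one its injectivity, as a map of étale sheaves. -/
def Hom.IsStrict {X Y : LogScheme} (f : X.Hom Y) : Prop :=
  (∀ (V : X.X.Etale) (m : X.Mon V), LocallyOn V fun W b ↦
    ∃ (U : Y.X.Etale) (g : dom W ⟶ dom U) (hg : g ≫ proj U = proj W ≫ f.f)
      (n : Y.Mon U) (u : (X.Mon W)ˣ), X.res b m = f.pull g hg n * u) ∧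
  (∀ (U : Y.X.Etale) (V : X.X.Etale) (g : dom V ⟶ dom U) (hg : g ≫ proj U = proj V ≫ f.f)
    (n n' : Y.Mon U) (u : (X.Mon V)ˣ), f.pull g hg n = f.pull g hg n' * u →
    LocallyOn V fun W b ↦
      ∃ (U' : Y.X.Etale) (a : U' ⟶ U) (g' : dom W ⟶ dom U')
        (hg' : g' ≫ proj U' = proj W ≫ f.f) (w : (Y.Mon U')ˣ),
        g' ≫ left a = left b ≫ g ∧ Y.res a n = Y.res a n' * w ∧ f.pull g' hg' w = X.res b u)

/-- A strict closed immersion of log schemes. -/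
def Hom.IsStrictClosedImmersion {X Y : LogScheme} (f : X.Hom Y) : Prop :=
  IsClosedImmersion f.f ∧ f.IsStrict

/-- A strict open immersion of log schemes, i.e. up to isomorphism the inclusion of an open
subscheme with the restricted log structure. -/
def Hom.IsStrictOpenImmersion {X Y : LogScheme} (f : X.Hom Y) : Prop :=
  IsOpenImmersion f.f ∧ f.IsStrict

/-- A strict étale morphism of log schemes. -/
def Hom.IsStrictEtale {X Y : LogScheme} (f : X.Hom Y) : Prop :=
  Etale f.f ∧ f.IsStrict

/-- `β : P → M(U)` is a chart over `U`: the map from the log structure associated with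
`P → 𝒪_U`, i.e. the pushout of `P ← (α ∘ β)⁻¹ 𝒪_U^* → 𝒪_U^*`, to the restriction of `M` to `U`
is an isomorphism. The first clause is its surjectivity and the second one its injectivity,
as a map of étale sheaves. -/
def IsChart (X : LogScheme) (U : X.X.Etale) {P : Type} [CommMonoid P] (β : P →* X.Mon U) : Prop :=
  (∀ (V : X.X.Etale) (b : V ⟶ U) (m : X.Mon V), LocallyOn V fun W c ↦
    ∃ (p : P) (u : (X.Mon W)ˣ), X.res c m = X.res (c ≫ b) (β p) * u) ∧
  (∀ (V : X.X.Etale) (b : V ⟶ U) (p q : P) (u : (X.Mon V)ˣ),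
    X.res b (β p) = X.res b (β q) * u → LocallyOn V fun _ c ↦
      ∃ r s : P, IsUnit (X.res (c ≫ b) (β r)) ∧ IsUnit (X.res (c ≫ b) (β s)) ∧
        p * r = q * s ∧ X.res (c ≫ b) (β s) = X.res c u * X.res (c ≫ b) (β r))

/-- A fine monoid: finitely generated and integral (cancellative). -/
def IsFineMonoid (P : Type) [CommMonoid P] : Prop :=
  Monoid.FG P ∧ IsCancelMul P

/-- A fine and saturated monoid. The last condition says that an element `a / b` of the group
completion lies in `P` as soon as a positive power of it does. -/
def IsFsMonoid (P : Type) [CommMonoid P] : Prop :=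
  IsFineMonoid P ∧ ∀ (n : ℕ), 0 < n → ∀ a b : P, (∃ c, a ^ n = b ^ n * c) → ∃ c, a = b * c

/-- A fine log scheme: étale locally there is a chart by a fine monoid. -/
def IsFine (X : LogScheme) : Prop :=
  ∀ x : X.X, ∃ U : X.X.Etale, x ∈ Set.range (proj U) ∧
    ∃ (P : Type) (_ : CommMonoid P) (β : P →* X.Mon U), IsFineMonoid P ∧ X.IsChart U β

/-- A fine and saturated log scheme: étale locally there is a chart by a fine and saturated
monoid. -/
def IsFs (X : LogScheme) : Prop :=
  ∀ x : X.X, ∃ U : X.X.Etale, x ∈ Set.range (proj U) ∧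
    ∃ (P : Type) (_ : CommMonoid P) (β : P →* X.Mon U), IsFsMonoid P ∧ X.IsChart U β

/-! ### Log smoothness and projectivity -/

/-- `i : S → T` is a log thickening of order one: a strict closed immersion whose ideal has
square zero. -/
def Hom.IsFirstOrderThickening {S T : LogScheme} (i : S.Hom T) : Prop :=
  i.IsStrictClosedImmersion ∧
    ∀ (U : T.X.Opens) (a b : Γ(T.X, U)), i.f.app U a = 0 → i.f.app U b = 0 → a * b = 0

/-- `X` is log smooth over `Spec ℂ` with its trivial log structure: the underlying morphism is
locally of finite presentation, and every morphism `f : S → X` over `ℂ` extends, étale locally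
on `T`, along every log thickening `S → T` of order one into a fine log scheme. -/
def IsLogSmooth (X : LogScheme) : Prop :=
  LocallyOfFinitePresentation X.str ∧
  ∀ (S T : LogScheme) (i : S.Hom T) (f : S.Hom X), T.IsFine → i.IsFirstOrderThickening →
    ∀ t : T.X, ∃ (S' T' : LogScheme) (v : T'.Hom T) (v₀ : S'.Hom S) (i' : S'.Hom T')
      (g : T'.Hom X),
      t ∈ Set.range v.f ∧ v.IsStrictEtale ∧ v₀.IsStrictEtale ∧
      IsPullback v₀.f i'.f i.f v.f ∧ v₀.comp i = i'.comp v ∧ i'.comp g = v₀.comp f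

end LogScheme

/-- The standard grading of the polynomial ring. -/
instance gradedPoly (n : ℕ) : GradedAlgebra (MvPolynomial.homogeneousSubmodule (Fin (n + 1)) ℂ) :=
  MvPolynomial.gradedAlgebra

/-- Projective space `ℙⁿ` over `ℂ`. -/
def projSpace (n : ℕ) : Scheme.{0} :=
  Proj (MvPolynomial.homogeneousSubmodule (Fin (n + 1)) ℂ)

/-- The structure morphism of projective space. -/
def projSpaceStr (n : ℕ) : projSpace n ⟶ Spec (.of ℂ) :=
  Proj.toSpecZero (MvPolynomial.homogeneousSubmodule (Fin (n + 1)) ℂ) ≫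
    Spec.map (CommRingCat.ofHom
      (algebraMap ℂ (MvPolynomial.homogeneousSubmodule (Fin (n + 1)) ℂ 0)))

namespace LogScheme

/-- The underlying scheme of `X` is projective over `ℂ`. -/
def IsProjective (X : LogScheme) : Prop :=
  ∃ (n : ℕ) (j : X.X ⟶ projSpace n), IsClosedImmersion j ∧ j ≫ projSpaceStr n = X.str

end LogScheme

/-- Log varieties over `ℂ`: fine and saturated log schemes over `Spec ℂ` (with its trivial log
structure) whose underlying scheme is of finite type and separated over `ℂ`. -/
structure LogVar extends LogScheme where
  isFs : toLogScheme.IsFs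
  locallyOfFiniteType : LocallyOfFiniteType str
  quasiCompact : QuasiCompact str
  isSeparated : IsSeparated str

end LogGeom

end

/-! The projective line carries two log structures that are log smooth and projective over ℂ: the
trivial one, and the one given by the divisor of the two points where a homogeneous coordinate
vanishes. Suppose φ is additive. Cutting the two points out of the line, one after the other, leaves
the multiplicative group with trivial log structure in both cases. In the trivial case each removed
piece is an ordinary point. In the other case it is the standard log point, `Spec ℂ` with the log
structure ℕ × ℂˣ. Hence φ(log line) − φ(line) = 2(φ(log point) − φ(point)), which is
`IsAdditive.logLine_sub`, and every coefficient of this difference is even.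

If φ also agreed with the log e-polynomial, the coefficient of u in the difference would be the
difference of the dimensions of the spaces of global log one-forms. On the line with two points this
space is spanned by dt/t (`LogLineData.hodge_eq_one`); on the trivial line it is zero
(`LineData.hodge_eq_zero`). The coefficient is 1, which is odd.

Three verifications carry the weight.

Global one-forms: `forms` is a sheafification, so its sections are studied through their values. A
log form is evaluated on the derivation d/dT at the geometric points with values in an algebraic
closure of ℂ(T) that lie over the overlap of the charts. These values form a sheaf and separate
forms on the line. A `Frame` is a local generator of the log differentials; with it every global
form has value z · dlog of the coordinate for a constant z, because global functions on the line are
constant.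

Log smoothness: a morphism to a chart of the log line amounts to a section of the log structure of
the source, the image of the coordinate (`homOfSection`). Along a strict thickening with fine target
such a section lifts étale locally (`LogLineData.exists_lift_t`).

Strictness: the section `gen` of the log point maps it to the origin of either chart, and
`homOfSection_gen_isStrict` shows that this inclusion is strict. -/

noncomputable section

namespace LogGeom

/-! ### The small étale site -/

section Site

/-- The terminal object of the small étale site. -/
def top (X : Scheme.{0}) : X.Etale := Scheme.Etale.mk (𝟙 X)

lemma etaleHom_ext {X : Scheme.{0}} {U V : X.Etale} {a b : U ⟶ V} (h : left a = left b) : a = b :=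
  (Scheme.Etale.forget X).map_injective (Over.OverMorphism.ext h)

/-- The object `top X` is terminal. -/
def isTerminalTop (X : Scheme.{0}) : IsTerminal (top X) :=
  IsTerminal.ofUniqueHom (fun U => homOfLeft (proj U) (by exact Category.comp_id _)) (by
    intro U m
    exact etaleHom_ext ((Category.comp_id _).symm.trans (left_proj m)))

/-- Coverings in the small étale site are the jointly surjective families, so local existence may be
proved one point at a time. Every later gluing argument passes through this criterion. -/
lemma mem_topology_iff {X : Scheme.{0}} {V : X.Etale} (S : Sieve V) :
    S ∈ X.smallEtaleTopology V ↔
      ∀ v : dom V, ∃ (W : X.Etale) (b : W ⟶ V), S b ∧ v ∈ Set.range (left b) := by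
  obtain ⟨ι, Z, f, rfl⟩ := S.exists_eq_ofArrows
  rw [Scheme.ofArrows_mem_smallEtaleTopology_iff, Set.eq_univ_iff_forall]
  refine forall_congr' fun v => ?_
  simp only [Set.mem_iUnion]
  constructor
  · rintro ⟨i, hi⟩
    exact ⟨Z i, f i, Sieve.ofArrows_mk _ _ i, hi⟩
  · rintro ⟨W, b, ⟨Y, c, _, ⟨i⟩, rfl⟩, w, rfl⟩
    exact ⟨i, left c w, rfl⟩

/-- Needed to transport the sheaf property of functions from the big étale site to the small one. -/
lemma coverPreserving_forget (X : Scheme.{0}) :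
    CoverPreserving X.smallEtaleTopology (Scheme.etaleTopology.over X) (Scheme.Etale.forget X) := by
  refine ⟨fun {U S} hS => ?_⟩
  rw [GrothendieckTopology.mem_over_iff]
  choose W b hS hb using (mem_topology_iff S).1 hS
  let 𝒰 : Scheme.Cover (Scheme.precoverage @Etale) (dom U) :=
    Scheme.Cover.mkOfCovers (dom U) (fun w => dom (W w)) (fun w => left (b w))
      (fun w => ⟨w, hb w⟩) fun w => inferInstanceAs (Etale (CommaMorphism.left _))
  refine (Scheme.mem_grothendieckTopology_iff (P := @Etale)).2 ⟨𝒰, ?_⟩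
  rintro _ _ ⟨w⟩
  exact (Sieve.overEquiv_iff _ _).2 ⟨W w, b w, Over.homMk (𝟙 (dom (W w))) (by
    exact (Category.id_comp _).trans (left_proj (b w)).symm), hS w, Over.OverMorphism.ext
      (Category.id_comp (left (b w))).symm⟩

instance isContinuous_forget (X : Scheme.{0}) :
    (Scheme.Etale.forget X ⋙ Over.forget X).IsContinuous X.smallEtaleTopology
      Scheme.etaleTopology := by
  have : RepresentablyFlat (Scheme.Etale.forget X) := flat_of_preservesFiniteLimits _
  have : (Scheme.Etale.forget X).IsContinuous X.smallEtaleTopology (Scheme.etaleTopology.over X) := by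
    rw [Functor.isContinuous_iff_coverPreserving]
    exact coverPreserving_forget X
  exact Functor.isContinuous_comp _ _ _ (Scheme.etaleTopology.over X) _

/-- Global functions are represented by the affine line over ℤ, and the étale topology is coarser
than the fppf topology, which is subcanonical. -/
lemma isSheaf_globalSections :
    Presieve.IsSheaf Scheme.etaleTopology (Scheme.Γ.{0} ⋙ forget CommRingCat) := by
  have h : Scheme.etaleTopology.{0} ≤ Scheme.fppfTopology :=
    Scheme.grothendieckTopology_monotone fun _ _ _ _ ↦ ⟨inferInstance, inferInstance⟩
  have : (Scheme.Γ.{0} ⋙ forget CommRingCat).IsRepresentable :=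
    ⟨_, ⟨{
      homEquiv := fun {U} =>
        (AffineSpace.toSpecMvPolyIntEquiv PUnit).trans (Equiv.funUnique _ _)
      homEquiv_comp := fun f g => AffineSpace.toSpecMvPolyIntEquiv_comp _ f g PUnit.unit }⟩⟩
  exact Presieve.isSheaf_of_le _ h (GrothendieckTopology.Subcanonical.isSheaf_of_isRepresentable _)

lemma isSheaf_etaleO (X : Scheme.{0}) :
    Presieve.IsSheaf X.smallEtaleTopology (etaleO X ⋙ forget CommRingCat) :=
  Functor.op_comp_isSheaf_of_types (Scheme.Etale.forget X ⋙ Over.forget X) _ _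
    ⟨_, (isSheaf_iff_isSheaf_of_type _ _).2 isSheaf_globalSections⟩

/-- Sections of a sheaf that exist locally and are unique glue. -/
lemma exists_of_locally {C : Type*} [Category C] {J : GrothendieckTopology C} {F : Cᵒᵖ ⥤ Type*}
    (hF : Presieve.IsSheaf J F) {V : C}
    (P : ∀ ⦃W : C⦄, (W ⟶ V) → F.obj (op W) → Prop)
    (hres : ∀ ⦃W W' : C⦄ (b : W ⟶ V) (c : W' ⟶ W) m, P b m → P (c ≫ b) (F.map c.op m))
    (huniq : ∀ ⦃W : C⦄ (b : W ⟶ V) m m', P b m → P b m' → m = m')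
    {S : Sieve V} (hS : S ∈ J V) (hex : ∀ ⦃W⦄ (b : W ⟶ V), S b → ∃ m, P b m) :
    ∃ m : F.obj (op V), ∀ ⦃W⦄ (b : W ⟶ V), S b → P b (F.map b.op m) := by
  choose x hx using hex
  have hc : Presieve.FamilyOfElements.Compatible (P := F) (R := S.arrows) (fun W b hb => x b hb) :=
    (Presieve.compatible_iff_sieveCompatible _).2 fun Y Z f g hf =>
      huniq _ _ _ (hx _ _) (hres _ _ _ (hx _ _))
  obtain ⟨m, hm, -⟩ := hF S hS _ hc
  refine ⟨m, fun W b hb => ?_⟩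
  have := hm b hb
  exact this ▸ hx _ _

lemma eq_of_locally {C : Type*} [Category C] {J : GrothendieckTopology C} {F : Cᵒᵖ ⥤ Type*}
    (hF : Presieve.IsSheaf J F) {V : C} {m m' : F.obj (op V)} {S : Sieve V} (hS : S ∈ J V)
    (h : ∀ ⦃W⦄ (b : W ⟶ V), S b → F.map b.op m = F.map b.op m') : m = m' :=
  (hF S hS).isSeparatedFor.ext h

variable {X : Scheme.{0}}

namespace LogScheme.LocallyOn

variable {V : X.Etale} {Q Q' : ∀ ⦃W : X.Etale⦄, (W ⟶ V) → Prop}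

lemma of_cover (hQ : ∀ ⦃W W' : X.Etale⦄ (b : W ⟶ V) (c : W' ⟶ W), Q b → Q (c ≫ b))
    (h : ∀ v : dom V, ∃ (W : X.Etale) (b : W ⟶ V), v ∈ Set.range (left b) ∧ Q b) :
    LocallyOn V Q := by
  refine ⟨⟨fun W b => Q b, fun {Y Z} f hf g => hQ f g hf⟩, ?_, fun W b hb => hb⟩
  rw [mem_topology_iff]
  intro v
  obtain ⟨W, b, h1, h2⟩ := h v
  exact ⟨W, b, h2, h1⟩

lemma exists_mem (h : LocallyOn V Q) (v : dom V) :
    ∃ (W : X.Etale) (b : W ⟶ V), v ∈ Set.range (left b) ∧ Q b := by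
  obtain ⟨S, hS, h⟩ := h
  obtain ⟨W, b, h1, h2⟩ := (mem_topology_iff S).1 hS v
  exact ⟨W, b, h2, h b h1⟩

lemma mono (h : LocallyOn V Q) (hQ : ∀ ⦃W : X.Etale⦄ (b : W ⟶ V), Q b → Q' b) :
    LocallyOn V Q' := by
  obtain ⟨S, hS, h⟩ := h
  exact ⟨S, hS, fun W b hb => hQ b (h b hb)⟩

lemma and (h : LocallyOn V Q) (h' : LocallyOn V Q') : LocallyOn V fun _ b => Q b ∧ Q' b := by
  obtain ⟨S, hS, h⟩ := h
  obtain ⟨S', hS', h'⟩ := h'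
  exact ⟨S ⊓ S', X.smallEtaleTopology.intersection_covering hS hS',
    fun W b hb => ⟨h b hb.1, h' b hb.2⟩⟩

lemma pullback (h : LocallyOn V Q) {W : X.Etale} (b : W ⟶ V) :
    LocallyOn W fun _ c => Q (c ≫ b) := by
  obtain ⟨S, hS, h⟩ := h
  exact ⟨S.pullback b, X.smallEtaleTopology.pullback_stable _ hS, fun W b hb => h _ hb⟩

lemma bind (h : LocallyOn V fun W b => LocallyOn W fun _ c => Q (c ≫ b)) : LocallyOn V Q := by
  obtain ⟨S, hS, h⟩ := h
  choose T hT hQ using h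
  refine ⟨Sieve.bind S.arrows T, X.smallEtaleTopology.bind_covering hS hT, ?_⟩
  rintro W _ ⟨Y, g, f, hf, hg, rfl⟩
  exact hQ f hf g hg

lemma of_forall (h : ∀ ⦃W : X.Etale⦄ (b : W ⟶ V), Q b) : LocallyOn V Q :=
  ⟨⊤, X.smallEtaleTopology.top_mem _, fun W b _ => h b⟩

end LogScheme.LocallyOn

/-- An étale `dom U`-scheme seen as an étale `X`-scheme. -/
def push (U : X.Etale) (V : (dom U).Etale) : X.Etale := Scheme.Etale.mk (proj V ≫ proj U)

/-- A morphism of étale `dom U`-schemes seen as a morphism of étale `X`-schemes. -/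
def pushMap (U : X.Etale) {V W : (dom U).Etale} (b : V ⟶ W) : push U V ⟶ push U W :=
  homOfLeft (V := push U V) (U := push U W) (left b : dom V ⟶ dom W) (by
    change left b ≫ proj W ≫ proj U = proj V ≫ proj U
    rw [← Category.assoc, left_proj])

/-- The functor `push`. -/
def pushFunctor (U : X.Etale) : (dom U).Etale ⥤ X.Etale where
  obj := push U
  map b := pushMap U b
  map_id _ := rfl
  map_comp _ _ := rfl

/-- A map to `push U V` as a morphism of schemes to `V`. -/
def leftPush {U : X.Etale} {V : (dom U).Etale} {W : X.Etale} (b : W ⟶ push U V) :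
    dom W ⟶ dom V := left b

lemma leftPush_proj {U : X.Etale} {V : (dom U).Etale} {W : X.Etale} (b : W ⟶ push U V) :
    leftPush b ≫ proj V ≫ proj U = proj W := left_proj b

instance {U : X.Etale} {V : (dom U).Etale} {W : X.Etale} (b : W ⟶ push U V) :
    Etale (leftPush b) := inferInstanceAs (Etale (CommaMorphism.left _))

/-- The source of a map to `push U V` as an étale `dom U`-scheme. -/
def unpush {U : X.Etale} {V : (dom U).Etale} {W : X.Etale} (b : W ⟶ push U V) : (dom U).Etale :=
  Scheme.Etale.mk (leftPush b ≫ proj V)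

/-- A map to `push U V` as a morphism of étale `dom U`-schemes. -/
def unpushMap {U : X.Etale} {V : (dom U).Etale} {W : X.Etale} (b : W ⟶ push U V) :
    unpush b ⟶ V := homOfLeft (V := unpush b) (leftPush b) rfl

/-- A morphism to `dom U'` over `X` seen as a morphism of étale schemes. -/
def toPush {U U' : X.Etale} {V : (dom U).Etale} (g : dom V ⟶ dom U')
    (hg : g ≫ proj U' = proj V ≫ proj U) : push U V ⟶ U' := homOfLeft (V := push U V) g hg

/-- The comparison isomorphism, one way. -/
def pushUnpush {U : X.Etale} {V : (dom U).Etale} {W : X.Etale} (b : W ⟶ push U V) :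
    W ⟶ push U (unpush b) :=
  homOfLeft (U := push U (unpush b)) (𝟙 (dom W)) (by
    have := leftPush_proj b
    rw [← Category.assoc] at this
    exact (Category.id_comp _).trans this)

/-- The comparison isomorphism, the other way. -/
def unpushPush {U : X.Etale} {V : (dom U).Etale} {W : X.Etale} (b : W ⟶ push U V) :
    push U (unpush b) ⟶ W :=
  toPush (V := unpush b) (𝟙 (dom W)) (by
    have := leftPush_proj b
    rw [← Category.assoc] at this
    exact (Category.id_comp _).trans this.symm)

lemma pushUnpush_comp {U : X.Etale} {V : (dom U).Etale} {W : X.Etale} (b : W ⟶ push U V) :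
    pushUnpush b ≫ pushMap U (unpushMap b) = b := etaleHom_ext (Category.id_comp (leftPush b))

lemma unpushPush_comp {U : X.Etale} {V : (dom U).Etale} {W : X.Etale} (b : W ⟶ push U V) :
    unpushPush b ≫ b = pushMap U (unpushMap b) := etaleHom_ext (Category.id_comp (leftPush b))

instance (U : X.Etale) : (pushFunctor U).IsContinuous (dom U).smallEtaleTopology
    X.smallEtaleTopology := by
  refine Functor.isContinuous_of_coverPreserving ⟨?_⟩ ⟨?_⟩
  · intro ℱ Z T x hx Y1 Y2 W f1 f2 g1 g2 hg1 hg2 h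
    have h' : leftPush f1 ≫ left g1 = leftPush f2 ≫ left g2 := congrArg left h
    -- The two maps out of `W` each make it an étale scheme over `dom U`. The structures coincide
    -- because both maps continue to the same map to `Z`, so compatibility over `X` can be read off
    -- from compatibility over `dom U`.
    have hc : leftPush f2 ≫ proj Y2 = proj (unpush f1) := by
      change _ = leftPush f1 ≫ proj Y1
      rw [← left_proj g1, ← left_proj g2, ← Category.assoc, ← Category.assoc, h']
    let c2 : unpush f1 ⟶ Y2 := homOfLeft (V := unpush f1) (leftPush f2) hc
    have h1 := hx (unpushMap f1) c2 hg1 hg2 (etaleHom_ext h')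
    have h2 := congrArg (ℱ.obj.map (pushUnpush f1).op) h1
    have e2 : pushUnpush f1 ≫ pushMap U c2 = f2 :=
      etaleHom_ext (Category.id_comp (leftPush f2))
    have key : ∀ {Y : (dom U).Etale} (c : unpush f1 ⟶ Y) (m : ℱ.obj.obj (op (push U Y)))
        (f : W ⟶ push U Y) (e : pushUnpush f1 ≫ pushMap U c = f),
        ℱ.obj.map (pushUnpush f1).op (ℱ.obj.map (pushMap U c).op m) = ℱ.obj.map f.op m := by
      rintro Y c m _ rfl
      rw [op_comp, Functor.map_comp]; rfl
    exact (key (unpushMap f1) (x g1 hg1) f1 (pushUnpush_comp f1)).symm.trans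
      (h2.trans (key c2 (x g2 hg2) f2 e2))
  · intro V S hS
    rw [mem_topology_iff] at hS ⊢
    intro v
    obtain ⟨W, b, h1, h2⟩ := hS v
    exact ⟨push U W, pushMap U b, ⟨W, b, 𝟙 _, h1, (Category.id_comp _).symm⟩, h2⟩

/-- The open subscheme `O` of an étale `X`-scheme. -/
def sub (V : X.Etale) (O : (dom V).Opens) : X.Etale := Scheme.Etale.mk (O.ι ≫ proj V)

/-- The inclusion of an open subscheme. -/
def subι (V : X.Etale) (O : (dom V).Opens) : sub V O ⟶ V := homOfLeft O.ι rfl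

lemma range_subι (V : X.Etale) (O : (dom V).Opens) : Set.range (left (subι V O)) = O :=
  Scheme.Opens.range_ι O

instance (V : X.Etale) (O : (dom V).Opens) : IsOpenImmersion (left (subι V O)) :=
  inferInstanceAs (IsOpenImmersion O.ι)

instance etale_left {U V : X.Etale} (b : U ⟶ V) : Etale (left b) :=
  inferInstanceAs (Etale (CommaMorphism.left _))

end Site

/-! ### Locality and gluing of sections, and equality and composition of morphisms of log schemes.
-/

namespace LogScheme

variable (X : LogScheme)

lemma isSheaf_M : Presieve.IsSheaf X.X.smallEtaleTopology (X.M.obj ⋙ forget CommMonCat) :=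
  (isSheaf_iff_isSheaf_of_type _ _).1 (Presheaf.isSheaf_comp_of_isSheaf _ _ _ X.M.property)

variable {X}

lemma mon_ext {V : X.X.Etale} {m m' : X.Mon V}
    (h : LocallyOn V fun _ b => X.res b m = X.res b m') : m = m' := by
  obtain ⟨S, hS, h⟩ := h
  exact eq_of_locally X.isSheaf_M hS h

lemma fn_ext {V : X.X.Etale} {m m' : X.Fn V}
    (h : LocallyOn V fun _ b => X.resFn b m = X.resFn b m') : m = m' := by
  obtain ⟨S, hS, h⟩ := h
  exact eq_of_locally (isSheaf_etaleO X.X) hS h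

lemma mon_glue {V : X.X.Etale} (P : ∀ ⦃W : X.X.Etale⦄, (W ⟶ V) → X.Mon W → Prop)
    (hres : ∀ ⦃W W' : X.X.Etale⦄ (b : W ⟶ V) (c : W' ⟶ W) m, P b m → P (c ≫ b) (X.res c m))
    (huniq : ∀ ⦃W : X.X.Etale⦄ (b : W ⟶ V) m m', P b m → P b m' → m = m')
    (hex : LocallyOn V fun _ b => ∃ m, P b m) :
    ∃ m : X.Mon V, LocallyOn V fun _ b => P b (X.res b m) := by
  obtain ⟨S, hS, hex⟩ := hex
  obtain ⟨m, hm⟩ := exists_of_locally X.isSheaf_M P hres huniq hS hex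
  exact ⟨m, S, hS, hm⟩

lemma fn_glue {V : X.X.Etale} (P : ∀ ⦃W : X.X.Etale⦄, (W ⟶ V) → X.Fn W → Prop)
    (hres : ∀ ⦃W W' : X.X.Etale⦄ (b : W ⟶ V) (c : W' ⟶ W) m, P b m → P (c ≫ b) (X.resFn c m))
    (huniq : ∀ ⦃W : X.X.Etale⦄ (b : W ⟶ V) m m', P b m → P b m' → m = m')
    (hex : LocallyOn V fun _ b => ∃ m, P b m) :
    ∃ m : X.Fn V, LocallyOn V fun _ b => P b (X.resFn b m) := by
  obtain ⟨S, hS, hex⟩ := hex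
  obtain ⟨m, hm⟩ := exists_of_locally (isSheaf_etaleO X.X) P hres huniq hS hex
  exact ⟨m, S, hS, hm⟩

@[simp] lemma res_id (V : X.X.Etale) (m : X.Mon V) : X.res (𝟙 V) m = m :=
  congr($(X.M.obj.map_id (op V)) m)

lemma res_comp {U V W : X.X.Etale} (b : V ⟶ U) (c : W ⟶ V) (m : X.Mon U) :
    X.res (c ≫ b) m = X.res c (X.res b m) :=
  congr($(X.M.obj.map_comp b.op c.op) m)

@[simp] lemma resFn_id (V : X.X.Etale) (m : X.Fn V) : X.resFn (𝟙 V) m = m :=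
  congr($((etaleO X.X).map_id (op V)) m)

lemma resFn_comp {U V W : X.X.Etale} (b : V ⟶ U) (c : W ⟶ V) (m : X.Fn U) :
    X.resFn (c ≫ b) m = X.resFn c (X.resFn b m) :=
  congr($((etaleO X.X).map_comp b.op c.op) m)

/-- The section of `M` given by a unit. -/
lemma exists_toFn_eq {V : X.X.Etale} {x : X.Fn V} (hx : IsUnit x) : ∃ m, X.toFn V m = x :=
  (X.unit V x hx).exists

lemma toFn_inj {V : X.X.Etale} {m m' : X.Mon V} (hx : IsUnit (X.toFn V m))
    (h : X.toFn V m = X.toFn V m') : m = m' :=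
  (X.unit V _ hx).unique rfl h.symm

/-- The inverse function also lifts to `M`, and the product of the two lifts is the only lift of 1.
-/
lemma isUnit_toFn {V : X.X.Etale} {m : X.Mon V} : IsUnit (X.toFn V m) ↔ IsUnit m := by
  refine ⟨fun h => ?_, fun h => h.map _⟩
  obtain ⟨y, hy⟩ := isUnit_iff_exists_inv.1 h
  have hy' : IsUnit y := IsUnit.of_mul_eq_one _ (by rw [mul_comm]; exact hy)
  obtain ⟨n, rfl⟩ := exists_toFn_eq hy'
  rw [← map_mul] at hy
  exact IsUnit.of_mul_eq_one n (toFn_inj (by rw [hy]; exact isUnit_one) (by rw [hy, map_one]))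

namespace Hom

variable {X Y Z : LogScheme}

lemma ext' {f f' : X.Hom Y} (h : f.f = f'.f)
    (h' : ∀ {U : Y.X.Etale} {V : X.X.Etale} (g : dom V ⟶ dom U) (hg : g ≫ proj U = proj V ≫ f.f)
      (hg' : g ≫ proj U = proj V ≫ f'.f) (m : Y.Mon U), f.pull g hg m = f'.pull g hg' m) :
    f = f' := by
  obtain ⟨f, _, p, _, _, _⟩ := f
  obtain ⟨f', _, p', _, _, _⟩ := f'
  obtain rfl : f = f' := h
  have : @p = @p' := by
    funext U V g hg
    ext m
    exact h' g hg hg m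
  subst this
  rfl

/-- Composition is defined through the universal étale scheme `f.base U`. Any other intermediate `V`
maps to it, so the composite can be computed through whichever `V` is convenient. -/
lemma comp_pull (k : Z.Hom X) (f : X.Hom Y) {U : Y.X.Etale} {V : X.X.Etale} {W : Z.X.Etale}
    (g : dom W ⟶ dom V) (hg : g ≫ proj V = proj W ≫ k.f) (h : dom V ⟶ dom U)
    (hh : h ≫ proj U = proj V ≫ f.f) (e : (g ≫ h) ≫ proj U = proj W ≫ (k.comp f).f) (m : Y.Mon U) :
    (k.comp f).pull (g ≫ h) e m = k.pull g hg (f.pull h hh m) := by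
  let c : V ⟶ f.base U := homOfLeft (f.toBase U h (proj V) hh) (f.toBase_proj _ _ _ _)
  have hc : left c = f.toBase U h (proj V) hh := rfl
  have e1 : left c ≫ f.baseFst U = h := by rw [hc, toBase_fst]
  have e2 : g ≫ left c = f.toBase U (g ≫ h) (proj W ≫ k.f) (by rw [e, Category.assoc]; rfl) :=
    f.base_ext U (by simp [hc]) (by simp [hc, hg])
  have h1 := f.res_pull (f.baseFst U) (f.baseFst_proj U) c (by rw [e1, hh]) m
  rw [f.pull_eq e1 _ hh] at h1
  rw [← h1, k.pull_res g hg c (by rw [e2, toBase_proj])]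
  exact (k.pull_eq e2 _ _ _).symm

/-- The pullback of a unit is determined by the underlying morphism. -/
lemma pull_eq_of_isUnit {f f' : X.Hom Y} (h : f.f = f'.f) {U : Y.X.Etale} {V : X.X.Etale}
    (g : dom V ⟶ dom U) (hg : g ≫ proj U = proj V ≫ f.f) (hg' : g ≫ proj U = proj V ≫ f'.f)
    {m : Y.Mon U} (hm : IsUnit m) : f.pull g hg m = f'.pull g hg' m :=
  X.toFn_inj (isUnit_toFn.2 (hm.map _)) (by rw [f.toFn_pull, f'.toFn_pull])

end Hom

/-! ### Restriction to an étale scheme -/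

variable (X) in
/-- The restriction of a log scheme to an étale scheme. -/
def restr (U : X.X.Etale) : LogScheme where
  X := dom U
  str := proj U ≫ X.str
  M := ((pushFunctor U).sheafPushforwardContinuous _ _ _).obj X.M
  α := { app := fun V => X.α.app (op (push U V.unop))
         naturality := fun V W b => X.α.naturality (pushMap U b.unop).op }
  unit V x hx := X.unit (push U V) x hx

variable (X) in
/-- The inclusion of the restriction. -/
def restrHom (U : X.X.Etale) : (X.restr U).Hom X where
  f := proj U
  w := rfl
  pull {U' V} g hg := X.res (toPush g hg)
  res_pull {U' V V'} g hg b hg' m := (X.res_comp (toPush g hg) (pushMap U b) m).symm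
  pull_res {U₁ U₂ V} g hg a hg' m := (X.res_comp a (toPush g hg) m).symm
  toFn_pull {U' V} g hg m := X.toFn_res (toPush g hg) m

/-- Sections of the restriction over `W` are by definition sections of `M` over `push U W`, so this
étale `X`-scheme and the identity map are witnesses for both clauses. -/
lemma restrHom_isStrict (U : X.X.Etale) : (X.restrHom U).IsStrict := by
  refine ⟨fun V m => LocallyOn.of_forall fun W b => ?_, fun U' V g hg n n' u h =>
    LocallyOn.of_forall fun W b => ?_⟩
  · refine ⟨push U W, 𝟙 (dom W), Category.id_comp _, X.res (pushMap U b) m, 1, ?_⟩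
    exact (X.res_id (push U W) _).symm.trans (mul_one _).symm
  · let a : push U W ⟶ U' := pushMap U b ≫ toPush g hg
    refine ⟨push U W, a, 𝟙 (dom W), Category.id_comp _, Units.map (X.res (pushMap U b)) u,
      Category.id_comp (left b ≫ g), ?_, X.res_id (push U W) _⟩
    have h2 := congrArg (X.res (pushMap U b)) h
    exact (X.res_comp _ _ _).trans (h2.trans ((map_mul (X.res (pushMap U b)) _ _).trans
      (congrArg (· * _) (X.res_comp _ _ _).symm)))

lemma restrHom_isStrictEtale (U : X.X.Etale) : (X.restrHom U).IsStrictEtale :=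
  ⟨inferInstanceAs (Etale (proj U)), restrHom_isStrict U⟩

lemma comp_push_eq {S T : Scheme.{0}} {U : S.Etale} {f : T ⟶ S} {l : T ⟶ dom U}
    (hl : l ≫ proj U = f) {U' : (dom U).Etale} {V : T.Etale} {g : dom V ⟶ dom U'}
    (hg : g ≫ proj U' = proj V ≫ l) : g ≫ proj U' ≫ proj U = proj V ≫ f := by
  rw [← hl, ← Category.assoc, hg, Category.assoc]

/-- The lift of a morphism to the restriction. -/
def Hom.lift {Y : LogScheme} (h : Y.Hom X) (U : X.X.Etale) (l : Y.X ⟶ dom U)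
    (hl : l ≫ proj U = h.f) : Y.Hom (X.restr U) where
  f := l
  w := by rw [← h.w, ← hl, Category.assoc]; rfl
  pull {U' V} g hg := h.pull (U := push U U') g (comp_push_eq hl hg)
  res_pull g hg b hg' m := h.res_pull (U := push U _) _ _ _ _ _
  pull_res g hg a hg' m := h.pull_res _ _ (pushMap U a) _ m
  toFn_pull g hg m := h.toFn_pull (U := push U _) _ _ _

lemma Hom.lift_comp {Y : LogScheme} (h : Y.Hom X) (U : X.X.Etale) (l : Y.X ⟶ dom U)
    (hl : l ≫ proj U = h.f) : (h.lift U l hl).comp (X.restrHom U) = h := by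
  refine Hom.ext' hl fun {U' V} g hg hg' m => ?_
  have h1 := Hom.toBase_proj (X.restrHom U) U' g (proj V ≫ l) (hg.trans (Category.assoc _ _ _).symm)
  have h2 := Hom.toBase_fst (X.restrHom U) U' g (proj V ≫ l) (hg.trans (Category.assoc _ _ _).symm)
  have h3 := (X.restrHom U).baseFst_proj U'
  exact (h.pull_res _ (comp_push_eq hl h1) (toPush _ h3)
    ((congrArg (· ≫ proj U') h2).trans hg') m).trans (h.pull_eq h2 _ _ _)

/-- The étale `X`-schemes that witness strictness of `h` are moved over `dom U`: by base change in
the surjectivity clause, and by `unpush` in the injectivity clause, where they already map to `push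
U U'`. -/
lemma Hom.lift_isStrict {Y : LogScheme} {h : Y.Hom X} (hs : h.IsStrict) (U : X.X.Etale)
    (l : Y.X ⟶ dom U) (hl : l ≫ proj U = h.f) : (h.lift U l hl).IsStrict := by
  refine ⟨fun V m => (hs.1 V m).mono ?_, fun U' V g hg n n' u e =>
    (hs.2 (push U U') V g (comp_push_eq hl hg) n n' u e).mono ?_⟩
  · rintro W b ⟨U', g, hg, n, u, e⟩
    have hg2 : g ≫ proj U' = (proj W ≫ l) ≫ (X.restrHom U).f := by
      rw [hg, ← hl]; exact (Category.assoc _ _ _).symm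
    have h1 := Hom.toBase_proj (X.restrHom U) U' g (proj W ≫ l) hg2
    have h2 := Hom.toBase_fst (X.restrHom U) U' g (proj W ≫ l) hg2
    have h3 := (X.restrHom U).baseFst_proj U'
    refine ⟨(X.restrHom U).base U', (X.restrHom U).toBase U' g (proj W ≫ l) hg2,
      h1, X.res (toPush _ h3) n, u, ?_⟩
    rw [e]
    congr 1
    exact ((h.pull_res _ (comp_push_eq hl h1) (toPush _ h3)
      ((congrArg (· ≫ proj U') h2).trans hg) n).trans (h.pull_eq h2 _ _ _)).symm
  · rintro W b ⟨U₁, a, g', hg', w, e1, e2, e3⟩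
    have key : g' ≫ proj (unpush a) = proj W ≫ l := by
      have e1' : g' ≫ leftPush a = left b ≫ g := e1
      exact (Category.assoc _ _ _).symm.trans <| (congrArg (· ≫ proj U') e1').trans <|
        (Category.assoc _ _ _).trans <| (congrArg (left b ≫ ·) hg).trans ((Category.assoc _ _ _).symm.trans
        (congrArg (· ≫ l) (left_proj b)))
    refine ⟨unpush a, unpushMap a, g', key, Units.map (X.res (unpushPush a)) w, e1, ?_, ?_⟩
    · have hr := fun k => (X.res_comp a (unpushPush a) k).symm.trans
        (congrArg (fun c => X.res c k) (unpushPush_comp a))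
      exact (hr n).symm.trans <| (congrArg (X.res (unpushPush a)) e2).trans <|
        (map_mul _ _ _).trans (congrArg (· * _) (hr n'))
    · rw [← e3]
      have h4 : g' ≫ 𝟙 (dom U₁) = g' := Category.comp_id _
      exact (h.pull_res (U := U₁) (U' := push U (unpush a)) g' (comp_push_eq hl key) (unpushPush a)
        ((congrArg (· ≫ proj U₁) h4).trans hg') _).trans (h.pull_eq h4 _ _ _)

lemma LocallyOn.unpush {X : Scheme.{0}} {U : X.Etale} {V : (dom U).Etale}
    {Q : ∀ ⦃W : X.Etale⦄, (W ⟶ push U V) → Prop} (h : LocallyOn (push U V) Q) :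
    LocallyOn V fun _ b => Q (pushMap U b) := by
  obtain ⟨S, hS, h⟩ := h
  refine ⟨S.functorPullback (pushFunctor U), ?_, fun W b hb => h _ hb⟩
  rw [mem_topology_iff] at hS ⊢
  intro v
  obtain ⟨W, b, h1, h2⟩ := hS v
  refine ⟨LogGeom.unpush b, unpushMap b, ?_, h2⟩
  have := S.downward_closed h1 (unpushPush b)
  rw [unpushPush_comp] at this
  exact this

variable {X Y : LogScheme}

lemma IsChart.restr {U₁ : X.X.Etale} {P : Type} [CommMonoid P] {β : P →* X.Mon U₁}
    (h : X.IsChart U₁ β) (U : X.X.Etale) (V : (dom U).Etale) (c : push U V ⟶ U₁) :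
    (X.restr U).IsChart V ((X.res c).comp β) := by
  have e {V' W : (dom U).Etale} (b : V' ⟶ V) (d : W ⟶ V') (p : P) :
      X.res (pushMap U d ≫ pushMap U b ≫ c) (β p) =
        (X.restr U).res (d ≫ b) (X.res c (β p)) := by
    rw [← Category.assoc, X.res_comp]
    rfl
  have e' {V' : (dom U).Etale} (b : V' ⟶ V) (p : P) :
      X.res (pushMap U b ≫ c) (β p) = (X.restr U).res b (X.res c (β p)) := X.res_comp _ _ _
  refine ⟨fun (V' : (dom U).Etale) (b : V' ⟶ V) (m : X.Mon (push U V')) =>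
      (h.1 (push U V') (pushMap U b ≫ c) m).unpush.mono ?_,
    fun (V' : (dom U).Etale) (b : V' ⟶ V) p q (u : (X.Mon (push U V'))ˣ) huv =>
      (h.2 (push U V') (pushMap U b ≫ c) p q u ?_).unpush.mono ?_⟩
  · rintro W d ⟨p, u, hp⟩
    rw [e] at hp
    exact ⟨p, u, hp⟩
  · rw [e', e']
    exact huv
  · rintro W d ⟨r, s, h1, h2, h3, h4⟩
    rw [e] at h1 h2 h4
    rw [e] at h4
    exact ⟨r, s, h1, h2, h3, h4⟩

lemma exists_mem_range_base (f : X.Hom Y) {U : Y.X.Etale} {x : X.X}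
    (hx : f.f x ∈ Set.range (proj U)) : x ∈ Set.range (proj (f.base U)) := by
  obtain ⟨u, hu⟩ := hx
  obtain ⟨z, -, hz⟩ := Scheme.Pullback.exists_preimage_pullback (f := proj U) (g := f.f) u x hu
  exact ⟨z, hz⟩

lemma IsFs.restr (h : X.IsFs) (U : X.X.Etale) : (X.restr U).IsFs := by
  intro x
  obtain ⟨U₁, hx, P, _, β, hP, hβ⟩ := h (proj U x)
  refine ⟨(X.restrHom U).base U₁, exists_mem_range_base (X.restrHom U) hx, P, _, _, hP,
    hβ.restr U _ (toPush _ ((X.restrHom U).baseFst_proj U₁))⟩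

/-! ### Trivial log structures -/

variable (X) in
/-- The section of `M` given by an invertible function. -/
def ofUnit (V : X.X.Etale) : (X.Fn V)ˣ →* X.Mon V :=
  have h (x : (X.Fn V)ˣ) : X.toFn V (exists_toFn_eq x.isUnit).choose = x :=
    (exists_toFn_eq x.isUnit).choose_spec
  { toFun := fun x => (exists_toFn_eq x.isUnit).choose
    map_one' := toFn_inj (by rw [h]; exact Units.isUnit _) (by rw [h, map_one]; rfl)
    map_mul' := fun x y => toFn_inj (by rw [h]; exact Units.isUnit _)
      (by rw [h, map_mul, h, h]; rfl) }

@[simp] lemma toFn_ofUnit (V : X.X.Etale) (x : (X.Fn V)ˣ) : X.toFn V (X.ofUnit V x) = x :=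
  (exists_toFn_eq x.isUnit).choose_spec

variable (X) in
/-- The log structure consists of the units only. -/
def IsTrivial : Prop := ∀ (V : X.X.Etale) (m : X.Mon V), IsUnit m

lemma IsTrivial.restr (h : X.IsTrivial) (U : X.X.Etale) : (X.restr U).IsTrivial :=
  fun V m => h (push U V) m

/-- The pullback of functions along a morphism of étale schemes over different bases. -/
def fnPull {U : X.X.Etale} {V : Y.X.Etale} (g : dom V ⟶ dom U) : X.Fn U →+* Y.Fn V := g.appTop.hom

lemma Hom.toFn_pull' (f : Y.Hom X) {U : X.X.Etale} {V : Y.X.Etale} (g : dom V ⟶ dom U)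
    (hg : g ≫ proj U = proj V ≫ f.f) (m : X.Mon U) :
    Y.toFn V (f.pull g hg m) = fnPull g (X.toFn U m) := f.toFn_pull g hg m

lemma resFn_fnPull {U : X.X.Etale} {V V' : Y.X.Etale} (g : dom V ⟶ dom U) (b : V' ⟶ V)
    (x : X.Fn U) : Y.resFn b (fnPull g x) = fnPull (left b ≫ g) x :=
  congr($((Scheme.Hom.comp_appTop (left b) g).symm) x)

lemma fnPull_resFn {U U' : X.X.Etale} {V : Y.X.Etale} (g : dom V ⟶ dom U') (a : U' ⟶ U)
    (x : X.Fn U) : (fnPull g (X.resFn a x) : Y.Fn V) = fnPull (g ≫ left a) x :=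
  congr($((Scheme.Hom.comp_appTop g (left a)).symm) x)

/-- The function underlying a section of a trivial log structure, as a unit. -/
def IsTrivial.toUnit (hX : X.IsTrivial) (U : X.X.Etale) : X.Mon U →* (X.Fn U)ˣ where
  toFun m := ((hX U m).map (X.toFn U)).unit
  map_one' := Units.ext (map_one _)
  map_mul' m n := Units.ext (map_mul _ _ _)

/-- A morphism of schemes to a scheme with trivial log structure. -/
def homOfTrivial (hX : X.IsTrivial) (f : Y.X ⟶ X.X) (w : f ≫ X.str = Y.str) : Y.Hom X where
  f := f
  w := w
  pull {U V} g hg := (Y.ofUnit V).comp ((Units.map (fnPull g).toMonoidHom).comp (hX.toUnit U))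
  res_pull {U V V'} g hg b hg' m := by
    refine (toFn_inj ?_ ?_).symm
    · exact (toFn_ofUnit V' _).symm ▸ Units.isUnit _
    · exact (toFn_ofUnit V' _).trans (Eq.symm ((Y.toFn_res b _).trans
        ((congrArg _ (toFn_ofUnit V _)).trans (resFn_fnPull g b _))))
  pull_res {U U' V} g hg a hg' m := by
    refine toFn_inj ?_ ?_
    · exact (toFn_ofUnit V _).symm ▸ Units.isUnit _
    · exact (toFn_ofUnit V _).trans (Eq.trans ((congrArg (fnPull g) (X.toFn_res a m)).trans
        (fnPull_resFn g a _))
        (toFn_ofUnit V (Units.map (fnPull (g ≫ left a)).toMonoidHom (hX.toUnit U m))).symm)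
  toFn_pull {U V} g hg m := toFn_ofUnit V _

/-- All sections are units: every section is 1 times a unit, and `n` differs from `n'` by the unit
n'⁻¹n. -/
lemma IsTrivial.isStrict (hX : X.IsTrivial) (hY : Y.IsTrivial) (f : Y.Hom X) : f.IsStrict := by
  refine ⟨fun V m => LocallyOn.of_forall fun W b => ⟨top X.X, proj W ≫ f.f, Category.comp_id _, 1,
      (hY W (Y.res b m)).unit, by rw [map_one, one_mul, IsUnit.unit_spec]⟩,
    fun U V g hg n n' u h => LocallyOn.of_forall fun W b => ?_⟩
  have hb : (left b ≫ g) ≫ proj U = proj W ≫ f.f := by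
    rw [Category.assoc, hg, ← Category.assoc, left_proj]
  refine ⟨U, 𝟙 U, left b ≫ g, hb, (hX U n').unit⁻¹ * (hX U n).unit, Category.comp_id _, ?_, ?_⟩
  · rw [res_id, res_id, Units.val_mul, ← mul_assoc, IsUnit.mul_val_inv, one_mul, IsUnit.unit_spec]
  · have h1 : f.pull (left b ≫ g) hb ((((hX U n').unit⁻¹ : (X.Mon U)ˣ) : X.Mon U) * n) =
        Y.res b u := by
      rw [← f.res_pull g hg b hb, map_mul, h, ← mul_assoc, ← map_mul, mul_comm _ n',
        IsUnit.mul_val_inv, map_one, one_mul]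
    rw [Units.val_mul, IsUnit.unit_spec]
    exact h1

lemma IsTrivial.hom_ext (hX : X.IsTrivial) {f f' : Y.Hom X} (h : f.f = f'.f) : f = f' :=
  Hom.ext' h fun g hg hg' m => Hom.pull_eq_of_isUnit h g hg hg' (hX _ m)

/-- The one-element monoid is a chart. -/
lemma IsTrivial.isFs (hX : X.IsTrivial) : X.IsFs := by
  intro x
  refine ⟨top X.X, ⟨x, rfl⟩, PUnit, inferInstance, 1, ⟨⟨⟨⟨Finset.univ, ?_⟩⟩, inferInstance⟩, ?_⟩, ?_, ?_⟩
  · exact Subsingleton.elim _ _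
  · exact fun n hn a b _ => ⟨1, Subsingleton.elim _ _⟩
  · exact fun V b m => LocallyOn.of_forall fun W c =>
      ⟨1, (hX W (X.res c m)).unit, by simp⟩
  · intro V b p q u h
    refine LocallyOn.of_forall fun W c => ⟨1, 1, by simp, by simp, Subsingleton.elim _ _, ?_⟩
    simp only [MonoidHom.one_apply, map_one, one_mul, mul_one] at h ⊢
    rw [← h, map_one]

/-- The glued maps are homomorphisms because gluings of sections are unique. -/
lemma isSheaf_commMonCat {C : Type*} [Category C] {J : GrothendieckTopology C}
    {P : Cᵒᵖ ⥤ CommMonCat.{0}} (hP : Presieve.IsSheaf J (P ⋙ forget CommMonCat)) :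
    Presheaf.IsSheaf J P := by
  intro E V S hS x hx
  have hc (e : E) : Presieve.FamilyOfElements.Compatible (P := P ⋙ forget CommMonCat)
      (R := S.arrows) fun W b hb =>
        CommMonCat.Hom.hom (X := E) (Y := P.obj (op W)) (x b hb) e :=
    fun Y₁ Y₂ Z g₁ g₂ f₁ f₂ h₁ h₂ h =>
      congrArg (fun k : E ⟶ P.obj (op Z) => k.hom e) (hx g₁ g₂ h₁ h₂ h)
  choose y hy hu using fun e => hP S hS _ (hc e)
  refine ⟨CommMonCat.ofHom ⟨⟨y, ?_⟩, ?_⟩, ?_, ?_⟩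
  · exact (hu 1 _ fun W b hb => (map_one (P.map b.op).hom).trans (map_one (CommMonCat.Hom.hom (X := E) (Y := P.obj (op W)) (x b hb))).symm).symm
  · exact fun e e' => (hu (e * e') (y e * y e') fun W b hb =>
      (map_mul (P.map b.op).hom _ _).trans <| Eq.trans
        (congrArg₂ (· * ·) (hy e b hb) (hy e' b hb)) (map_mul (CommMonCat.Hom.hom (X := E) (Y := P.obj (op W)) (x b hb)) e e').symm).symm
  · exact fun W b hb => CommMonCat.hom_ext (MonoidHom.ext fun e => hy e b hb)
  · exact fun z hz => CommMonCat.hom_ext (MonoidHom.ext fun e => hu e _ fun W b hb =>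
      congrArg (fun k : E ⟶ P.obj (op W) => k.hom e) (hz b hb))

/-! ### The log structure of functions invertible on an open subscheme -/

section Div

variable (X : Scheme.{0}) (str : X ⟶ Spec (.of ℂ)) (U : X.Opens)

/-- The functions on `V` that are invertible over `U`. -/
def divMon (V : X.Etale) : Submonoid Γ(dom V, ⊤) where
  carrier := {f | proj V ⁻¹ᵁ U ≤ (dom V).basicOpen f}
  one_mem' := by
    simp
  mul_mem' {f g} hf hg := by
    rw [Set.mem_ofPred_eq, Scheme.basicOpen_mul]
    exact le_inf hf hg

lemma appTop_mem_divMon {V W : X.Etale} (b : W ⟶ V) {f : Γ(dom V, ⊤)} (hf : f ∈ divMon X U V) :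
    (left b).appTop.hom f ∈ divMon X U W := by
  change _ ≤ (dom W).basicOpen _
  have h1 : (left b) ⁻¹ᵁ (dom V).basicOpen f = (dom W).basicOpen ((left b).appTop.hom f) :=
    Scheme.preimage_basicOpen_top _ _
  rw [← h1, ← left_proj b]
  exact fun x hx => hf hx

/-- The presheaf of functions that are invertible over `U`. -/
def divPresheaf : X.Etaleᵒᵖ ⥤ CommMonCat.{0} where
  obj V := CommMonCat.of (divMon X U V.unop)
  map {V W} b := CommMonCat.ofHom
    { toFun := fun f => ⟨(left b.unop).appTop.hom f.1, appTop_mem_divMon X U b.unop f.2⟩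
      map_one' := Subtype.ext (map_one _)
      map_mul' := fun f g => Subtype.ext (map_mul _ _ _) }
  map_id V := by
    ext f
    exact congr($((etaleO X).map_id V) f.1)
  map_comp b c := by
    ext f
    exact congr($((etaleO X).map_comp b c) f.1)

/-- Functions glue, and being invertible over `U` is a condition at each point, hence local. -/
lemma isSheaf_divPresheaf : Presheaf.IsSheaf X.smallEtaleTopology (divPresheaf X U) := by
  refine isSheaf_commMonCat ?_
  intro V S hS x hx
  have hy : Presieve.FamilyOfElements.Compatible (P := etaleO X ⋙ forget CommRingCat)
      (R := S.arrows) fun W b hb => (x b hb).1 :=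
    fun Y₁ Y₂ Z g₁ g₂ f₁ f₂ h₁ h₂ e => congrArg Subtype.val (hx g₁ g₂ h₁ h₂ e)
  obtain ⟨f, hf, huniq⟩ := isSheaf_etaleO X S hS _ hy
  refine ⟨⟨f, fun v hv => ?_⟩, fun W b hb => Subtype.ext (hf b hb), fun g hg =>
    Subtype.ext (huniq _ fun W b hb => congrArg Subtype.val (hg b hb))⟩
  obtain ⟨W, b, hb, w, rfl⟩ := (mem_topology_iff S).1 hS v
  have h1 : (left b) ⁻¹ᵁ (dom V).basicOpen f = (dom W).basicOpen ((left b).appTop.hom f) :=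
    Scheme.preimage_basicOpen_top _ _
  have h2 : (left b).appTop.hom f = (x b hb).1 := hf b hb
  change w ∈ (left b) ⁻¹ᵁ (dom V).basicOpen f
  rw [h1, h2]
  refine (x b hb).2 ?_
  change proj W w ∈ U
  rw [← left_proj b]
  exact hv

/-- The scheme `X` with the log structure of functions invertible on `U`. -/
def divLog : LogScheme where
  X := X
  str := str
  M := ⟨divPresheaf X U, isSheaf_divPresheaf X U⟩
  α := { app := fun V => CommMonCat.ofHom (divMon X U V.unop).subtype
         naturality := fun V W b => rfl }
  unit V x hx := by
    refine ⟨⟨x, fun v _ => ?_⟩, rfl, fun m hm => Subtype.ext hm⟩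
    exact (Scheme.basicOpen_of_isUnit (dom V) (f := x) hx).ge trivial

lemma divLog_isTrivial : (divLog X str ⊤).IsTrivial := fun V m => by
  refine isUnit_toFn.1 ?_
  have h : ⊤ ≤ (dom V).basicOpen m.1 := m.2
  exact RingedSpace.isUnit_of_isUnit_germ (dom V).toRingedSpace ⊤ m.1 fun x _ =>
    (Scheme.mem_basicOpen_top (dom V) m.1 x).1 (h trivial)

end Div

end LogScheme
end LogGeom

namespace LogGeom

/-! ### Étale algebras over the affine line -/

section EtaleAlgebra

open Polynomial TensorProduct

variable (B : Type) [CommRing B] [Algebra (Polynomial ℂ) B]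

/-- A flat algebra over a domain is torsion-free. -/
lemma isRegular_algebraMap_of_flat [Module.Flat ℂ[X] B] {p : ℂ[X]} (hp : p ≠ 0) {b : B}
    (h : algebraMap ℂ[X] B p * b = 0) : b = 0 := by
  have h1 : IsSMulRegular B p :=
    Module.Flat.isSMulRegular_of_nonZeroDivisors (mem_nonZeroDivisors_of_ne_zero hp)
  refine h1 ?_
  simp only [Algebra.smul_def, h, mul_zero]

/-- By flatness `B` embeds into its base change to ℂ(X), which is étale over a field and therefore
reduced. -/
lemma isReduced_of_etale [Algebra.Etale ℂ[X] B] : IsReduced B := by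
  let K := FractionRing ℂ[X]
  have h1 : IsReduced (K ⊗[ℂ[X]] B) := Algebra.FormallyUnramified.isReduced_of_field K _
  have h2 : Function.Injective (Algebra.TensorProduct.includeRight : B →ₐ[ℂ[X]] K ⊗[ℂ[X]] B) := by
    apply Algebra.TensorProduct.includeRight_injective
    exact FaithfulSMul.algebraMap_injective _ _
  exact isReduced_of_injective _ h2

/-- The prime `p` lies over the maximal ideal (X), and unramifiedness says that X generates the
maximal ideal of the localization at `p`. The factor `s` clears denominators. -/
lemma exists_mul_eq_of_mem_prime [Algebra.Etale ℂ[X] B] (p : Ideal B) [p.IsPrime]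
    (hT : algebraMap ℂ[X] B X ∈ p) {x : B} (hx : x ∈ p) :
    ∃ s, s ∉ p ∧ ∃ y, s * x = algebraMap ℂ[X] B X * y := by
  let q := p.under ℂ[X]
  have hq : q = Ideal.span {X} := by
    have hmax : (Ideal.span {(X : ℂ[X])}).IsMaximal :=
      PrincipalIdealRing.isMaximal_of_irreducible irreducible_X
    refine (hmax.eq_of_le (Ideal.IsPrime.under _ p).ne_top ?_).symm
    rw [Ideal.span_singleton_le_iff_mem]
    exact hT
  let := Localization.AtPrime.algebraOfLiesOver q p
  have h := ((Algebra.isUnramifiedAt_iff_map_eq ℂ[X] q p).1 inferInstance).2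
  rw [hq, Ideal.map_span, Set.image_singleton,
    IsScalarTower.algebraMap_apply ℂ[X] B (Localization.AtPrime p)] at h
  have hx' : algebraMap B (Localization.AtPrime p) x ∈ IsLocalRing.maximalIdeal _ :=
    (IsLocalization.AtPrime.to_map_mem_maximal_iff _ p x).2 hx
  rw [← h, Ideal.mem_span_singleton'] at hx'
  obtain ⟨z, hz⟩ := hx'
  obtain ⟨⟨y, s⟩, hy⟩ := IsLocalization.surj p.primeCompl z
  have : algebraMap B (Localization.AtPrime p) (s * x) =
      algebraMap B _ (algebraMap ℂ[X] B X * y) := by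
    rw [map_mul, map_mul, ← hz, ← hy]; ring
  obtain ⟨t, ht⟩ := (IsLocalization.eq_iff_exists p.primeCompl _).1 this
  refine ⟨t * s, (t * s).2, t * y, ?_⟩
  rw [mul_assoc, ht]; ring

/-- X is a uniformizer at `p`, so a divisor of a power of X is a power of X times a unit. As long as
`f` lies in `p`, a factor X can be split off and cancelled, which lowers `n`. -/
lemma exists_eq_pow_mul [Algebra.Etale ℂ[X] B] (p : Ideal B) [p.IsPrime]
    (hT : algebraMap ℂ[X] B X ∈ p) (n : ℕ) :
    ∀ {f g s : B}, s ∉ p → f * g = s * algebraMap ℂ[X] B X ^ n →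
    ∃ (k : ℕ) (a b : B), a ∉ p ∧ b ∉ p ∧ b * f = algebraMap ℂ[X] B X ^ k * a := by
  induction n with
  | zero =>
    intro f g s hs h
    refine ⟨0, f, 1, fun hf => hs ?_, fun h1 => hs (by simpa using p.mul_mem_left s h1), by ring⟩
    rw [pow_zero, mul_one] at h
    exact h ▸ p.mul_mem_right g hf
  | succ n ih =>
    intro f g s hs h
    by_cases hf : f ∈ p
    · obtain ⟨t, ht, f', hf'⟩ := exists_mul_eq_of_mem_prime B p hT hf
      have h1 : f' * g = (t * s) * algebraMap ℂ[X] B X ^ n := by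
        rw [← sub_eq_zero]
        apply isRegular_algebraMap_of_flat B (X_ne_zero (R := ℂ))
        rw [mul_sub, ← mul_assoc, ← hf', mul_assoc, h]
        ring
      obtain ⟨k, a, b, ha, hb, hab⟩ := ih (fun hc => (‹p.IsPrime›.mem_or_mem hc).elim ht hs) h1
      refine ⟨k + 1, a, b * t, ha, fun hc => (‹p.IsPrime›.mem_or_mem hc).elim hb ht, ?_⟩
      rw [mul_assoc, hf', mul_left_comm, hab]
      ring
    · exact ⟨0, f, 1, hf, fun h1 => hs (by simpa using p.mul_mem_left s h1), by ring⟩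

/-- The relative differentials over ℂ[X] vanish, so those over ℂ all come from ℂ[X], where dX
generates. -/
lemma exists_smul_D_eq [Algebra ℂ B] [IsScalarTower ℂ ℂ[X] B] [Algebra.FormallyUnramified ℂ[X] B]
    (b : B) : ∃ a : B, KaehlerDifferential.D ℂ B b =
      a • KaehlerDifferential.D ℂ B (algebraMap ℂ[X] B X) := by
  have h0 : KaehlerDifferential.map ℂ ℂ[X] B B (KaehlerDifferential.D ℂ B b) = 0 :=
    Subsingleton.elim _ _
  obtain ⟨w, hw⟩ := (KaehlerDifferential.exact_mapBaseChange_map ℂ ℂ[X] B _).1 h0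
  rw [← hw]
  clear hw h0
  suffices h : LinearMap.range (KaehlerDifferential.mapBaseChange ℂ ℂ[X] B) ≤
      Submodule.span B {KaehlerDifferential.D ℂ B (algebraMap ℂ[X] B X)} by
    obtain ⟨a, ha⟩ := Submodule.mem_span_singleton.1 (h ⟨w, rfl⟩)
    exact ⟨a, ha.symm⟩
  rintro _ ⟨w, rfl⟩
  induction w with
  | zero => rw [map_zero]; exact zero_mem _
  | add x y hx hy => rw [map_add]; exact add_mem hx hy
  | tmul c ω =>
    rw [KaehlerDifferential.mapBaseChange_tmul]
    refine Submodule.smul_mem _ _ ?_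
    have hω : ω ∈ Submodule.span ℂ[X] (Set.range (KaehlerDifferential.D ℂ ℂ[X])) := by
      rw [KaehlerDifferential.span_range_derivation]; trivial
    induction hω using Submodule.span_induction with
    | mem x hx =>
      obtain ⟨p, rfl⟩ := hx
      rw [KaehlerDifferential.map_D]
      have : algebraMap ℂ[X] B p = aeval (algebraMap ℂ[X] B X) p := by
        rw [aeval_algebraMap_apply, aeval_X_left_apply]
      rw [this, Derivation.map_aeval]
      exact Submodule.smul_mem _ _ (Submodule.subset_span rfl)
    | zero => rw [map_zero]; exact zero_mem _
    | add x y _ _ hx hy => rw [map_add]; exact add_mem hx hy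
    | smul a x _ hx =>
      rw [LinearMap.map_smul, ← algebraMap_smul B]
      exact Submodule.smul_mem _ _ hx

end EtaleAlgebra
end LogGeom

namespace LogGeom

open Polynomial

namespace LogScheme

variable {X Y : LogScheme}

/-! ### Functions and points -/

section Points

lemma exists_affine (V : X.X.Etale) (v : dom V) :
    ∃ (W : X.X.Etale) (b : W ⟶ V), v ∈ Set.range (left b) ∧ IsAffine (dom W) := by
  obtain ⟨O, hO, hv, -⟩ := exists_isAffineOpen_mem_and_subset (x := v) (U := ⊤) trivial
  exact ⟨sub V O, subι V O, by rw [range_subι]; exact hv, hO⟩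

lemma locallyOn_affine (V : X.X.Etale) {Q : ∀ ⦃W : X.X.Etale⦄, (W ⟶ V) → Prop}
    (hQ : ∀ ⦃W W' : X.X.Etale⦄ (b : W ⟶ V) (c : W' ⟶ W), Q b → Q (c ≫ b))
    (h : ∀ ⦃W⦄ (b : W ⟶ V), IsAffine (dom W) → Q b) : LocallyOn V Q :=
  .of_cover hQ fun v => by
    obtain ⟨W, b, h1, h2⟩ := exists_affine V v
    exact ⟨W, b, h1, h b h2⟩

/-- The function `x` does not vanish at `v`. -/
def NZ {V : X.X.Etale} (x : X.Fn V) (v : dom V) : Prop := v ∈ (dom V).basicOpen (U := ⊤) x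

lemma nz_mul {V : X.X.Etale} (x y : X.Fn V) (v : dom V) : NZ (x * y) v ↔ NZ x v ∧ NZ y v := by
  have h := Scheme.basicOpen_mul (dom V) (U := ⊤) x y
  exact Set.ext_iff.1 (congrArg (fun O : (dom V).Opens => (O : Set (dom V))) h) v

lemma nz_fnPull {U : X.X.Etale} {V : Y.X.Etale} (g : dom V ⟶ dom U) (x : X.Fn U) (v : dom V) :
    NZ (fnPull g x : Y.Fn V) v ↔ NZ x (g v) := by
  have h := Scheme.preimage_basicOpen_top g x
  exact (Set.ext_iff.1 (congrArg (fun O : (dom V).Opens => (O : Set (dom V))) h) v).symm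

lemma nz_resFn {V W : X.X.Etale} (b : W ⟶ V) (x : X.Fn V) (w : dom W) :
    NZ (X.resFn b x) w ↔ NZ x (left b w) := nz_fnPull (left b) x w

lemma isUnit_iff_nz {V : X.X.Etale} (x : X.Fn V) : IsUnit x ↔ ∀ v, NZ x v :=
  ⟨fun h v => (Scheme.basicOpen_of_isUnit (dom V) (f := x) h).ge trivial, fun h =>
    RingedSpace.isUnit_of_isUnit_germ (dom V).toRingedSpace ⊤ x fun v _ =>
      (Scheme.mem_basicOpen_top (dom V) x v).1 (h v)⟩

/-- The open subscheme where `x` does not vanish. -/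
def locus {V : X.X.Etale} (x : X.Fn V) : X.X.Etale := sub V ((dom V).basicOpen (U := ⊤) x)

/-- The inclusion of `locus x`. -/
def locusι {V : X.X.Etale} (x : X.Fn V) : locus x ⟶ V := subι V _

lemma range_locusι {V : X.X.Etale} (x : X.Fn V) (v : dom V) :
    v ∈ Set.range (left (locusι x)) ↔ NZ x v := by
  exact Set.ext_iff.1 (range_subι V _) v

lemma isUnit_resFn_locusι {V : X.X.Etale} (x : X.Fn V) : IsUnit (X.resFn (locusι x) x) :=
  (isUnit_iff_nz _).2 fun w => (nz_resFn _ _ _).2 ((range_locusι x _).1 ⟨w, rfl⟩)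

lemma not_nz_iff {V : X.X.Etale} (x : X.Fn V) (v : dom V) :
    NZ x v ↔ x ∉ (show PrimeSpectrum (X.Fn V) from (dom V).toSpecΓ v).asIdeal := by
  have h := Scheme.toSpecΓ_preimage_basicOpen (dom V) x
  exact (Set.ext_iff.1 (congrArg (fun O : (dom V).Opens => (O : Set (dom V))) h) v).symm

/-- The value of a function at a point with values in `R`. -/
def ev {R : Type} [CommRing R] {V : X.X.Etale} (z : Spec (.of R) ⟶ dom V) : X.Fn V →+* R :=
  ((Scheme.ΓSpecIso (.of R)).hom.hom).comp z.appTop.hom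

lemma ev_resFn {R : Type} [CommRing R] {V W : X.X.Etale} (b : W ⟶ V) (z : Spec (.of R) ⟶ dom W)
    (x : X.Fn V) : ev z (X.resFn b x) = ev (z ≫ left b) x := by
  change (Scheme.ΓSpecIso (.of R)).hom.hom _ = (Scheme.ΓSpecIso (.of R)).hom.hom _
  rw [Scheme.Hom.comp_appTop]
  rfl

lemma ev_algebraMap {R : Type} [CommRing R] [Algebra ℂ R] {V : X.X.Etale} (z : Spec (.of R) ⟶ dom V)
    (hz : z ≫ proj V ≫ X.str = Spec.map (CommRingCat.ofHom (algebraMap ℂ R))) (a : ℂ) :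
    ev z (algebraMap ℂ (X.Fn V) a) = algebraMap ℂ R a := by
  have h1 : (proj V ≫ X.str).appTop ≫ z.appTop =
      (Spec.map (CommRingCat.ofHom (algebraMap ℂ R))).appTop := by
    rw [← Scheme.Hom.comp_appTop, hz]
  have h2 := Scheme.ΓSpecIso_inv_naturality (CommRingCat.ofHom (algebraMap ℂ R))
  change (Scheme.ΓSpecIso (.of R)).hom.hom (((proj V ≫ X.str).appTop ≫ z.appTop).hom
    ((Scheme.ΓSpecIso (.of ℂ)).inv.hom a)) = _
  rw [h1]
  have h3 := congr($h2 a)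
  have h4 := congrArg (Scheme.ΓSpecIso (.of R)).hom.hom h3
  refine h4.symm.trans ?_
  exact congr($((Scheme.ΓSpecIso (.of R)).inv_hom_id) (algebraMap ℂ R a))

lemma nz_iff_ev {k : Type} [Field k] {V : X.X.Etale} (z : Spec (.of k) ⟶ dom V) (x : X.Fn V) :
    NZ x (z default) ↔ ev z x ≠ 0 := by
  have h := Scheme.preimage_basicOpen_top z x
  have h1 : NZ x (z default) ↔ default ∈ (Spec (.of k)).basicOpen (z.appTop x) :=
    (Set.ext_iff.1 (congrArg (fun O : (Spec (.of k)).Opens => (O : Set (Spec (.of k)))) h) default)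
  rw [h1, basicOpen_eq_of_affine']
  change _ ∉ _ ↔ _
  have h2 : (default : Spec (.of k)) = (⊥ : PrimeSpectrum k) := Subsingleton.elim _ _
  rw [h2]
  exact Iff.rfl

end Points

/-! ### Coordinates -/

section Coord

/-- The morphism to the affine line given by a function. -/
def toA1 {U : X.X.Etale} (c : X.Fn U) : dom U ⟶ Spec (.of ℂ[X]) :=
  (dom U).toSpecΓ ≫ Spec.map (CommRingCat.ofHom (aeval (R := ℂ) c).toRingHom : _ ⟶ Γ(dom U, ⊤))

lemma toA1_resFn {U V : X.X.Etale} (b : V ⟶ U) (c : X.Fn U) :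
    toA1 (X.resFn b c) = left b ≫ toA1 c := by
  rw [toA1, toA1, ← Category.assoc, Scheme.toSpecΓ_naturality, Category.assoc, ← Spec.map_comp]
  refine congrArg (fun φ => (dom V).toSpecΓ ≫ Spec.map φ) ?_
  exact CommRingCat.hom_ext (RingHom.ext fun p => aeval_algHom_apply (X.resFn b) c p)

/-- The function `c` is an étale coordinate. -/
def IsEtaleCoord {U : X.X.Etale} (c : X.Fn U) : Prop := Etale (toA1 c)

lemma IsEtaleCoord.resFn {U V : X.X.Etale} {c : X.Fn U} (hc : IsEtaleCoord c) (b : V ⟶ U) :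
    IsEtaleCoord (X.resFn b c) := by
  have : Etale (toA1 c) := hc
  unfold IsEtaleCoord
  rw [toA1_resFn]
  infer_instance

lemma IsEtaleCoord.etale_aeval {V : X.X.Etale} {c : X.Fn V} (hc : IsEtaleCoord c)
    [IsAffine (dom V)] : (aeval (R := ℂ) c).toRingHom.Etale := by
  have h1 : Etale (toA1 c) := hc
  have h2 : Etale (Spec.map (CommRingCat.ofHom (aeval (R := ℂ) c).toRingHom : _ ⟶ Γ(dom V, ⊤))) := by
    have e : Spec.map (CommRingCat.ofHom (aeval (R := ℂ) c).toRingHom : _ ⟶ Γ(dom V, ⊤)) =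
        inv (dom V).toSpecΓ ≫ toA1 c := by rw [toA1, IsIso.inv_hom_id_assoc]
    rw [e]
    infer_instance
  exact (HasRingHomProperty.Spec_iff (P := @Etale)).1 h2

lemma isReduced_Spec_of_etale {R : CommRingCat.{0}} (f : Spec R ⟶ Spec (.of ℂ[X])) [hf : Etale f] :
    IsReduced (Spec R) := by
  obtain ⟨φ, rfl⟩ := Spec.map_surjective f
  have h3 := (HasRingHomProperty.Spec_iff (P := @Etale)).1 hf
  let := φ.hom.toAlgebra
  have : Algebra.Etale ℂ[X] R := h3
  have := isReduced_of_etale R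
  infer_instance

lemma IsEtaleCoord.isReduced {V : X.X.Etale} {c : X.Fn V} (hc : IsEtaleCoord c) :
    IsReduced (dom V) := by
  have h1 : Etale (toA1 c) := hc
  suffices h : ∀ i, IsReduced ((dom V).affineCover.X i) from
    IsReduced.of_openCover (dom V) (dom V).affineCover
  intro i
  have h2 : Etale ((dom V).affineCover.f i ≫ toA1 c) := inferInstance
  exact isReduced_Spec_of_etale (hf := h2) _

lemma IsEtaleCoord.eq_zero_of_mul {V : X.X.Etale} {c : X.Fn V} (hc : IsEtaleCoord c) {f : X.Fn V}
    (h : c * f = 0) : f = 0 := by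
  refine fn_ext (locallyOn_affine V (fun W W' b d h => ?_) fun W b hW => ?_)
  · rw [resFn_comp, resFn_comp, h]
  · have h1 := (hc.resFn b).etale_aeval
    let := (aeval (R := ℂ) (X.resFn b c)).toRingHom.toAlgebra
    have : Algebra.Etale ℂ[X] (X.Fn W) := h1
    rw [map_zero]
    refine isRegular_algebraMap_of_flat (X.Fn W) (X_ne_zero (R := ℂ)) ?_
    have e : algebraMap ℂ[X] (X.Fn W) Polynomial.X = X.resFn b c := aeval_X _
    rw [e, ← map_mul, h, map_zero]

lemma IsEtaleCoord.mul_left_cancel {V : X.X.Etale} {c : X.Fn V} (hc : IsEtaleCoord c)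
    {f g : X.Fn V} (h : c * f = c * g) : f = g :=
  sub_eq_zero.1 (hc.eq_zero_of_mul (by rw [mul_sub, h, sub_self]))

lemma IsEtaleCoord.pow_mul_left_cancel {V : X.X.Etale} {c : X.Fn V} (hc : IsEtaleCoord c) (n : ℕ)
    {f g : X.Fn V} (h : c ^ n * f = c ^ n * g) : f = g := by
  induction n with
  | zero => simpa using h
  | succ n ih => exact ih (hc.mul_left_cancel (by rw [← mul_assoc, ← mul_assoc, ← pow_succ', h]))

/-- A function that is invertible away from `c = 0` is locally a power of `c` times a unit. -/
lemma IsEtaleCoord.exists_pow_mul {V : X.X.Etale} {c : X.Fn V} (hc : IsEtaleCoord c) {f : X.Fn V}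
    (hf : ∀ v, NZ c v → NZ f v) (v : dom V) :
    ∃ (W : X.X.Etale) (b : W ⟶ V), v ∈ Set.range (left b) ∧ ∃ (k : ℕ) (w : X.Fn W),
      IsUnit w ∧ X.resFn b f = X.resFn b c ^ k * w := by
  by_cases hcv : NZ c v
  · exact ⟨locus f, locusι f, (range_locusι f v).2 (hf v hcv), 0, _, isUnit_resFn_locusι f,
      by rw [pow_zero, one_mul]⟩
  obtain ⟨W, b, ⟨w, rfl⟩, hW⟩ := exists_affine V v
  have h1 := (hc.resFn b).etale_aeval
  let := (aeval (R := ℂ) (X.resFn b c)).toRingHom.toAlgebra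
  have : Algebra.Etale ℂ[X] (X.Fn W) := h1
  have e : algebraMap ℂ[X] (X.Fn W) Polynomial.X = X.resFn b c := aeval_X _
  -- On an affine scheme, inclusion of the non-vanishing locus of `c` in that of `f` means that `f`
  -- divides a power of `c`.
  have hrad : X.resFn b c ∈ (Ideal.span {X.resFn b f}).radical := by
    rw [← PrimeSpectrum.basicOpen_le_basicOpen_iff]
    intro q hq
    obtain ⟨w', hw'⟩ : ∃ w' : dom W, (dom W).toSpecΓ w' = q := by
      have : Function.Surjective (dom W).toSpecΓ :=
        (Scheme.homeoOfIso (asIso (dom W).toSpecΓ)).surjective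
      exact this q
    subst hw'
    refine (not_nz_iff _ w').1 ((nz_resFn b f w').2 (hf _ ((nz_resFn b c w').1 ?_)))
    exact (not_nz_iff _ w').2 hq
  obtain ⟨n, hn⟩ := hrad
  obtain ⟨g, hg⟩ := Ideal.mem_span_singleton'.1 hn
  let p := (show PrimeSpectrum (X.Fn W) from (dom W).toSpecΓ w).asIdeal
  have hp : p.IsPrime := PrimeSpectrum.isPrime _
  have hcp : algebraMap ℂ[X] (X.Fn W) Polynomial.X ∈ p := by
    rw [e]
    by_contra hcon
    exact hcv ((nz_resFn b c w).1 ((not_nz_iff _ w).2 hcon))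
  obtain ⟨k, a, d, ha, hd, had⟩ := exists_eq_pow_mul (X.Fn W) p hcp n (f := X.resFn b f) (g := g)
    (s := 1) (fun h => hp.ne_top ((Ideal.eq_top_iff_one _).2 h)) (by rw [e, one_mul, ← hg, mul_comm])
  rw [e] at had
  -- Neither `a` nor `d` lies in the prime of the chosen point, so both become units on a
  -- neighbourhood of it.
  have hu := isUnit_resFn_locusι (a * d)
  rw [map_mul, IsUnit.mul_iff] at hu
  obtain ⟨ha', hd'⟩ := hu
  refine ⟨locus (a * d), locusι (a * d) ≫ b, ?_, k, X.resFn (locusι (a * d)) a * ↑hd'.unit⁻¹,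
    ha'.mul (Units.isUnit _), ?_⟩
  · obtain ⟨w', hw'⟩ := (range_locusι (a * d) w).2
      ((nz_mul _ _ _).2 ⟨(not_nz_iff _ _).2 ha, (not_nz_iff _ _).2 hd⟩)
    refine ⟨w', ?_⟩
    rw [← hw']
    rfl
  · have h2 := congrArg (X.resFn (locusι (a * d))) had
    rw [map_mul, map_mul, map_pow] at h2
    rw [resFn_comp, resFn_comp, ← mul_assoc, ← h2, mul_comm _ (X.resFn _ (X.resFn b f)), mul_assoc,
      IsUnit.mul_val_inv, mul_one]

lemma IsEtaleCoord.exists_dd_eq {V : X.X.Etale} {c : X.Fn V} (hc : IsEtaleCoord c)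
    [IsAffine (dom V)] (x : X.Fn V) :
    ∃ a : X.Fn V, dd ℂ (X.toFn V) x = a • dd ℂ (X.toFn V) c := by
  have h1 := hc.etale_aeval
  let := (aeval (R := ℂ) c).toRingHom.toAlgebra
  have : Algebra.Etale ℂ[X] (X.Fn V) := h1
  have : IsScalarTower ℂ ℂ[X] (X.Fn V) := .of_algebraMap_eq fun a => by
    exact (AlgHom.commutes (aeval (R := ℂ) c) a).symm
  have e : algebraMap ℂ[X] (X.Fn V) Polynomial.X = c := aeval_X _
  obtain ⟨a, ha⟩ := exists_smul_D_eq (X.Fn V) x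
  refine ⟨a, ?_⟩
  have h2 : ((a • KaehlerDifferential.D ℂ (X.Fn V) c, 0) : Ω[X.Fn V⁄ℂ] × (X.Mon V →₀ X.Fn V)) =
      a • (KaehlerDifferential.D ℂ (X.Fn V) c, 0) := by rw [Prod.smul_mk, smul_zero]
  rw [dd, dd, ha, e, h2]
  exact map_smul _ _ _

end Coord

end LogScheme
end LogGeom

namespace LogGeom

/-! ### The projective line -/

section ProjectiveLine

open HomogeneousLocalization Polynomial

/-- The grading of the homogeneous coordinate ring of the projective line. -/
abbrev lineGrading : ℕ → Submodule ℂ (MvPolynomial (Fin (1 + 1)) ℂ) :=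
  MvPolynomial.homogeneousSubmodule (Fin (1 + 1)) ℂ

lemma X_mem_lineGrading (i : Fin (1 + 1)) : MvPolynomial.X i ∈ lineGrading 1 :=
  MvPolynomial.isHomogeneous_X _ _

lemma exists_C_eq (a : lineGrading 0) : ∃ c : ℂ, algebraMap ℂ (lineGrading 0) c = a := by
  obtain ⟨a, ha⟩ := a
  have h := (MvPolynomial.totalDegree_eq_zero_iff_eq_C (p := a)).1
    (Nat.le_zero.1 (MvPolynomial.IsHomogeneous.totalDegree_le ha))
  exact ⟨_, Subtype.ext h.symm⟩

lemma adjoin_X_lineGrading :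
    Algebra.adjoin (lineGrading 0) (Set.range (MvPolynomial.X : Fin (1 + 1) → MvPolynomial (Fin (1 + 1)) ℂ)) = ⊤ := by
  rw [eq_top_iff]
  rintro p -
  induction p using MvPolynomial.induction_on with
  | C a => exact Subalgebra.algebraMap_mem _ (algebraMap ℂ (lineGrading 0) a)
  | add p q hp hq => exact add_mem hp hq
  | mul_X p i hp => exact mul_mem hp (Algebra.subset_adjoin ⟨i, rfl⟩)

/-- The quotient of the two homogeneous coordinates with denominator `X i`. -/
def ratio (i : Fin (1 + 1)) : Away lineGrading (MvPolynomial.X i) :=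
  Away.isLocalizationElem (X_mem_lineGrading i) (X_mem_lineGrading i.rev)

/-- The ring map from polynomials to the homogeneous localization, `X ↦ ratio i`. -/
def chartRing (i : Fin (1 + 1)) : ℂ[X] →+* Away lineGrading (MvPolynomial.X i) :=
  eval₂RingHom ((fromZeroRingHom lineGrading _).comp (algebraMap ℂ (lineGrading 0))) (ratio i)

lemma chartRing_X (i : Fin (1 + 1)) : chartRing i X = ratio i := eval₂_X _ _

lemma chartRing_C (i : Fin (1 + 1)) (c : ℂ) :
    chartRing i (C c) = fromZeroRingHom lineGrading _ (algebraMap ℂ (lineGrading 0) c) :=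
  eval₂_C _ _

/-- Setting `X i` to `1`, on polynomials. -/
def setOne (i : Fin (1 + 1)) : MvPolynomial (Fin (1 + 1)) ℂ →+* ℂ[X] :=
  (MvPolynomial.aeval (R := ℂ) fun j => if j = i then 1 else (X : ℂ[X])).toRingHom

lemma setOne_X (i j : Fin (1 + 1)) : setOne i (MvPolynomial.X j) = if j = i then 1 else X :=
  MvPolynomial.aeval_X _ _

lemma isUnit_setOne (i : Fin (1 + 1)) : IsUnit (setOne i (MvPolynomial.X i)) := by
  rw [setOne_X, if_pos rfl]
  exact isUnit_one

/-- Setting `X i` to `1`. -/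
def dehomogenize (i : Fin (1 + 1)) : Away lineGrading (MvPolynomial.X i) →+* ℂ[X] :=
  (IsLocalization.Away.lift (S := Localization.Away (MvPolynomial.X i : MvPolynomial (Fin (1 + 1)) ℂ))
    (MvPolynomial.X i) (isUnit_setOne i)).comp
    (algebraMap (Away lineGrading (MvPolynomial.X i)) (Localization.Away (MvPolynomial.X i)))

lemma dehomogenize_mk (i : Fin (1 + 1)) (n : ℕ) (p : MvPolynomial (Fin (1 + 1)) ℂ) (hp) :
    dehomogenize i (Away.mk lineGrading (X_mem_lineGrading i) n p hp) = setOne i p := by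
  have h : (algebraMap (Away lineGrading (MvPolynomial.X i))
      (Localization.Away (MvPolynomial.X i : MvPolynomial (Fin (1 + 1)) ℂ)))
      (Away.mk lineGrading (X_mem_lineGrading i) n p hp) *
      algebraMap _ _ (MvPolynomial.X i : MvPolynomial (Fin (1 + 1)) ℂ) ^ n = algebraMap _ _ p := by
    change Localization.mk _ _ * _ = _
    rw [← map_pow, ← Localization.mk_one_eq_algebraMap, ← Localization.mk_one_eq_algebraMap,
      Localization.mk_mul, Localization.mk_eq_mk_iff, Localization.r_iff_exists]
    exact ⟨1, by simp; ring⟩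
  have h2 := congrArg (IsLocalization.Away.lift
    (S := Localization.Away (MvPolynomial.X i : MvPolynomial (Fin (1 + 1)) ℂ))
    (MvPolynomial.X i) (isUnit_setOne i)) h
  rw [map_mul, map_pow, IsLocalization.Away.lift_eq, IsLocalization.Away.lift_eq, setOne_X,
    if_pos rfl, one_pow, mul_one] at h2
  exact h2

/-- Gives injectivity of `chartRing`. -/
lemma dehomogenize_chartRing (i : Fin (1 + 1)) (p : ℂ[X]) :
    dehomogenize i (chartRing i p) = p := by
  suffices h : (dehomogenize i).comp (chartRing i) = RingHom.id _ from congr($h p)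
  refine Polynomial.ringHom_ext (fun a => ?_) ?_
  · rw [RingHom.comp_apply, chartRing_C]
    have h : fromZeroRingHom lineGrading _ (algebraMap ℂ (lineGrading 0) a) =
        Away.mk lineGrading (X_mem_lineGrading i) 0 (MvPolynomial.C a)
          ((zero_smul ℕ 1).symm ▸ MvPolynomial.isHomogeneous_C _ _) := by
      ext
      simp [fromZeroRingHom]
      rfl
    rw [h, dehomogenize_mk]
    exact MvPolynomial.aeval_C _ _
  · rw [RingHom.comp_apply, chartRing_X, ratio, dehomogenize_mk, map_pow, setOne_X, pow_one,
      if_neg (by fin_cases i <;> decide)]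
    rfl

/-- The degree-zero part of the polynomial ring is ℂ, and over it the homogeneous localization is
spanned by quotients of monomials by powers of `X i`. -/
lemma chartRing_surjective (i : Fin (1 + 1)) : Function.Surjective (chartRing i) := by
  suffices h : (⊤ : Submodule (lineGrading 0) (Away lineGrading (MvPolynomial.X i))) ≤
      Submodule.span (lineGrading 0) (Set.range (chartRing i)) by
    intro x
    have hx := h (Submodule.mem_top (x := x))
    induction hx using Submodule.span_induction with
    | mem x hx => exact hx
    | zero => exact ⟨0, map_zero _⟩
    | add x y _ _ hx hy =>
      obtain ⟨p, rfl⟩ := hx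
      obtain ⟨q, rfl⟩ := hy
      exact ⟨p + q, map_add _ _ _⟩
    | smul a x _ hx =>
      obtain ⟨p, rfl⟩ := hx
      obtain ⟨c, rfl⟩ := exists_C_eq a
      exact ⟨C c * p, by rw [map_mul, chartRing_C, Algebra.smul_def]; rfl⟩
  rw [← Away.span_mk_prod_pow_eq_top (X_mem_lineGrading i) MvPolynomial.X adjoin_X_lineGrading
    (fun _ => 1) X_mem_lineGrading]
  refine Submodule.span_mono ?_
  rintro _ ⟨a, ai, hai, rfl⟩
  -- The powers of `X i` in the numerator cancel against the denominator, so only the exponent of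
  -- the other coordinate survives.
  refine ⟨X ^ ai i.rev, ?_⟩
  rw [map_pow, chartRing_X, ratio]
  ext
  rw [val_pow, Away.val_mk, Away.val_mk, Localization.mk_pow, Localization.mk_eq_mk_iff,
    Localization.r_iff_exists]
  refine ⟨1, ?_⟩
  have hai' : ai 0 + ai 1 = a := by simpa using hai
  subst hai'
  fin_cases i <;> simp <;> ring

lemma chartRing_bijective (i : Fin (1 + 1)) : Function.Bijective (chartRing i) :=
  ⟨Function.LeftInverse.injective (dehomogenize_chartRing i), chartRing_surjective i⟩

instance (i : Fin (1 + 1)) : IsIso (CommRingCat.ofHom (chartRing i)) :=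
  (ConcreteCategory.isIso_iff_bijective _).2 (chartRing_bijective i)

/-- The homogeneous localization is a polynomial ring. -/
def awayIso (i : Fin (1 + 1)) :
    CommRingCat.of ℂ[X] ≅ CommRingCat.of (Away lineGrading (MvPolynomial.X i)) :=
  asIso (CommRingCat.ofHom (chartRing i))

/-- The structure morphism of the projective line. -/
def lineStr : Proj lineGrading ⟶ Spec (.of ℂ) :=
  Proj.toSpecZero lineGrading ≫ Spec.map (CommRingCat.ofHom (algebraMap ℂ (lineGrading 0)))

/-- The affine charts of the projective line. -/
def lineChart (i : Fin (1 + 1)) : Spec (.of ℂ[X]) ⟶ Proj lineGrading :=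
  Spec.map (awayIso i).inv ≫ Proj.awayι lineGrading (MvPolynomial.X i) (X_mem_lineGrading i) one_pos

instance isOpenImmersion_lineChart (i : Fin (1 + 1)) : IsOpenImmersion (lineChart i) :=
  IsOpenImmersion.comp _ _

lemma lineChart_str (i : Fin (1 + 1)) :
    lineChart i ≫ lineStr = Spec.map (CommRingCat.ofHom (algebraMap ℂ ℂ[X])) := by
  rw [lineChart, lineStr, Category.assoc, Proj.awayι_toSpecZero_assoc, ← Spec.map_comp,
    ← Spec.map_comp]
  congr 1
  have h : CommRingCat.ofHom (algebraMap ℂ (lineGrading 0)) ≫ CommRingCat.ofHom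
      (fromZeroRingHom lineGrading (.powers (MvPolynomial.X i))) =
      CommRingCat.ofHom (algebraMap ℂ ℂ[X]) ≫ (awayIso i).hom :=
    CommRingCat.hom_ext (RingHom.ext fun c => (chartRing_C i c).symm)
  rw [h, Category.assoc, Iso.hom_inv_id, Category.comp_id]

lemma opensRange_lineChart (i : Fin (1 + 1)) :
    (lineChart i).opensRange = Proj.basicOpen lineGrading (MvPolynomial.X i) :=
  (Scheme.Hom.opensRange_comp_of_isIso _ _).trans (Proj.opensRange_awayι _ _ _ _)

lemma lineChart_covers (x : Proj lineGrading) : ∃ i, x ∈ Set.range (lineChart i) := by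
  have h := Proj.iSup_basicOpen_eq_top' lineGrading (MvPolynomial.X : Fin (1 + 1) → _)
    (fun i => ⟨1, X_mem_lineGrading i⟩) adjoin_X_lineGrading
  obtain ⟨i, hi⟩ := TopologicalSpace.Opens.mem_iSup.1 (h.ge (Set.mem_univ x))
  rw [← opensRange_lineChart] at hi
  exact ⟨i, hi⟩

lemma awayIso_inv_ratio (i : Fin (1 + 1)) : (awayIso i).inv.hom (ratio i) = X := by
  rw [← chartRing_X]
  exact congr($((awayIso i).hom_inv_id) X)

/-- The opposite chart is the locus where the other homogeneous coordinate does not vanish; inside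
chart `i` this is the locus of `ratio i`, whose coordinate is X. -/
lemma lineChart_mem_iff (i : Fin (1 + 1)) (x : Spec (.of ℂ[X])) :
    lineChart i x ∈ Set.range (lineChart i.rev) ↔ (X : ℂ[X]) ∉ x.asIdeal := by
  have h := Proj.awayι_preimage_basicOpen lineGrading (X_mem_lineGrading i) one_pos
    (X_mem_lineGrading i.rev) one_pos
  have h2 : lineChart i x ∈ (lineChart i.rev).opensRange ↔
      Spec.map (awayIso i).inv x ∈ PrimeSpectrum.basicOpen (ratio i) := by
    rw [opensRange_lineChart]
    exact Set.ext_iff.1 (congrArg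
      (fun O : (Spec (.of (Away lineGrading (MvPolynomial.X i)))).Opens => (O : Set (Spec (.of (Away lineGrading (MvPolynomial.X i)))))) h) _
  refine h2.trans ?_
  change (awayIso i).inv.hom (ratio i) ∉ x.asIdeal ↔ _
  rw [awayIso_inv_ratio]

/-- The function on `T` that a morphism to an affine scheme assigns to a ring element. -/
def pullElem {T : Scheme.{0}} {R : CommRingCat.{0}} (g : T ⟶ Spec R) : R →+* Γ(T, ⊤) :=
  g.appTop.hom.comp (Scheme.ΓSpecIso R).inv.hom

lemma pullElem_comp {T : Scheme.{0}} {R S : CommRingCat.{0}} (g : T ⟶ Spec S) (φ : R ⟶ S) (r : R) :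
    pullElem (g ≫ Spec.map φ) r = pullElem g (φ.hom r) := by
  have h := Scheme.ΓSpecIso_inv_naturality φ
  change (g ≫ Spec.map φ).appTop.hom _ = g.appTop.hom _
  rw [Scheme.Hom.comp_appTop]
  exact congrArg g.appTop.hom congr($h r).symm

lemma awayMap_ratio_mul (i : Fin (1 + 1)) :
    awayMap lineGrading (X_mem_lineGrading i.rev)
      (rfl : MvPolynomial.X i * MvPolynomial.X i.rev = _) (ratio i) *
    awayMap lineGrading (X_mem_lineGrading i)
      (mul_comm _ _ : MvPolynomial.X i * MvPolynomial.X i.rev = _) (ratio i.rev) = 1 := by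
  ext
  simp only [ratio, Away.isLocalizationElem, val_mul, val_one, awayMap_mk, Away.val_mk,
    Localization.mk_mul]
  rw [← Localization.mk_one, Localization.mk_eq_mk_iff, Localization.r_iff_exists]
  exact ⟨1, by simp; ring⟩

/-- On the intersection of the charts the coordinates are inverse to each other. -/
lemma lineChart_mul_eq_one (i : Fin (1 + 1)) {T : Scheme.{0}} (g g' : T ⟶ Spec (.of ℂ[X]))
    (h : g ≫ lineChart i = g' ≫ lineChart i.rev) :
    pullElem g X * pullElem g' X = 1 := by
  have e (j : Fin (1 + 1)) (f : T ⟶ Spec (.of ℂ[X])) :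
      pullElem f X = pullElem (f ≫ Spec.map (awayIso j).inv) (ratio j) := by
    rw [pullElem_comp, awayIso_inv_ratio]
  -- The two maps factor through the intersection of the charts, the spectrum of the localization at
  -- the product of the homogeneous coordinates, where the two ratios are mutually inverse.
  let l := pullback.lift (g ≫ Spec.map (awayIso i).inv) (g' ≫ Spec.map (awayIso i.rev).inv)
    (f := Proj.awayι lineGrading (MvPolynomial.X i) (X_mem_lineGrading i) one_pos)
    (g := Proj.awayι lineGrading (MvPolynomial.X i.rev) (X_mem_lineGrading i.rev) one_pos)
    ((Category.assoc _ _ _).trans (h.trans (Category.assoc _ _ _).symm))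
  let s := l ≫ (Proj.pullbackAwayιIso lineGrading (X_mem_lineGrading i) one_pos
    (X_mem_lineGrading i.rev) one_pos rfl).hom
  have h1 : g ≫ Spec.map (awayIso i).inv = s ≫ Spec.map (CommRingCat.ofHom _) :=
    (pullback.lift_fst _ _ _).symm.trans ((congrArg (l ≫ ·)
      (Proj.pullbackAwayιIso_hom_SpecMap_awayMap_left lineGrading (X_mem_lineGrading i) one_pos
        (X_mem_lineGrading i.rev) one_pos rfl).symm).trans (Category.assoc _ _ _).symm)
  have h2 : g' ≫ Spec.map (awayIso i.rev).inv = s ≫ Spec.map (CommRingCat.ofHom _) :=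
    (pullback.lift_snd _ _ _).symm.trans ((congrArg (l ≫ ·)
      (Proj.pullbackAwayιIso_hom_SpecMap_awayMap_right lineGrading (X_mem_lineGrading i) one_pos
        (X_mem_lineGrading i.rev) one_pos rfl).symm).trans (Category.assoc _ _ _).symm)
  rw [e i g, e i.rev g', h1, h2, pullElem_comp, pullElem_comp, ← map_mul]
  exact (congrArg (pullElem s) (awayMap_ratio_mul i)).trans (map_one _)

/-- The covering of the projective line by its two charts. -/
def lineCover : (Proj lineGrading).OpenCover :=
  Scheme.Cover.mkOfCovers (Fin (1 + 1)) (fun _ => Spec (.of ℂ[X])) lineChart lineChart_covers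
    fun _ => inferInstance

instance : Smooth lineStr := by
  have : ∀ i, IsAffine (lineCover.X i) := fun i => inferInstanceAs (IsAffine (Spec _))
  refine (HasRingHomProperty.iff_of_source_openCover (P := @Smooth) lineCover).2 fun i => ?_
  have h : (algebraMap ℂ ℂ[X]).Smooth := by
    rw [RingHom.smooth_algebraMap]
    constructor <;> infer_instance
  have h2 (i : Fin (1 + 1)) : Smooth (lineChart i ≫ lineStr) := by
    rw [lineChart_str]
    exact (HasRingHomProperty.Spec_iff (P := @Smooth)).2 h
  exact HasRingHomProperty.appTop @Smooth _ (h2 i)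

instance : LocallyOfFiniteType lineStr := inferInstance

instance : QuasiCompact lineStr := by
  have : Algebra.FiniteType (lineGrading 0) (MvPolynomial (Fin (1 + 1)) ℂ) :=
    have : IsScalarTower ℂ (lineGrading 0) (MvPolynomial (Fin (1 + 1)) ℂ) :=
      .of_algebraMap_eq (R := ℂ) (S := lineGrading 0)
        (A := MvPolynomial (Fin (1 + 1)) ℂ) fun _ => rfl
    .of_restrictScalars_finiteType ℂ (lineGrading 0) _
  rw [lineStr]
  infer_instance

instance : IsSeparated lineStr := by
  rw [lineStr]
  infer_instance

end ProjectiveLine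

end LogGeom

/-! ### Lines with coordinates: the data used for both log structures, and the fs chart of the
two-point one. -/

namespace LogGeom

open Polynomial (aeval aeval_C aeval_X)
open scoped Polynomial

/-- The intersection of the two charts of the projective line. -/
def torus : (Proj lineGrading).Opens := (lineChart 0).opensRange ⊓ (lineChart 1).opensRange

lemma mem_torus_iff (i : Fin (1 + 1)) {x : Proj lineGrading} :
    x ∈ torus ↔ x ∈ Set.range (lineChart i) ∧ x ∈ Set.range (lineChart i.rev) := by
  fin_cases i
  · rfl
  · exact and_comm

/-- The charts of the projective line in its small étale site. -/
def chart (i : Fin (1 + 1)) : (Proj lineGrading).Etale := Scheme.Etale.mk (lineChart i)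

namespace LogScheme

/-- A morphism to the affine line is determined by the function it defines. -/
lemma toA1_eq_of_pullElem {L : LogScheme} {U : L.X.Etale} (e : dom U ⟶ Spec (.of ℂ[X]))
    (he : e ≫ Spec.map (CommRingCat.ofHom (algebraMap ℂ ℂ[X])) = proj U ≫ L.str)
    {x : L.Fn U} (hx : pullElem e Polynomial.X = x) : toA1 x = e := by
  have h1 : (aeval (R := ℂ) x).toRingHom = (pullElem e : ℂ[X] →+* L.Fn U) := by
    refine Polynomial.ringHom_ext (fun a => ?_) ((aeval_X _).trans hx.symm)
    refine (aeval_C _ _).trans ?_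
    have h3 := pullElem_comp e (CommRingCat.ofHom (algebraMap ℂ ℂ[X])) a
    rw [he] at h3
    exact h3
  have h2 : (CommRingCat.ofHom (aeval (R := ℂ) x).toRingHom :
      _ ⟶ Γ(dom U, ⊤)) = (Scheme.ΓSpecIso (.of ℂ[X])).inv ≫ e.appTop :=
    CommRingCat.hom_ext h1
  unfold toA1
  rw [h2, Spec.map_comp, ← Scheme.toSpecΓ_naturality_assoc, toSpecΓ_SpecMap_ΓSpecIso_inv,
    Category.comp_id]

lemma nz_iff_of_pullElem {L : LogScheme} {U : L.X.Etale} {R : CommRingCat.{0}} (e : dom U ⟶ Spec R)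
    (r : R) {x : L.Fn U} (hx : pullElem e r = x) (v : dom U) : NZ x v ↔ r ∉ (e v).asIdeal := by
  have h := Scheme.preimage_basicOpen_top e ((Scheme.ΓSpecIso R).inv.hom r)
  have h2 := basicOpen_eq_of_affine r
  subst hx
  exact (Set.ext_iff.1 (congrArg (fun O : (dom U).Opens => (O : Set (dom U))) h) v).symm.trans
    (Set.ext_iff.1 (congrArg (fun O : (Spec R).Opens => (O : Set (Spec R))) h2) (e v))

/-- Affine coordinates that identify the underlying scheme with the projective line. -/
structure LineData (L : LogScheme) where
  U : Fin (1 + 1) → L.X.Etale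
  isOpenImmersion : ∀ i, IsOpenImmersion (proj (U i))
  c : ∀ i, L.Fn (U i)
  isIso_toA1 : ∀ i, IsIso (toA1 (c i))
  covers : ∀ x : L.X, ∃ i, x ∈ Set.range (proj (U i))
  mul : ∀ {i : Fin (1 + 1)} {W : L.X.Etale} (a : W ⟶ U i) (a' : W ⟶ U i.rev),
    L.resFn a (c i) * L.resFn a' (c i.rev) = 1
  mem_range : ∀ {i : Fin (1 + 1)} (w : dom (U i)), NZ (c i) w →
    proj (U i) w ∈ Set.range (proj (U i.rev))

namespace LineData

variable {L : LogScheme} (l : LineData L)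

include l

lemma isEtaleCoord (i : Fin (1 + 1)) : IsEtaleCoord (l.c i) := by
  have := l.isIso_toA1 i
  unfold IsEtaleCoord
  infer_instance

lemma hom_unique {W : L.X.Etale} {i : Fin (1 + 1)} (a a' : W ⟶ l.U i) : a = a' := by
  have := l.isOpenImmersion i
  exact etaleHom_ext ((cancel_mono (proj (l.U i))).1 ((left_proj a).trans (left_proj a').symm))

lemma exists_hom {W : L.X.Etale} (i : Fin (1 + 1))
    (h : ∀ w, proj W w ∈ Set.range (proj (l.U i))) : Nonempty (W ⟶ l.U i) := by
  have := l.isOpenImmersion i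
  exact ⟨homOfLeft (IsOpenImmersion.lift (proj (l.U i)) (proj W) (by
    rintro _ ⟨w, rfl⟩; exact h w)) (IsOpenImmersion.lift_fac _ _ _)⟩

lemma exists_chart (V : L.X.Etale) (v : dom V) :
    ∃ (i : Fin (1 + 1)) (W : L.X.Etale) (b : W ⟶ V) (_ : W ⟶ l.U i), v ∈ Set.range (left b) := by
  obtain ⟨i, hi⟩ := l.covers (proj V v)
  have := l.isOpenImmersion i
  let O : (dom V).Opens := proj V ⁻¹ᵁ (proj (l.U i)).opensRange
  obtain ⟨a⟩ := l.exists_hom (W := sub V O) i fun w => by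
    rw [← left_proj (subι V O)]
    exact (Set.ext_iff.1 (range_subι V O) (left (subι V O) w)).1 ⟨w, rfl⟩
  exact ⟨i, sub V O, subι V O, a, (Set.ext_iff.1 (range_subι V O) v).2 hi⟩

lemma exists_hom_rev {W : L.X.Etale} {i : Fin (1 + 1)} (a : W ⟶ l.U i)
    (h : ∀ w, NZ (L.resFn a (l.c i)) w) : Nonempty (W ⟶ l.U i.rev) :=
  l.exists_hom _ fun w => by
    rw [← left_proj a]
    exact l.mem_range _ ((nz_resFn _ _ _).1 (h w))

lemma pow_mul_cancel_fn {V : L.X.Etale} {i : Fin (1 + 1)} (a : V ⟶ l.U i) (k : ℕ)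
    {f g : L.Fn V} (h : L.resFn a (l.c i) ^ k * f = L.resFn a (l.c i) ^ k * g) : f = g :=
  ((l.isEtaleCoord i).resFn a).pow_mul_left_cancel k h

end LineData

/-- The log structure on the projective line with its coordinates as local generators. -/
structure LogLineData (L : LogScheme) extends LineData L where
  t : ∀ i, L.Mon (U i)
  toFn_t : ∀ i, L.toFn _ (t i) = c i
  injective : ∀ V, Function.Injective (L.toFn V)
  nz_toFn : ∀ {i : Fin (1 + 1)} {V : L.X.Etale} (m : L.Mon V) (a : V ⟶ U i) (v : dom V),
    NZ (L.resFn a (c i)) v → NZ (L.toFn V m) v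

lemma isFsMonoid_nat : IsFsMonoid (Multiplicative ℕ) := by
  refine ⟨⟨inferInstance, inferInstance⟩, fun n hn a b => ?_⟩
  rintro ⟨c, hc⟩
  have h : n * a.toAdd = n * b.toAdd + c.toAdd := congrArg Multiplicative.toAdd hc
  have h2 : b.toAdd ≤ a.toAdd := Nat.le_of_mul_le_mul_left (by omega) hn
  refine ⟨.ofAdd (a.toAdd - b.toAdd), ?_⟩
  rw [← ofAdd_toAdd b, ← ofAdd_add, toAdd_ofAdd, Nat.add_sub_cancel' h2, ofAdd_toAdd]

namespace LogLineData

variable {L : LogScheme} (l : LogLineData L)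

include l

/-- The function of `m` is invertible where the coordinate is, hence locally a power of the
coordinate times a unit. Injectivity of `toFn` lifts this identity to `M`. -/
lemma exists_eq {V : L.X.Etale} {i : Fin (1 + 1)} (a : V ⟶ l.U i) (m : L.Mon V) (v : dom V) :
    ∃ (W : L.X.Etale) (b : W ⟶ V), v ∈ Set.range (left b) ∧ ∃ (k : ℕ) (u : (L.Mon W)ˣ),
      L.res b m = L.res (b ≫ a) (l.t i) ^ k * u := by
  obtain ⟨W, b, hv, k, w, hw, h⟩ := ((l.isEtaleCoord i).resFn a).exists_pow_mul
    (f := L.toFn V m) (l.nz_toFn m a) v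
  obtain ⟨u, rfl⟩ := exists_toFn_eq hw
  refine ⟨W, b, hv, k, (isUnit_toFn.1 hw).unit, l.injective _ ?_⟩
  rw [toFn_res, h, map_mul, map_pow, toFn_res, l.toFn_t, resFn_comp]
  rfl

lemma pow_mul_cancel {V : L.X.Etale} {i : Fin (1 + 1)} (a : V ⟶ l.U i) (k : ℕ)
    {m n : L.Mon V} (h : L.res a (l.t i) ^ k * m = L.res a (l.t i) ^ k * n) : m = n := by
  refine l.injective _ (l.pow_mul_cancel_fn a k ?_)
  have := congrArg (L.toFn V) h
  rwa [map_mul, map_mul, map_pow, toFn_res, l.toFn_t] at this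

/-- The powers of the coordinate form a chart. -/
lemma isChart_t (i : Fin (1 + 1)) :
    L.IsChart (l.U i) (powersHom _ (l.t i)) := by
  refine ⟨fun V b m => .of_cover ?_ fun v => ?_, fun V b p q u h => LocallyOn.of_forall fun W c => ?_⟩
  · rintro W W' c d ⟨p, u, h⟩
    refine ⟨p, Units.map (L.res d) u, ?_⟩
    rw [res_comp, h, map_mul, ← res_comp, Category.assoc]
    rfl
  · obtain ⟨W, c, hv, k, u, h⟩ := l.exists_eq b m v
    refine ⟨W, c, hv, .ofAdd k, u, ?_⟩
    rw [h, powersHom_apply, map_pow, toAdd_ofAdd]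
  · have h' := congrArg (L.res c) h
    rw [map_mul, ← res_comp, ← res_comp, powersHom_apply, powersHom_apply, map_pow, map_pow] at h'
    simp only [powersHom_apply, map_pow]
    obtain ⟨p, rfl⟩ := Multiplicative.ofAdd.surjective p
    obtain ⟨q, rfl⟩ := Multiplicative.ofAdd.surjective q
    rw [toAdd_ofAdd, toAdd_ofAdd] at h'
    have hu : IsUnit (L.res c u) := u.isUnit.map _
    -- Cancelling the smaller power of the coordinate leaves an identity between its remaining
    -- power, with exponent the difference `s`, and a unit. This power is thus itself a unit, and it
    -- corrects the smaller exponent.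
    obtain hpq | hpq := le_total q p
    · obtain ⟨s, rfl⟩ := Nat.exists_eq_add_of_le hpq
      rw [pow_add] at h'
      have h2 := l.pow_mul_cancel _ _ h'
      refine ⟨1, .ofAdd s, by simp, ?_, by rw [mul_one]; rfl, ?_⟩
      · rw [toAdd_ofAdd, h2]; exact hu
      · rw [toAdd_ofAdd, h2, toAdd_one, pow_zero, mul_one]
    · obtain ⟨s, rfl⟩ := Nat.exists_eq_add_of_le hpq
      rw [pow_add, mul_assoc, ← mul_one (_ ^ p), mul_assoc, one_mul] at h'
      have h2 := l.pow_mul_cancel _ _ h'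
      refine ⟨.ofAdd s, 1, ?_, by simp, by rw [mul_one]; rfl, ?_⟩
      · rw [toAdd_ofAdd]; exact IsUnit.of_mul_eq_one _ h2.symm
      · rw [toAdd_ofAdd, toAdd_one, pow_zero, h2, mul_comm]

lemma isFs : L.IsFs := by
  intro x
  obtain ⟨i, hi⟩ := l.covers x
  exact ⟨l.U i, hi, Multiplicative ℕ, inferInstance, _, isFsMonoid_nat, l.isChart_t i⟩

end LogLineData

/-- The projective line with the log structure of functions that are invertible over `D`. -/
def line (D : (Proj lineGrading).Opens) : LogScheme := divLog (Proj lineGrading) lineStr D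

/-- The coordinates of the projective line. -/
def lineData (D : (Proj lineGrading).Opens) : LineData (line D) where
  U := chart
  isOpenImmersion i := isOpenImmersion_lineChart i
  c i := (pullElem (𝟙 (Spec (.of ℂ[X]))) Polynomial.X : Γ(Spec (.of ℂ[X]), ⊤))
  isIso_toA1 i := by
    have h := toA1_eq_of_pullElem (L := line D) (U := chart i) (𝟙 (Spec (.of ℂ[X])))
      ((Category.id_comp _).trans (lineChart_str i).symm) rfl
    have h2 : IsIso (𝟙 (Spec (.of ℂ[X]))) := inferInstance
    exact (congrArg (fun f : Spec (.of ℂ[X]) ⟶ Spec (.of ℂ[X]) => IsIso f) h).mpr h2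
  covers := lineChart_covers
  mul {i W} a a' := by
    have h : left a ≫ lineChart i = left a' ≫ lineChart i.rev :=
      (left_proj a).trans (left_proj a').symm
    exact lineChart_mul_eq_one i (left a) (left a') h
  mem_range {i} w hw := (lineChart_mem_iff i w).2
    ((nz_iff_of_pullElem (L := line D) (U := chart i) (𝟙 (Spec (.of ℂ[X]))) _ rfl w).1 hw)

/-- The projective line with the log structure given by the two points `0` and `∞`. -/
def logLineData : LogLineData (line torus) where
  __ := lineData torus
  t i := ⟨(pullElem (𝟙 (Spec (.of ℂ[X]))) Polynomial.X : Γ(Spec (.of ℂ[X]), ⊤)),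
    fun w hw => (nz_iff_of_pullElem (L := line torus) (U := chart i) (𝟙 (Spec (.of ℂ[X]))) _ rfl
      w).2 ((lineChart_mem_iff i w).1 ((mem_torus_iff i).1 hw).2)⟩
  toFn_t i := rfl
  injective V := Subtype.val_injective
  nz_toFn {i V} m a v h := by
    refine m.2 ((mem_torus_iff i).2 ⟨?_, ?_⟩)
    · exact ⟨left a v, congr($(left_proj a) v)⟩
    · have h2 := (lineData torus).mem_range (left a v) ((nz_resFn _ _ _).1 h)
      have h3 : proj (chart i) (left a v) = proj V v := congr($(left_proj a) v)
      exact h3 ▸ h2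

end LogScheme
end LogGeom

namespace LogGeom

open Polynomial (aeval aeval_C aeval_X)
open scoped Polynomial TensorProduct

/-! ### A geometric generic point of the affine line and its derivation -/

/-- An algebraic closure of `ℂ(T)`. -/
abbrev GenField : Type := AlgebraicClosure (FractionRing ℂ[X])

/-- The element `T` of `GenField`. -/
def genT : GenField := algebraMap ℂ[X] GenField Polynomial.X

instance : IsScalarTower ℂ[X] (FractionRing ℂ[X]) GenField := inferInstance

instance : IsScalarTower ℂ ℂ[X] GenField := inferInstance

lemma algebraMap_genField_injective : Function.Injective (algebraMap ℂ[X] GenField) := by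
  rw [IsScalarTower.algebraMap_eq ℂ[X] (FractionRing ℂ[X]) GenField]
  exact (algebraMap (FractionRing ℂ[X]) GenField).injective.comp (IsFractionRing.injective _ _)

lemma genT_ne_zero : genT ≠ 0 := fun h => Polynomial.X_ne_zero (R := ℂ)
  (algebraMap_genField_injective (h.trans (map_zero _).symm))

/-- A localization followed by a separable algebraic extension. It is what makes differentiation
with respect to T extend to `GenField`. -/
instance : Algebra.FormallyEtale ℂ[X] GenField := by
  have : Algebra.FormallyEtale ℂ[X] (FractionRing ℂ[X]) :=
    .of_isLocalization (nonZeroDivisors ℂ[X])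
  have : Algebra.FormallyEtale (FractionRing ℂ[X]) GenField := .of_isSeparable _ _
  exact .comp ℂ[X] (FractionRing ℂ[X]) GenField

/-- Differentiation with respect to `T`. -/
def genD : Derivation ℂ GenField GenField :=
  ((LinearMap.liftBaseChange GenField ((Algebra.linearMap ℂ[X] GenField) ∘ₗ
    (KaehlerDifferential.polynomialEquiv ℂ).toLinearMap)) ∘ₗ
    (KaehlerDifferential.tensorKaehlerEquivOfFormallyEtale ℂ ℂ[X]
      GenField).symm.toLinearMap).compDer (KaehlerDifferential.D ℂ GenField)

lemma genD_genT : genD genT = 1 := by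
  have h := KaehlerDifferential.tensorKaehlerEquivOfFormallyEtale_symm_D_algebraMap ℂ ℂ[X] GenField
    Polynomial.X
  change (LinearMap.liftBaseChange GenField _) ((KaehlerDifferential.tensorKaehlerEquivOfFormallyEtale
    ℂ ℂ[X] GenField).symm (KaehlerDifferential.D ℂ GenField genT)) = 1
  rw [genT, h]
  simp

/-- The log structure on `GenField`. -/
abbrev genLog : GenFieldˣ →* GenField := Units.coeHom GenField

/-- The linear form on log differentials of `GenField` given by `genD`. -/
def genForm : LogDiff ℂ genLog →ₗ[GenField] GenField :=
  (logRel ℂ genLog).liftQ (LinearMap.coprod genD.liftKaehlerDifferential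
    (Finsupp.linearCombination GenField fun u : GenFieldˣ => genD u * (u⁻¹ : GenFieldˣ))) (by
    rw [logRel, Submodule.span_le]
    rintro _ (⟨m, rfl⟩ | ⟨m, n, rfl⟩)
    · simp [mul_comm (genD _)]
    · simp
      field_simp
      ring)

lemma genForm_dd (f : GenField) : genForm (dd ℂ genLog f) = genD f := by
  simp [genForm, dd]

lemma genForm_dlog (u : GenFieldˣ) :
    genForm (dlog ℂ genLog u) = genD u * (u⁻¹ : GenFieldˣ) := by
  simp [genForm, dlog]

end LogGeom

namespace LogGeom

lemma isSheaf_moduleCat {R : Type} [Ring R] {C : Type*} [Category C] {J : GrothendieckTopology C}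
    {P : Cᵒᵖ ⥤ ModuleCat.{0} R} (hP : Presieve.IsSheaf J (P ⋙ forget (ModuleCat R))) :
    Presheaf.IsSheaf J P := by
  intro E V S hS x hx
  let x' {W : C} (b : W ⟶ V) (hb : S b) : E →ₗ[R] P.obj (op W) :=
    @ModuleCat.Hom.hom R _ E (P.obj (op W)) (x b hb)
  have hc (e : E) : Presieve.FamilyOfElements.Compatible (P := P ⋙ forget (ModuleCat R))
      (R := S.arrows) fun W b hb => x' b hb e :=
    fun Y₁ Y₂ Z g₁ g₂ f₁ f₂ h₁ h₂ h =>
      congrArg (fun k : E ⟶ P.obj (op Z) => k.hom e) (hx g₁ g₂ h₁ h₂ h)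
  choose y hy hu using fun e => hP S hS _ (hc e)
  refine ⟨ModuleCat.ofHom ⟨⟨y, ?_⟩, ?_⟩, ?_, ?_⟩
  · exact fun e e' => (hu (e + e') (y e + y e') fun W b hb =>
      (map_add (P.map b.op).hom _ _).trans <| Eq.trans
        (congrArg₂ (· + ·) (hy e b hb) (hy e' b hb)) (map_add (x' b hb) e e').symm).symm
  · exact fun r e => (hu (r • e) (r • y e) fun W b hb =>
      (map_smul (P.map b.op).hom _ _).trans <| Eq.trans
        (congrArg (r • ·) (hy e b hb)) (map_smul (x' b hb) r e).symm).symm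
  · exact fun W b hb => ModuleCat.hom_ext (LinearMap.ext fun e => hy e b hb)
  · exact fun z hz => ModuleCat.hom_ext (LinearMap.ext fun e => hu e _ fun W b hb =>
      congrArg (fun k : E ⟶ P.obj (op W) => k.hom e) (hz b hb))

namespace LogScheme

variable {L : LogScheme}

/-! ### Points with values in a field -/

/-- The `k`-valued points over `ℂ` of `V` that lie over `D`. -/
@[ext] structure FieldPt (k : Type) [Field k] [Algebra ℂ k] (D : L.X.Opens) (V : L.X.Etale) : Type where
  pt : Spec (.of k) ⟶ dom V
  pt_str : pt ≫ proj V ≫ L.str = Spec.map (CommRingCat.ofHom (algebraMap ℂ k))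
  mem : proj V (pt default) ∈ D

namespace FieldPt

variable {k : Type} [Field k] [Algebra ℂ k] {D : L.X.Opens}

/-- The image of a point. -/
def map {V W : L.X.Etale} (b : W ⟶ V) (τ : FieldPt k D W) : FieldPt k D V where
  pt := τ.pt ≫ left b
  pt_str := by rw [← τ.pt_str, ← left_proj b, Category.assoc, Category.assoc]
  mem := by
    have h : proj V (left b (τ.pt default)) = proj W (τ.pt default) :=
      congr($(left_proj b) (τ.pt default))
    exact h.symm ▸ τ.mem

lemma map_comp {U V W : L.X.Etale} (b : V ⟶ U) (c : W ⟶ V) (τ : FieldPt k D W) :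
    τ.map (c ≫ b) = (τ.map c).map b := FieldPt.ext (Category.assoc _ _ _).symm

lemma map_id {V : L.X.Etale} (τ : FieldPt k D V) : τ.map (𝟙 V) = τ := FieldPt.ext (Category.comp_id _)

/-- Evaluation of functions at a point. -/
def evalAt {V : L.X.Etale} (τ : FieldPt k D V) : L.Fn V →ₐ[ℂ] k where
  __ := ev τ.pt
  commutes' := ev_algebraMap τ.pt τ.pt_str

lemma evalAt_map {V W : L.X.Etale} (b : W ⟶ V) (τ : FieldPt k D W) (x : L.Fn V) :
    (τ.map b).evalAt x = τ.evalAt (L.resFn b x) := (ev_resFn b τ.pt x).symm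

lemma evalAt_ne_zero {V : L.X.Etale} (τ : FieldPt k D V) {x : L.Fn V} (h : NZ x (τ.pt default)) :
    τ.evalAt x ≠ 0 :=
  (nz_iff_ev τ.pt x).1 h

lemma exists_common {V W W' : L.X.Etale} (b : W ⟶ V) (b' : W' ⟶ V) (σ : FieldPt k D W)
    (σ' : FieldPt k D W') (h : σ.map b = σ'.map b') :
    ∃ (Z : L.X.Etale) (g : Z ⟶ W) (g' : Z ⟶ W') (ρ : FieldPt k D Z), g ≫ b = g' ≫ b' ∧
      ρ.map g = σ ∧ ρ.map g' = σ' := by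
  have e0 : pullback.fst (left b) (left b') ≫ proj W = pullback.snd (left b) (left b') ≫ proj W' := by
    rw [← left_proj b', ← pullback.condition_assoc, left_proj]
  let Z : L.X.Etale := Scheme.Etale.mk (pullback.fst (left b) (left b') ≫ proj W)
  let g : Z ⟶ W := homOfLeft (V := Z) (pullback.fst (left b) (left b')) rfl
  let g' : Z ⟶ W' := homOfLeft (V := Z) (pullback.snd (left b) (left b')) e0.symm
  have e : σ.pt ≫ left b = σ'.pt ≫ left b' := congrArg FieldPt.pt h
  let r : Spec (.of k) ⟶ dom Z := pullback.lift σ.pt σ'.pt e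
  have h1 : r ≫ left g = σ.pt := pullback.lift_fst _ _ _
  have h2 : r ≫ left g' = σ'.pt := pullback.lift_snd _ _ _
  refine ⟨Z, g, g', ⟨r, ?_, ?_⟩, etaleHom_ext pullback.condition, FieldPt.ext h1, FieldPt.ext h2⟩
  · rw [← σ.pt_str, ← h1, Category.assoc, ← left_proj g, Category.assoc]
  · have h3 : proj W (left g (r default)) = proj Z (r default) := congr($(left_proj g) (r default))
    have h4 : proj W (left g (r default)) = proj W (σ.pt default) :=
      congrArg (proj W) congr($h1 default)
    rw [← h3, h4]
    exact σ.mem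

variable [IsSepClosed k]

/-- Residue field extensions of étale morphisms are separable, so a point with values in a separably
closed field lifts through every preimage of its image. -/
lemma exists_map_eq {V W : L.X.Etale} (b : W ⟶ V) (τ : FieldPt k D V) (w : dom W)
    (hw : left b w = τ.pt default) : ∃ σ : FieldPt k D W, σ.map b = τ := by
  obtain ⟨l, hl, hl'⟩ := Scheme.exists_fac_of_etale_of_isSepClosed (left b) τ.pt w hw
  refine ⟨⟨l, ?_, ?_⟩, FieldPt.ext hl⟩
  · rw [← τ.pt_str, ← hl, ← left_proj b, Category.assoc, Category.assoc]
  · have h : proj V (left b (l default)) = proj W (l default) := congr($(left_proj b) (l default))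
    rw [← h, hl', hw]
    exact τ.mem

lemma exists_mem {V : L.X.Etale} {Q : ∀ ⦃W : L.X.Etale⦄, (W ⟶ V) → Prop} (h : LocallyOn V Q)
    (τ : FieldPt k D V) : ∃ (W : L.X.Etale) (b : W ⟶ V) (σ : FieldPt k D W), Q b ∧ σ.map b = τ := by
  obtain ⟨W, b, ⟨w, hw⟩, hb⟩ := h.exists_mem (τ.pt default)
  obtain ⟨σ, hσ⟩ := τ.exists_map_eq b w hw
  exact ⟨W, b, σ, hb, hσ⟩

end FieldPt

variable (D : L.X.Opens)

/-- The presheaf of `A`-valued functions on points. -/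
def ptFun (k : Type) [Field k] [Algebra ℂ k] (A : Type) : L.X.Etaleᵒᵖ ⥤ Type where
  obj V := FieldPt k D V.unop → A
  map b := TypeCat.ofHom fun f τ => f (τ.map b.unop)
  map_id V := by
    ext f τ
    exact congrArg f τ.map_id
  map_comp b c := by
    ext f τ
    exact congrArg f (FieldPt.map_comp _ _ _)

/-- Every point of `V` lifts to some member of the covering, and two lifts come from one point of a
fibre product, where compatibility applies. -/
lemma isSheaf_ptFun (k : Type) [Field k] [Algebra ℂ k] [IsSepClosed k] (A : Type) :
    Presieve.IsSheaf L.X.smallEtaleTopology (ptFun D k A) := by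
  intro V S hS x hx
  let y {W : L.X.Etale} (b : W ⟶ V) (hb : S b) : FieldPt k D W → A := x b hb
  have hy {W W' : L.X.Etale} (b : W ⟶ V) (hb : S b) (b' : W' ⟶ V) (hb' : S b') (σ : FieldPt k D W)
      (σ' : FieldPt k D W') (h : σ.map b = σ'.map b') : y b hb σ = y b' hb' σ' := by
    obtain ⟨Z, g, g', ρ, e, rfl, rfl⟩ := FieldPt.exists_common b b' σ σ' h
    exact congrFun (hx g g' hb hb' e) ρ
  have hex (τ : FieldPt k D V) := τ.exists_mem (Q := fun W b => S b) ⟨S, hS, fun W b hb => hb⟩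
  choose W b σ hb hσ using hex
  refine ⟨fun τ => y (b τ) (hb τ) (σ τ), fun W' c hc => funext fun ρ => ?_, fun z hz => funext fun τ => ?_⟩
  · exact hy _ _ _ _ _ _ (hσ _)
  · have h : z ((σ τ).map (b τ)) = y (b τ) (hb τ) (σ τ) := congrFun (hz (b τ) (hb τ)) (σ τ)
    rw [hσ] at h
    exact h

/-- The presheaf of `GenField`-valued functions on points. -/
def genPresheaf : L.X.Etaleᵒᵖ ⥤ ModuleCat.{0} ℂ where
  obj V := ModuleCat.of ℂ (FieldPt GenField D V.unop → GenField)
  map b := ModuleCat.ofHom (LinearMap.funLeft ℂ GenField (FieldPt.map b.unop))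
  map_id V := by
    refine ModuleCat.hom_ext (LinearMap.ext fun f => funext fun τ => ?_)
    exact congrArg f τ.map_id
  map_comp b c := by
    refine ModuleCat.hom_ext (LinearMap.ext fun f => funext fun τ => ?_)
    exact congrArg f (τ.map_comp _ _)

lemma isSheaf_genPresheaf : Presheaf.IsSheaf L.X.smallEtaleTopology (genPresheaf D) :=
  isSheaf_moduleCat (isSheaf_ptFun D GenField GenField)

end LogScheme
end LogGeom

/-! ### Generic points of the charts, and global functions on the projective line. -/

namespace LogGeom

open Polynomial (aeval aeval_C aeval_X)
open scoped Polynomial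

/-- Multiplying by T to the degree of `q` turns the right side into the reversed polynomial, whose
degree is at most that of `q`. Hence `p` has degree 0. -/
lemma exists_eq_C_of_aeval_inv {p q : ℂ[X]} (h : aeval genT p = aeval genT⁻¹ q) :
    ∃ z : ℂ, p = Polynomial.C z := by
  let : Invertible genT⁻¹ := invertibleOfNonzero (inv_ne_zero genT_ne_zero)
  have h1 := Polynomial.eval₂_reverse_mul_pow (algebraMap ℂ GenField) genT⁻¹ q
  rw [invOf_eq_inv, inv_inv] at h1
  change aeval genT q.reverse * _ = aeval genT⁻¹ q at h1
  have h0 : aeval genT (p * Polynomial.X ^ q.natDegree) = aeval genT q.reverse := by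
    rw [map_mul, map_pow, aeval_X, h, ← h1, mul_assoc, ← mul_pow, inv_mul_cancel₀ genT_ne_zero,
      one_pow, mul_one]
  have h2 : ∀ r : ℂ[X], aeval genT r = algebraMap ℂ[X] GenField r := fun r =>
    (Polynomial.aeval_algebraMap_apply GenField Polynomial.X r).trans (by
      rw [Polynomial.aeval_X_left_apply])
  rw [h2, h2] at h0
  have h3 := algebraMap_genField_injective h0
  refine ⟨p.coeff 0, Polynomial.eq_C_of_natDegree_eq_zero ?_⟩
  by_contra hp
  have hp0 : p ≠ 0 := fun e => hp (by rw [e, Polynomial.natDegree_zero])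
  have h4 := congrArg Polynomial.natDegree h3
  rw [Polynomial.natDegree_mul_X_pow _ hp0] at h4
  have := Polynomial.reverse_natDegree_le q
  omega

namespace LogScheme

variable {L : LogScheme}

lemma pullElem_toA1 {U : L.X.Etale} (c : L.Fn U) (p : ℂ[X]) :
    (pullElem (toA1 c) p : L.Fn U) = aeval (R := ℂ) c p := by
  refine (pullElem_comp (R := .of ℂ[X]) (dom U).toSpecΓ
    (CommRingCat.ofHom (aeval (R := ℂ) c).toRingHom : _ ⟶ Γ(dom U, ⊤)) p).trans ?_
  have h : (dom U).toSpecΓ.appTop = (Scheme.ΓSpecIso Γ(dom U, ⊤)).hom := Scheme.toSpecΓ_appTop _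
  change (dom U).toSpecΓ.appTop.hom ((Scheme.ΓSpecIso Γ(dom U, ⊤)).inv.hom _) = _
  rw [h]
  exact congr($((Scheme.ΓSpecIso Γ(dom U, ⊤)).inv_hom_id) _)

lemma toA1_comp {U : L.X.Etale} (c : L.Fn U) :
    toA1 c ≫ Spec.map (CommRingCat.ofHom (algebraMap ℂ ℂ[X])) = proj U ≫ L.str := by
  have h : CommRingCat.ofHom (algebraMap ℂ ℂ[X]) ≫
      (CommRingCat.ofHom (aeval (R := ℂ) c).toRingHom : _ ⟶ Γ(dom U, ⊤)) =
      (Scheme.ΓSpecIso (.of ℂ)).inv ≫ (proj U ≫ L.str).appTop :=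
    CommRingCat.hom_ext (RingHom.ext fun z => aeval_C c z)
  rw [toA1, Category.assoc, ← Spec.map_comp, h, Spec.map_comp, ← Scheme.toSpecΓ_naturality_assoc,
    toSpecΓ_SpecMap_ΓSpecIso_inv, Category.comp_id]

lemma ev_aeval {R : CommRingCat.{0}} {U : L.X.Etale} (c : L.Fn U) (z : Spec R ⟶ dom U)
    (φ : CommRingCat.of ℂ[X] ⟶ R) (hz : z ≫ toA1 c = Spec.map φ) (p : ℂ[X]) :
    ev (R := R) z (aeval (R := ℂ) c p) = φ.hom p := by
  rw [← pullElem_toA1]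
  change (Scheme.ΓSpecIso R).hom.hom (z.appTop.hom ((toA1 c).appTop.hom
    ((Scheme.ΓSpecIso (.of ℂ[X])).inv.hom p))) = _
  have h1 : (toA1 c).appTop ≫ z.appTop = (Spec.map φ).appTop := by
    rw [← Scheme.Hom.comp_appTop, hz]
  have h2 := congr($h1 ((Scheme.ΓSpecIso (.of ℂ[X])).inv.hom p))
  refine (congrArg (Scheme.ΓSpecIso R).hom.hom h2).trans ?_
  have h3 := congr($(Scheme.ΓSpecIso_inv_naturality φ) p)
  refine (congrArg (Scheme.ΓSpecIso R).hom.hom h3.symm).trans ?_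
  exact congr($((Scheme.ΓSpecIso R).inv_hom_id) _)

/-- An étale coordinate takes the value `T` at some point. -/
lemma IsEtaleCoord.exists_ev_eq {V : L.X.Etale} {c : L.Fn V} (hc : IsEtaleCoord c) (v : dom V) :
    ∃ τ : Spec (.of GenField) ⟶ dom V, τ ≫ proj V ≫ L.str =
      Spec.map (CommRingCat.ofHom (algebraMap ℂ GenField)) ∧ ev τ c = genT := by
  have : Etale (toA1 c) := hc
  let γ : Spec (.of GenField) ⟶ Spec (.of ℂ[X]) :=
    Spec.map (CommRingCat.ofHom (algebraMap ℂ[X] GenField))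
  have h1 : γ default ∈ Set.range (toA1 c) := by
    have h0 : γ default = (⊥ : PrimeSpectrum ℂ[X]) := by
      have h1 : (default : Spec (.of GenField)) = (⊥ : PrimeSpectrum GenField) :=
        Subsingleton.elim _ _
      rw [h1]
      refine PrimeSpectrum.ext ?_
      change Ideal.comap (algebraMap ℂ[X] GenField) (⊥ : Ideal GenField) = ⊥
      exact (RingHom.injective_iff_ker_eq_bot _).1 algebraMap_genField_injective
    -- The image of an étale morphism is open. It contains the image of `v`, hence also the generic
    -- point of the affine line, which specializes to it.
    have h2 := (toA1 c).isOpenMap _ isOpen_univ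
    rw [Set.image_univ] at h2
    have h3 : (⊥ : PrimeSpectrum ℂ[X]) ⤳ toA1 c v :=
      (PrimeSpectrum.le_iff_specializes _ _).1 bot_le
    rw [h0]
    exact h3.mem_open h2 ⟨v, rfl⟩
  obtain ⟨w, hw⟩ := h1
  obtain ⟨τ, hτ, -⟩ := Scheme.exists_fac_of_etale_of_isSepClosed (toA1 c) γ w hw
  refine ⟨τ, ?_, ?_⟩
  · rw [← toA1_comp c, ← Category.assoc, hτ, ← Spec.map_comp, ← CommRingCat.ofHom_comp]
    rfl
  · have := ev_aeval c τ _ hτ Polynomial.X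
    rwa [aeval_X] at this

namespace LineData

variable (l : LineData L)

/-- The intersection of the charts. -/
def torus : L.X.Opens :=
  have := l.isOpenImmersion
  (proj (l.U 0)).opensRange ⊓ (proj (l.U 1)).opensRange

lemma mem_torus (i : Fin (1 + 1)) {x : L.X} :
    x ∈ l.torus ↔ x ∈ Set.range (proj (l.U i)) ∧ x ∈ Set.range (proj (l.U i.rev)) := by
  fin_cases i
  · rfl
  · exact and_comm

lemma mem_torus_of_nz {i : Fin (1 + 1)} {V : L.X.Etale} (a : V ⟶ l.U i) (v : dom V)
    (h : NZ (L.resFn a (l.c i)) v) : proj V v ∈ l.torus := by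
  have h3 : proj (l.U i) (left a v) = proj V v := congr($(left_proj a) v)
  rw [l.mem_torus i, ← h3]
  exact ⟨⟨_, rfl⟩, l.mem_range _ ((nz_resFn _ _ _).1 h)⟩

lemma exists_genPt {i : Fin (1 + 1)} {V : L.X.Etale} (a : V ⟶ l.U i) (v : dom V) :
    ∃ τ : FieldPt GenField l.torus V, τ.evalAt (L.resFn a (l.c i)) = genT := by
  obtain ⟨τ, h1, h2⟩ := ((l.isEtaleCoord i).resFn a).exists_ev_eq v
  refine ⟨⟨τ, h1, l.mem_torus_of_nz a _ ((nz_iff_ev τ _).2 ?_)⟩, h2⟩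
  rw [h2]
  exact genT_ne_zero

/-- `V` is reduced, so a non-zero `f` is invertible on a non-empty open subscheme. That subscheme
has a point where the coordinate takes the value T; its derivative there is 1, so the value of `f`
would be 0. -/
lemma eq_zero_of_evalAt {i : Fin (1 + 1)} {V : L.X.Etale} (a : V ⟶ l.U i) {f : L.Fn V}
    (h : ∀ τ : FieldPt GenField l.torus V, τ.evalAt f * genD (τ.evalAt (L.resFn a (l.c i))) = 0) : f = 0 := by
  have := ((l.isEtaleCoord i).resFn a).isReduced
  refine (basicOpen_eq_bot_iff (X := dom V) (U := ⊤) f).1 ?_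
  by_contra hne
  obtain ⟨v, hv⟩ := (TopologicalSpace.Opens.ne_bot_iff_nonempty _).1 hne
  obtain ⟨w, -⟩ := (range_locusι f v).2 hv
  obtain ⟨τ, hτ⟩ := l.exists_genPt (locusι f ≫ a) w
  have h1 := h (τ.map (locusι f))
  rw [FieldPt.evalAt_map, FieldPt.evalAt_map, ← resFn_comp, hτ, genD_genT, mul_one] at h1
  exact ((isUnit_resFn_locusι f).map τ.evalAt).ne_zero h1

lemma exists_aeval_eq (i : Fin (1 + 1)) (f : L.Fn (l.U i)) :
    ∃ p : ℂ[X], f = aeval (R := ℂ) (l.c i) p := by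
  have := l.isIso_toA1 i
  refine ⟨(Scheme.ΓSpecIso (.of ℂ[X])).hom.hom ((inv (toA1 (l.c i))).appTop.hom f), ?_⟩
  rw [← pullElem_toA1]
  have h1 : (inv (toA1 (l.c i))).appTop ≫ (toA1 (l.c i)).appTop = 𝟙 _ := by
    rw [← Scheme.Hom.comp_appTop, IsIso.hom_inv_id, Scheme.Hom.id_appTop]
  have h2 := congr($((Scheme.ΓSpecIso (.of ℂ[X])).hom_inv_id) ((inv (toA1 (l.c i))).appTop.hom f))
  exact (congr($h1 f).symm).trans (congrArg (toA1 (l.c i)).appTop.hom h2.symm)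

lemma evalAt_aeval {V : L.X.Etale} (τ : FieldPt GenField l.torus V) (c : L.Fn V) (p : ℂ[X]) :
    τ.evalAt (aeval (R := ℂ) c p) = aeval (τ.evalAt c) p :=
  (Polynomial.aeval_algHom_apply τ.evalAt c p).symm

lemma fn_ext_charts {V : L.X.Etale} {f g : L.Fn V}
    (h : ∀ (i) (W : L.X.Etale) (b : W ⟶ V) (a : W ⟶ l.U i), L.resFn b f = L.resFn b g) : f = g := by
  refine fn_ext (.of_cover (fun W W' b c e => ?_) fun v => ?_)
  · rw [resFn_comp, resFn_comp, e]
  · obtain ⟨i, W, b, a, hv⟩ := l.exists_chart V v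
    exact ⟨W, b, hv, h i W b a⟩

/-- Global functions on the projective line are constant. -/
lemma exists_eq_algebraMap (f : L.Fn (top L.X)) (hne : ∀ i, Nonempty (dom (l.U i))) :
    ∃ z : ℂ, f = algebraMap ℂ (L.Fn (top L.X)) z := by
  let t (i) : l.U i ⟶ top L.X := (isTerminalTop L.X).from _
  choose p hp using fun i => l.exists_aeval_eq i (L.resFn (t i) f)
  -- Both polynomial expressions of `f` are evaluated at a point of the overlap where one coordinate
  -- is T and the other one therefore T⁻¹.
  have key (i) : aeval genT (p i) = aeval genT⁻¹ (p i.rev) := by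
    obtain ⟨v⟩ := hne i
    obtain ⟨τ₀, hτ₀⟩ := l.exists_genPt (𝟙 (l.U i)) v
    rw [resFn_id] at hτ₀
    let W := locus (l.c i)
    obtain ⟨a'⟩ := l.exists_hom_rev (locusι (l.c i)) ((isUnit_iff_nz _).1 (isUnit_resFn_locusι (l.c i)))
    obtain ⟨w, hw⟩ := (range_locusι (l.c i) (τ₀.pt default)).2 ((nz_iff_ev τ₀.pt _).2 (by
      change τ₀.evalAt _ ≠ 0
      rw [hτ₀]
      exact genT_ne_zero))
    obtain ⟨σ, rfl⟩ := τ₀.exists_map_eq _ w hw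
    rw [FieldPt.evalAt_map] at hτ₀
    have hm := congrArg σ.evalAt (l.mul (locusι (l.c i)) a')
    rw [map_mul, hτ₀, map_one] at hm
    have hm' := eq_inv_of_mul_eq_one_right hm
    have e1 : locusι (l.c i) ≫ t i = a' ≫ t i.rev := (isTerminalTop L.X).hom_ext _ _
    have e2 : L.resFn (locusι (l.c i)) (L.resFn (t i) f) = L.resFn a' (L.resFn (t i.rev) f) := by
      rw [← resFn_comp, ← resFn_comp, e1]
    rw [hp, hp] at e2
    have e3 := congrArg σ.evalAt e2
    rw [← FieldPt.evalAt_map, ← FieldPt.evalAt_map, l.evalAt_aeval, l.evalAt_aeval, FieldPt.evalAt_map,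
      FieldPt.evalAt_map, hτ₀, hm'] at e3
    exact e3
  choose z hz using fun i => exists_eq_C_of_aeval_inv (key i)
  have hzz : ∀ i, z i = z 0 := by
    have h := key 0
    rw [hz, hz, aeval_C, aeval_C] at h
    have h' : z 0 = z 1 := (algebraMap ℂ GenField).injective h
    intro i
    fin_cases i
    · rfl
    · exact h'.symm
  refine ⟨z 0, l.fn_ext_charts fun i W b a => ?_⟩
  have h1 : b = a ≫ t i := (isTerminalTop L.X).hom_ext _ _
  rw [h1, resFn_comp, hp, hz, hzz, aeval_C]
  simp

end LineData

end LogScheme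

/-! ### Cohomology in degree zero -/

namespace LogScheme

open Abelian in
/-- Cohomology in degree zero is the space of global sections. -/
def hZeroEquiv (X : LogScheme) (F : Sheaf X.X.smallEtaleTopology (ModuleCat.{0} ℂ)) :
    X.H F 0 ≃ₗ[ℂ] F.obj.obj (op (top X.X)) :=
  Ext.linearEquiv₀ (R := ℂ) ≪≫ₗ
    { ((constantSheafAdj X.X.smallEtaleTopology (ModuleCat.{0} ℂ) (isTerminalTop X.X)).homEquiv
        (ModuleCat.of ℂ ℂ) F) with
      map_add' := fun f g => by simp [Adjunction.homEquiv_unit]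
      map_smul' := fun c f => by simp [Adjunction.homEquiv_unit]; rfl } ≪≫ₗ
    ModuleCat.homLinearEquiv (S := ℂ) ≪≫ₗ LinearMap.ringLmapEquivSelf ℂ ℂ _

/-! ### The sheaf of log one-forms -/

/-- Sections of the presheaf of log one-forms. -/
abbrev PreForm (L : LogScheme) (V : L.X.Etale) : Type := LogForms ℂ (L.toFn V) 1

/-- Sections of the sheaf of log one-forms. -/
abbrev Form (L : LogScheme) (V : L.X.Etale) : Type := (L.forms 1).obj.obj (op V)

variable {L : LogScheme}

/-- Restriction of sections of the presheaf of log one-forms. -/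
def resPreForm {V W : L.X.Etale} (b : W ⟶ V) : L.PreForm V →ₗ[ℂ] L.PreForm W :=
  LogForms.map (L.resPre b) 1

/-- Restriction of sections of the sheaf of log one-forms. -/
def resForm {V W : L.X.Etale} (b : W ⟶ V) : L.Form V →ₗ[ℂ] L.Form W :=
  ((L.forms 1).obj.map b.op).hom

lemma resForm_comp {U V W : L.X.Etale} (b : V ⟶ U) (c : W ⟶ V) (x : L.Form U) :
    resForm (c ≫ b) x = resForm c (resForm b x) :=
  congr($((L.forms 1).obj.map_comp b.op c.op) x)

/-- The map from the presheaf to the sheaf of log one-forms. -/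
def toForm (V : L.X.Etale) : L.PreForm V →ₗ[ℂ] L.Form V :=
  ((toSheafify L.X.smallEtaleTopology (L.formsPresheaf 1)).app (op V)).hom

lemma resForm_toForm {V W : L.X.Etale} (b : W ⟶ V) (x : L.PreForm V) :
    resForm b (toForm V x) = toForm W (resPreForm b x) :=
  congr($((toSheafify L.X.smallEtaleTopology (L.formsPresheaf 1)).naturality b.op) x).symm

lemma isSheaf_form : Presieve.IsSheaf L.X.smallEtaleTopology
    ((L.forms 1).obj ⋙ forget (ModuleCat ℂ)) :=
  (isSheaf_iff_isSheaf_of_type _ _).1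
    (Presheaf.isSheaf_comp_of_isSheaf _ _ _ (L.forms 1).property)

lemma form_ext {V : L.X.Etale} {m m' : L.Form V}
    (h : LocallyOn V fun _ b => resForm b m = resForm b m') : m = m' := by
  obtain ⟨S, hS, h⟩ := h
  exact eq_of_locally isSheaf_form hS h

lemma exists_toForm_eq {V : L.X.Etale} (x : L.Form V) :
    LocallyOn V fun W b => ∃ y, toForm W y = resForm b x :=
  ⟨_, Presheaf.imageSieve_mem L.X.smallEtaleTopology
    (toSheafify L.X.smallEtaleTopology (L.formsPresheaf 1)) x, fun W b hb => hb⟩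

variable {D : L.X.Opens}

/-- All sections of the log structure are invertible over `D`. -/
def IsTrivialOver (L : LogScheme) (D : L.X.Opens) : Prop :=
  ∀ (V : L.X.Etale) (m : L.Mon V) (v : dom V), proj V v ∈ D → NZ (L.toFn V m) v

variable (h : L.IsTrivialOver D)

namespace FieldPt

/-- The morphism of log rings given by a point. -/
def preLogHom {V : L.X.Etale} (τ : FieldPt GenField D V) : PreLogHom ℂ (L.toFn V) genLog where
  ring := τ.evalAt
  mon :=
    { toFun := fun m => Units.mk0 (τ.evalAt (L.toFn V m)) (τ.evalAt_ne_zero (h V m _ τ.mem))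
      map_one' := Units.ext (by simp)
      map_mul' := fun m n => Units.ext (by simp) }
  comm m := rfl

/-- The value of a log one-form on the derivation `genD`. -/
def evalPreForm {V : L.X.Etale} (τ : FieldPt GenField D V) : L.PreForm V →ₗ[ℂ] GenField :=
  ((genForm ∘ₗ (exteriorPower.oneEquiv GenField (LogDiff ℂ genLog)).toLinearMap).restrictScalars ℂ) ∘ₗ
    LogForms.map (τ.preLogHom h) 1

lemma evalPreForm_smul {V : L.X.Etale} (τ : FieldPt GenField D V) (f : L.Fn V) (x : L.PreForm V) :
    τ.evalPreForm h (f • x) = τ.evalAt f * τ.evalPreForm h x := by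
  change genForm (exteriorPower.oneEquiv GenField (LogDiff ℂ genLog)
    (LogForms.map (τ.preLogHom h) 1 (f • x))) = _
  rw [LogForms.map_smul, map_smul, map_smul]
  rfl

lemma evalPreForm_map {V W : L.X.Etale} (b : W ⟶ V) (τ : FieldPt GenField D W) (x : L.PreForm V) :
    (τ.map b).evalPreForm h x = τ.evalPreForm h (resPreForm b x) := by
  have e : (τ.map b).preLogHom h = (τ.preLogHom h).comp (L.resPre b) := by
    refine PreLogHom.ext (AlgHom.ext fun f => τ.evalAt_map b f) (MonoidHom.ext fun m => Units.ext ?_)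
    exact (τ.evalAt_map b _).trans (congrArg τ.evalAt (L.toFn_res b m).symm)
  change genForm (exteriorPower.oneEquiv GenField (LogDiff ℂ genLog)
    (LogForms.map ((τ.map b).preLogHom h) 1 x)) = _
  rw [e, LogForms.map_comp]
  rfl

lemma evalPreForm_dd {V : L.X.Etale} (τ : FieldPt GenField D V) (f : L.Fn V) :
    τ.evalPreForm h (exteriorPower.ιMulti (L.Fn V) 1 fun _ => dd ℂ (L.toFn V) f) =
      genD (τ.evalAt f) := by
  change genForm (exteriorPower.oneEquiv GenField (LogDiff ℂ genLog)
    (LogForms.map (τ.preLogHom h) 1 _)) = _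
  rw [LogForms.map_ιMulti, exteriorPower.oneEquiv_ιMulti, Function.comp_apply, LogDiff.map_dd,
    genForm_dd]
  rfl

lemma evalPreForm_dlog {V : L.X.Etale} (τ : FieldPt GenField D V) (m : L.Mon V) :
    τ.evalPreForm h (exteriorPower.ιMulti (L.Fn V) 1 fun _ => dlog ℂ (L.toFn V) m) =
      genD (τ.evalAt (L.toFn V m)) * (τ.evalAt (L.toFn V m))⁻¹ := by
  change genForm (exteriorPower.oneEquiv GenField (LogDiff ℂ genLog)
    (LogForms.map (τ.preLogHom h) 1 _)) = _
  rw [LogForms.map_ιMulti, exteriorPower.oneEquiv_ιMulti, Function.comp_apply, LogDiff.map_dlog,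
    genForm_dlog, Units.val_inv_eq_inv_val]
  rfl

end FieldPt

/-- Evaluation of log one-forms as a morphism of presheaves. -/
def evalPreFormHom : L.formsPresheaf 1 ⟶ genPresheaf D where
  app V := ModuleCat.ofHom (LinearMap.pi fun τ : FieldPt GenField D V.unop => τ.evalPreForm h)
  naturality V W b := ModuleCat.hom_ext (LinearMap.ext fun x => funext fun τ =>
    (τ.evalPreForm_map h b.unop x).symm)

/-- The value of a section of the sheaf of log one-forms on `genD`. -/
def evalForm {V : L.X.Etale} (τ : FieldPt GenField D V) : L.Form V →ₗ[ℂ] GenField :=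
  LinearMap.proj τ ∘ₗ ((sheafifyLift L.X.smallEtaleTopology (evalPreFormHom h)
    (isSheaf_genPresheaf D)).app (op V)).hom

/-- The values lie in a sheaf, so evaluation factors through the sheafification and is computed on
the presheaf. -/
lemma evalForm_toForm {V : L.X.Etale} (τ : FieldPt GenField D V) (x : L.PreForm V) :
    evalForm h τ (toForm V x) = τ.evalPreForm h x := by
  have e := toSheafify_sheafifyLift L.X.smallEtaleTopology (evalPreFormHom h) (isSheaf_genPresheaf D)
  exact congrFun congr($(congr_app e (op V)) x) τ

lemma evalForm_map {V W : L.X.Etale} (b : W ⟶ V) (τ : FieldPt GenField D W) (x : L.Form V) :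
    evalForm h (τ.map b) x = evalForm h τ (resForm b x) := by
  have e := (sheafifyLift L.X.smallEtaleTopology (evalPreFormHom h)
    (isSheaf_genPresheaf D)).naturality b.op
  exact (congrFun congr($e x) τ).symm

end LogScheme

/-! ### Global log one-forms on the projective line -/

/-- The logarithmic derivative on `GenField`. -/
def genDlog (x : GenField) : GenField := genD x * x⁻¹

lemma genDlog_add {x y : GenField} (h : x * y = 1) : genDlog x = -genDlog y := by
  have e := congrArg genD h
  rw [Derivation.leibniz, Derivation.map_one_eq_zero, smul_eq_mul, smul_eq_mul] at e
  obtain rfl := eq_inv_of_mul_eq_one_right h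
  rw [genDlog, genDlog, inv_inv]
  linear_combination e

namespace LogScheme

variable {L : LogScheme}

/-- The log one-form given by a log differential. -/
def diffForm {V : L.X.Etale} (x : LogDiff ℂ (L.toFn V)) : L.PreForm V :=
  exteriorPower.ιMulti (L.Fn V) 1 fun _ => x

lemma diffForm_eq {V : L.X.Etale} (x : LogDiff ℂ (L.toFn V)) :
    diffForm x = (exteriorPower.oneEquiv (L.Fn V) _).symm x :=
  ((LinearEquiv.symm_apply_eq _).2 (exteriorPower.oneEquiv_ιMulti _).symm).symm

lemma resPreForm_diffForm {V W : L.X.Etale} (b : W ⟶ V) (x : LogDiff ℂ (L.toFn V)) :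
    resPreForm b (diffForm x) = diffForm (LogDiff.map (L.resPre b) x) :=
  LogForms.map_ιMulti _ _ _

lemma logDiff_map_comp {U V W : L.X.Etale} (b : V ⟶ U) (c : W ⟶ V) (x : LogDiff ℂ (L.toFn U)) :
    LogDiff.map (L.resPre (c ≫ b)) x = LogDiff.map (L.resPre c) (LogDiff.map (L.resPre b) x) := by
  rw [resPre_comp, LogDiff.map_comp]

lemma logDiff_map_smul {V W : L.X.Etale} (b : W ⟶ V) (f : L.Fn V) (x : LogDiff ℂ (L.toFn V)) :
    LogDiff.map (L.resPre b) (f • x) = L.resFn b f • LogDiff.map (L.resPre b) x :=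
  (LogDiff.map (L.resPre b)).map_smulₛₗ f x

lemma dlog_unit {V : L.X.Etale} (u : (L.Mon V)ˣ) :
    dlog ℂ (L.toFn V) u = L.toFn V (u⁻¹ : (L.Mon V)ˣ) • dd ℂ (L.toFn V) (L.toFn V u) := by
  rw [dd_eq, smul_smul, ← map_mul, Units.inv_mul, map_one, one_smul]

namespace LineData

variable (l : LineData L)

lemma exists_charts_of_mem_torus (V : L.X.Etale) (v : dom V) (hv : proj V v ∈ l.torus) :
    ∃ (W : L.X.Etale) (b : W ⟶ V) (_ : ∀ i, W ⟶ l.U i), v ∈ Set.range (left b) := by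
  have := l.isOpenImmersion
  let O : (dom V).Opens := proj V ⁻¹ᵁ l.torus
  have hO (w : dom (sub V O)) : proj (sub V O) w ∈ l.torus := by
    rw [← left_proj (subι V O)]
    exact (Set.ext_iff.1 (range_subι V O) (left (subι V O) w)).1 ⟨w, rfl⟩
  exact ⟨_, subι V O, fun i => (l.exists_hom i fun w => ((l.mem_torus i).1 (hO w)).1).some,
    (Set.ext_iff.1 (range_subι V O) v).2 hv⟩

lemma exists_genPt_chart (V : L.X.Etale) (τ : FieldPt GenField l.torus V) :
    ∃ (W : L.X.Etale) (b : W ⟶ V) (σ : FieldPt GenField l.torus W) (_ : ∀ i, W ⟶ l.U i), σ.map b = τ := by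
  obtain ⟨W, b, a, w, hw⟩ := l.exists_charts_of_mem_torus V _ τ.mem
  obtain ⟨σ, hσ⟩ := τ.exists_map_eq _ w hw
  exact ⟨W, b, σ, a, hσ⟩

/-- The lift of a point to the chart `U 0`. -/
def liftPt (g : Spec (.of GenField) ⟶ L.X) (hg : g default ∈ Set.range (proj (l.U 0))) :
    Spec (.of GenField) ⟶ dom (l.U 0) :=
  have := l.isOpenImmersion 0
  IsOpenImmersion.lift (proj (l.U 0)) g (by
    rintro _ ⟨x, rfl⟩
    rw [Subsingleton.elim x default]
    exact hg)

lemma liftPt_eq {g : Spec (.of GenField) ⟶ L.X} (hg : g default ∈ Set.range (proj (l.U 0)))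
    {k : Spec (.of GenField) ⟶ dom (l.U 0)} (hk : k ≫ proj (l.U 0) = g) : l.liftPt g hg = k := by
  have := l.isOpenImmersion 0
  rw [← cancel_mono (proj (l.U 0)), hk]
  exact IsOpenImmersion.lift_fac _ _ _

/-- The logarithmic derivative of the coordinate `c 0` at a point. -/
def dlogCoord {V : L.X.Etale} (τ : FieldPt GenField l.torus V) : GenField :=
  genDlog (ev (l.liftPt (τ.pt ≫ proj V) τ.mem.1) (l.c 0))

lemma dlogCoord_congr {V W : L.X.Etale} (τ : FieldPt GenField l.torus V) (σ : FieldPt GenField l.torus W)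
    (h : τ.pt ≫ proj V = σ.pt ≫ proj W) : l.dlogCoord τ = l.dlogCoord σ := by
  have e : l.liftPt (τ.pt ≫ proj V) τ.mem.1 = l.liftPt (σ.pt ≫ proj W) σ.mem.1 := by
    have := l.isOpenImmersion 0
    refine l.liftPt_eq _ ((IsOpenImmersion.lift_fac _ _ _).trans h.symm)
  rw [dlogCoord, dlogCoord, e]

lemma dlogCoord_map {V W : L.X.Etale} (b : W ⟶ V) (τ : FieldPt GenField l.torus W) :
    l.dlogCoord (τ.map b) = l.dlogCoord τ :=
  l.dlogCoord_congr _ _ ((Category.assoc _ _ _).trans (congrArg (τ.pt ≫ ·) (left_proj b)))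

/-- The sign relating the logarithmic derivatives of the two coordinates. -/
def sgn (i : Fin (1 + 1)) : ℂ := if i = 0 then 1 else -1

lemma sgn_mul_self (i : Fin (1 + 1)) : sgn i * sgn i = 1 := by
  unfold sgn; split <;> simp

lemma dlogCoord_eq_zero {V : L.X.Etale} (τ : FieldPt GenField l.torus V) (a : V ⟶ l.U 0) :
    l.dlogCoord τ = genDlog (τ.evalAt (L.resFn a (l.c 0))) := by
  rw [← FieldPt.evalAt_map]
  have e := l.liftPt_eq (g := τ.pt ≫ proj V) τ.mem.1 (k := (τ.map a).pt)
    ((Category.assoc _ _ _).trans (congrArg (τ.pt ≫ ·) (left_proj a)))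
  rw [dlogCoord, e]
  rfl

/-- After lifting the point to the overlap both coordinates are defined and inverse to each other,
so their logarithmic derivatives are opposite. -/
lemma dlogCoord_eq {V : L.X.Etale} (τ : FieldPt GenField l.torus V) {i : Fin (1 + 1)} (a : V ⟶ l.U i) :
    l.dlogCoord τ = sgn i • genDlog (τ.evalAt (L.resFn a (l.c i))) := by
  obtain ⟨W, b, σ, a', rfl⟩ := l.exists_genPt_chart V τ
  rw [dlogCoord_map, FieldPt.evalAt_map, ← resFn_comp, l.dlogCoord_eq_zero _ (a' 0)]
  fin_cases i
  · rw [l.hom_unique (a' 0) (b ≫ a)]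
    simp [sgn]
  · have h := congrArg σ.evalAt (l.mul (a' 0) (b ≫ a))
    rw [map_mul, map_one] at h
    rw [genDlog_add h]
    simp [sgn]

lemma evalAt_coord_ne_zero {V : L.X.Etale} (τ : FieldPt GenField l.torus V) {i : Fin (1 + 1)} (a : V ⟶ l.U i) :
    τ.evalAt (L.resFn a (l.c i)) ≠ 0 := by
  obtain ⟨W, b, σ, a', rfl⟩ := l.exists_genPt_chart V τ
  have h := congrArg σ.evalAt (l.mul (b ≫ a) (a' i.rev))
  rw [map_mul, map_one] at h
  rw [FieldPt.evalAt_map, ← resFn_comp]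
  exact left_ne_zero_of_mul_eq_one h

/-- On a chart, multiplication by the coordinate and the sign turns `dlogCoord` into the derivative
of the coordinate, which reduces the claim to `eq_zero_of_evalAt`. -/
lemma eq_of_evalAt_mul_dlogCoord {V : L.X.Etale} {f g : L.Fn V}
    (h : ∀ τ : FieldPt GenField l.torus V, τ.evalAt f * l.dlogCoord τ = τ.evalAt g * l.dlogCoord τ) :
    f = g := by
  refine l.fn_ext_charts fun i W b a => sub_eq_zero.1 (l.eq_zero_of_evalAt a fun τ => ?_)
  have h1 := h (τ.map b)
  rw [FieldPt.evalAt_map, FieldPt.evalAt_map, dlogCoord_map, l.dlogCoord_eq τ a] at h1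
  have h2 : sgn i • genDlog (τ.evalAt (L.resFn a (l.c i))) * τ.evalAt (L.resFn a (l.c i)) =
      sgn i • genD (τ.evalAt (L.resFn a (l.c i))) := by
    rw [smul_mul_assoc, genDlog, inv_mul_cancel_right₀ (l.evalAt_coord_ne_zero τ a)]
  have h3 := congrArg (fun x => sgn i • (x * τ.evalAt (L.resFn a (l.c i)))) h1
  simp only [mul_assoc] at h3
  rw [h2, mul_smul_comm, mul_smul_comm, smul_smul, smul_smul, sgn_mul_self, one_smul, one_smul] at h3
  rw [map_sub, sub_mul, h3, sub_self]

lemma nonempty_chart (i : Fin (1 + 1)) : Nonempty (dom (l.U i)) := by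
  have := l.isIso_toA1 i
  exact ⟨inv (toA1 (l.c i)) (⊥ : PrimeSpectrum ℂ[X])⟩

lemma exists_not_nz (i : Fin (1 + 1)) : ∃ v : dom (l.U i), ¬ NZ (l.c i) v := by
  have := l.isIso_toA1 i
  have hp : (Ideal.span {(Polynomial.X : ℂ[X])}).IsPrime :=
    (Ideal.span_singleton_prime Polynomial.X_ne_zero).2 Polynomial.prime_X
  refine ⟨inv (toA1 (l.c i)) (⟨_, hp⟩ : PrimeSpectrum ℂ[X]), fun h => ?_⟩
  have hX : (pullElem (toA1 (l.c i)) Polynomial.X : L.Fn (l.U i)) = l.c i := by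
    rw [pullElem_toA1, aeval_X]
  rw [nz_iff_of_pullElem (R := .of ℂ[X]) (toA1 (l.c i)) Polynomial.X hX] at h
  have e : toA1 (l.c i) (inv (toA1 (l.c i)) (⟨_, hp⟩ : PrimeSpectrum ℂ[X])) =
    (⟨_, hp⟩ : PrimeSpectrum ℂ[X]) := congr($(IsIso.inv_hom_id (toA1 (l.c i))) _)
  rw [e] at h
  exact h (Ideal.mem_span_singleton_self _)

lemma exists_dlogCoord_ne_zero : ∃ τ : FieldPt GenField l.torus (top L.X), l.dlogCoord τ ≠ 0 := by
  obtain ⟨v⟩ := l.nonempty_chart 0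
  obtain ⟨τ, hτ⟩ := l.exists_genPt (𝟙 (l.U 0)) v
  refine ⟨τ.map ((isTerminalTop L.X).from _), ?_⟩
  rw [l.dlogCoord_map, l.dlogCoord_eq τ (𝟙 (l.U 0)), hτ, genDlog, genD_genT, one_mul]
  simp [sgn, genT_ne_zero]

end LineData

/-- Local generators of the log differentials. -/
structure Frame (l : LineData L) (h : L.IsTrivialOver l.torus) where
  e : ∀ i, LogDiff ℂ (L.toFn (l.U i))
  -- This factor is 1 for the generator dlog t and the coordinate itself for the generator dc. It is
  -- where the two log structures differ.
  κ : ∀ i, L.Fn (l.U i)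
  exists_dd_eq : ∀ i, ∃ f : L.Fn (l.U i), dd ℂ (L.toFn (l.U i)) (l.c i) = f • e i
  exists_dlog_eq : ∀ {i : Fin (1 + 1)} {V : L.X.Etale} (a : V ⟶ l.U i) (m : L.Mon V),
    LocallyOn V fun W b => ∃ (k : ℕ) (u : (L.Mon W)ˣ), dlog ℂ (L.toFn W) (L.res b m) =
      k • LogDiff.map (L.resPre (b ≫ a)) (e i) + dlog ℂ (L.toFn W) u
  evalPreForm : ∀ {i : Fin (1 + 1)} (τ : FieldPt GenField l.torus (l.U i)),
    τ.evalPreForm h (diffForm (e i)) = τ.evalAt (κ i) * genDlog (τ.evalAt (l.c i))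
  evalAt_ne_zero : ∀ {i : Fin (1 + 1)} (τ : FieldPt GenField l.torus (l.U i)), τ.evalAt (κ i) ≠ 0

namespace Frame

variable {l : LineData L} {h : L.IsTrivialOver l.torus} (F : Frame l h)

include F

lemma exists_dd_eq_smul {i : Fin (1 + 1)} {V : L.X.Etale} (a : V ⟶ l.U i) [IsAffine (dom V)]
    (x : L.Fn V) : ∃ f : L.Fn V, dd ℂ (L.toFn V) x = f • LogDiff.map (L.resPre a) (F.e i) := by
  obtain ⟨f, hf⟩ := ((l.isEtaleCoord i).resFn a).exists_dd_eq x
  obtain ⟨g, hg⟩ := F.exists_dd_eq i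
  have hg' := congrArg (LogDiff.map (L.resPre a)) hg
  rw [LogDiff.map_dd, logDiff_map_smul] at hg'
  refine ⟨f * L.resFn a g, ?_⟩
  rw [hf, mul_smul, ← hg']
  rfl

/-- Log differentials are spanned by exact ones and by dlog m. The first are multiples of dc; the
second are an integer multiple of the generator plus dlog u for a unit u, and dlog u = u⁻¹ du. -/
lemma exists_eq_smul {i : Fin (1 + 1)} {V : L.X.Etale} (a : V ⟶ l.U i) (x : LogDiff ℂ (L.toFn V)) :
    LocallyOn V fun W b => ∃ f : L.Fn W, LogDiff.map (L.resPre b) x =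
      f • LogDiff.map (L.resPre (b ≫ a)) (F.e i) := by
  have hres {x : LogDiff ℂ (L.toFn V)} {W W' : L.X.Etale} (b : W ⟶ V) (c : W' ⟶ W)
      (h : ∃ f : L.Fn W, LogDiff.map (L.resPre b) x = f • LogDiff.map (L.resPre (b ≫ a)) (F.e i)) :
      ∃ f : L.Fn W', LogDiff.map (L.resPre (c ≫ b)) x =
        f • LogDiff.map (L.resPre ((c ≫ b) ≫ a)) (F.e i) := by
    obtain ⟨f, hf⟩ := h
    refine ⟨L.resFn c f, ?_⟩
    rw [logDiff_map_comp, hf, logDiff_map_smul, ← logDiff_map_comp, Category.assoc]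
  have hx : x ∈ Submodule.span (L.Fn V) (Set.range (dd ℂ (L.toFn V)) ∪
      Set.range (dlog ℂ (L.toFn V))) := by
    rw [span_gen]; trivial
  induction hx using Submodule.span_induction with
  | mem x hx =>
    rcases hx with ⟨f, rfl⟩ | ⟨m, rfl⟩
    · refine locallyOn_affine V (fun W W' b c h => hres b c h) fun W b hW => ?_
      rw [LogDiff.map_dd]
      exact F.exists_dd_eq_smul (b ≫ a) _
    · refine LocallyOn.bind ((F.exists_dlog_eq a m).mono ?_)
      rintro W b ⟨k, u, hu⟩
      refine locallyOn_affine W (fun W' W'' b' c h => ?_) fun W' c hW' => ?_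
      · rw [Category.assoc]
        exact hres _ _ h
      · obtain ⟨f, hf⟩ := F.exists_dd_eq_smul (c ≫ b ≫ a) (L.toFn W' (Units.map (L.res c) u))
        have h2 : LogDiff.map (L.resPre b) (dlog ℂ (L.toFn V) m) =
            dlog ℂ (L.toFn W) (L.res b m) := LogDiff.map_dlog _ _
        have h3 : LogDiff.map (L.resPre c) (dlog ℂ (L.toFn W) u) =
            dlog ℂ (L.toFn W') (Units.map (L.res c) u) := LogDiff.map_dlog _ _
        rw [logDiff_map_comp, h2, hu, map_add, map_nsmul, h3, dlog_unit, hf, ← logDiff_map_comp,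
          smul_smul, ← Nat.cast_smul_eq_nsmul (L.Fn W'), ← add_smul, Category.assoc]
        exact ⟨_, rfl⟩
  | zero => exact LocallyOn.of_forall fun W b => ⟨0, by rw [map_zero, zero_smul]⟩
  | add x y _ _ hx hy =>
    refine (hx.and hy).mono ?_
    rintro W b ⟨⟨f, hf⟩, ⟨g, hg⟩⟩
    exact ⟨f + g, by rw [map_add, hf, hg, add_smul]⟩
  | smul r x _ hx =>
    refine hx.mono ?_
    rintro W b ⟨f, hf⟩
    exact ⟨L.resFn b r * f, by rw [logDiff_map_smul, hf, mul_smul]⟩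

lemma exists_preForm_eq {i : Fin (1 + 1)} {V : L.X.Etale} (a : V ⟶ l.U i) (x : L.PreForm V) :
    LocallyOn V fun W b => ∃ f : L.Fn W, resPreForm b x =
      f • resPreForm (b ≫ a) (diffForm (F.e i)) := by
  obtain ⟨x, rfl⟩ := (exteriorPower.oneEquiv (L.Fn V) _).symm.surjective x
  refine (F.exists_eq_smul a x).mono ?_
  rintro W b ⟨f, hf⟩
  refine ⟨f, ?_⟩
  rw [← diffForm_eq, resPreForm_diffForm, resPreForm_diffForm, hf, diffForm_eq, diffForm_eq, map_smul]

lemma evalPreForm_smul_frame {i : Fin (1 + 1)} {V : L.X.Etale} (a : V ⟶ l.U i) (f : L.Fn V)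
    (τ : FieldPt GenField l.torus V) : τ.evalPreForm h (f • resPreForm a (diffForm (F.e i))) =
      τ.evalAt (LineData.sgn i • (f * L.resFn a (F.κ i))) * l.dlogCoord τ := by
  rw [FieldPt.evalPreForm_smul, ← FieldPt.evalPreForm_map, F.evalPreForm, FieldPt.evalAt_map,
    FieldPt.evalAt_map, l.dlogCoord_eq τ a, map_smul, map_mul, smul_mul_smul_comm,
    LineData.sgn_mul_self, one_smul, mul_assoc]

lemma exists_evalForm_eq {i : Fin (1 + 1)} {V : L.X.Etale} (a : V ⟶ l.U i) (x : L.Form V) :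
    LocallyOn V fun W b => ∃ f : L.Fn W,
      resForm b x = toForm W (f • resPreForm (b ≫ a) (diffForm (F.e i))) := by
  refine LocallyOn.bind ((exists_toForm_eq x).mono ?_)
  rintro W b ⟨y, hy⟩
  refine (F.exists_preForm_eq (b ≫ a) y).mono ?_
  rintro W' c ⟨f, hf⟩
  refine ⟨f, ?_⟩
  rw [resForm_comp, ← hy, resForm_toForm, hf, Category.assoc]

/-- Locally the difference is `f` times the generator and has value zero everywhere, so f · κ
vanishes. As `κ` has non-zero value at every point used, `f` vanishes too. -/
lemma eq_of_evalForm {V : L.X.Etale} {x y : L.Form V}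
    (hxy : ∀ τ : FieldPt GenField l.torus V, evalForm h τ x = evalForm h τ y) : x = y := by
  refine sub_eq_zero.1 (form_ext (.of_cover (fun W W' b c e => ?_) fun v => ?_))
  · rw [resForm_comp, resForm_comp, e]
  · obtain ⟨i, W, b, a, w, rfl⟩ := l.exists_chart V v
    obtain ⟨W', c, ⟨w', rfl⟩, f, hf⟩ := (F.exists_evalForm_eq a (resForm b (x - y))).exists_mem w
    refine ⟨W', c ≫ b, ⟨w', rfl⟩, ?_⟩
    have h1 : LineData.sgn i • (f * L.resFn (c ≫ a) (F.κ i)) = 0 := by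
      refine l.eq_of_evalAt_mul_dlogCoord fun τ => ?_
      rw [← F.evalPreForm_smul_frame, ← evalForm_toForm, ← hf, ← evalForm_map, ← evalForm_map,
        map_sub, hxy, sub_self, map_zero, zero_mul]
    have h2 : f = 0 := by
      refine l.eq_of_evalAt_mul_dlogCoord fun τ => ?_
      have h3 := congrArg τ.evalAt h1
      rw [map_zero, map_smul, map_mul, ← FieldPt.evalAt_map] at h3
      have h4 := (smul_eq_zero.1 h3).resolve_left fun h0 => by
        have := LineData.sgn_mul_self i
        rw [h0, zero_mul] at this
        exact zero_ne_one this
      rw [(mul_eq_zero.1 h4).resolve_right (F.evalAt_ne_zero _), map_zero]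
    rw [resForm_comp, hf, h2, zero_smul, map_zero, map_zero]

/-- The value of a global one-form on `genD` is a multiple of the logarithmic derivative of the
coordinate. -/
lemma exists_evalForm_eq_smul (x : L.Form (top L.X)) :
    ∃ z : ℂ, ∀ τ : FieldPt GenField l.torus (top L.X), evalForm h τ x = z • l.dlogCoord τ := by
  -- The local coefficients relative to `dlogCoord` are determined by the values of the form. They
  -- glue to a global function, which is constant.
  obtain ⟨m, hm⟩ := fn_glue (V := top L.X) (fun W b f => ∀ τ : FieldPt GenField l.torus W,
      evalForm h τ (resForm b x) = τ.evalAt f * l.dlogCoord τ)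
    (fun W W' b c f hf τ => by
      rw [resForm_comp, ← evalForm_map, hf, FieldPt.evalAt_map, l.dlogCoord_map])
    (fun W b f g hf hg => l.eq_of_evalAt_mul_dlogCoord fun τ => by rw [← hf, ← hg])
    (.of_cover (fun W W' b c ⟨f, hf⟩ => ⟨L.resFn c f, fun τ => by
      rw [resForm_comp, ← evalForm_map, hf, FieldPt.evalAt_map, l.dlogCoord_map]⟩) fun v => by
      obtain ⟨i, W, b, a, w, rfl⟩ := l.exists_chart (top L.X) v
      obtain ⟨W', c, ⟨w', rfl⟩, f, hf⟩ := (F.exists_evalForm_eq a (resForm b x)).exists_mem w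
      refine ⟨W', c ≫ b, ⟨w', rfl⟩, LineData.sgn i • (f * L.resFn (c ≫ a) (F.κ i)), fun τ => ?_⟩
      rw [resForm_comp, hf, evalForm_toForm, F.evalPreForm_smul_frame])
  obtain ⟨z, rfl⟩ := l.exists_eq_algebraMap m l.nonempty_chart
  refine ⟨z, fun τ => ?_⟩
  obtain ⟨W, b, σ, hb, rfl⟩ := τ.exists_mem hm
  rw [evalForm_map, hb, AlgHom.commutes, AlgHom.commutes, l.dlogCoord_map, Algebra.smul_def]

/-- The local generators, with the signs `sgn i`, all have value `dlogCoord` and glue to the global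
form dt/t. Every other global form is a constant multiple of it. -/
lemma finrank_eq_one (hκ : ∀ i, F.κ i = 1) : L.hodge 1 0 = 1 := by
  rw [hodge, (hZeroEquiv L (L.forms 1)).finrank_eq]
  obtain ⟨x, hx⟩ : ∃ x : L.Form (top L.X), ∀ τ : FieldPt GenField l.torus (top L.X),
      evalForm h τ x = l.dlogCoord τ := by
    obtain ⟨S, hS, hex⟩ : LocallyOn (top L.X) fun W b => ∃ y : L.Form W, ∀ τ : FieldPt GenField l.torus W,
        evalForm h τ y = l.dlogCoord τ := by
      refine .of_cover (fun W W' b c ⟨y, hy⟩ => ⟨resForm c y, fun τ => ?_⟩) fun v => ?_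
      · rw [← evalForm_map, hy, l.dlogCoord_map]
      · obtain ⟨i, W, b, a, hv⟩ := l.exists_chart (top L.X) v
        refine ⟨W, b, hv, toForm W ((LineData.sgn i • (1 : L.Fn W)) •
          resPreForm a (diffForm (F.e i))), fun τ => ?_⟩
        rw [evalForm_toForm, F.evalPreForm_smul_frame, hκ, map_one, mul_one, smul_smul,
          LineData.sgn_mul_self, one_smul, map_one, one_mul]
    obtain ⟨x, hx⟩ := exists_of_locally (V := top L.X) isSheaf_form
      (fun W b (y : L.Form W) => ∀ τ : FieldPt GenField l.torus W, evalForm h τ y = l.dlogCoord τ)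
      (fun W W' b c y hy τ => by
        refine (evalForm_map h c τ y).symm.trans ?_
        rw [hy, l.dlogCoord_map])
      (fun W b y y' hy hy' => F.eq_of_evalForm fun τ => by rw [hy, hy']) hS hex
    refine ⟨x, fun τ => ?_⟩
    obtain ⟨W, b, σ, hb, rfl⟩ := τ.exists_mem ⟨S, hS, hx⟩
    rw [evalForm_map, l.dlogCoord_map]
    exact hb σ
  refine _root_.finrank_eq_one x (fun h0 => ?_) fun y => ?_
  · obtain ⟨τ, hτ⟩ := l.exists_dlogCoord_ne_zero
    exact hτ (by rw [← hx, h0, map_zero])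
  · obtain ⟨z, hz⟩ := F.exists_evalForm_eq_smul y
    exact ⟨z, F.eq_of_evalForm fun τ => by rw [hz, map_smul, hx]⟩

/-- A global form with value z · dlog c is locally f dc near the origin of a chart, which forces z =
± f c. If z were non-zero, the coordinate would be invertible at the origin. -/
lemma finrank_eq_zero (hκ : ∀ i, F.κ i = l.c i) : L.hodge 1 0 = 0 := by
  rw [hodge, (hZeroEquiv L (L.forms 1)).finrank_eq]
  have hx (x : L.Form (top L.X)) : x = 0 := by
    obtain ⟨z, hz⟩ := F.exists_evalForm_eq_smul x
    suffices z = 0 from F.eq_of_evalForm fun τ => by rw [hz, this, zero_smul, map_zero]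
    obtain ⟨v, hv⟩ := l.exists_not_nz 0
    let t : l.U 0 ⟶ top L.X := (isTerminalTop L.X).from _
    obtain ⟨W, b, ⟨w, rfl⟩, f, hf⟩ := (F.exists_evalForm_eq (𝟙 (l.U 0)) (resForm t x)).exists_mem v
    rw [Category.comp_id] at hf
    have e : LineData.sgn 0 • (f * L.resFn b (F.κ 0)) = algebraMap ℂ (L.Fn W) z := by
      refine l.eq_of_evalAt_mul_dlogCoord fun τ => ?_
      rw [← F.evalPreForm_smul_frame, ← evalForm_toForm, ← hf, ← evalForm_map, ← evalForm_map, hz,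
        l.dlogCoord_map, l.dlogCoord_map, AlgHom.commutes, Algebra.smul_def]
    by_contra hz0
    have hu : IsUnit (algebraMap ℂ (L.Fn W) z) := (IsUnit.mk0 z hz0).map _
    rw [← e, hκ, Algebra.smul_def, ← mul_assoc] at hu
    exact hv ((nz_resFn b _ w).1 ((isUnit_iff_nz _).1 (isUnit_of_mul_isUnit_right hu) w))
  have : Subsingleton (L.Form (top L.X)) := ⟨fun x y => by rw [hx x, hx y]⟩
  exact Module.finrank_zero_of_subsingleton

end Frame

/-- The frame `dlog t` of a log structure given by a coordinate. -/
def LogLineData.frame (l : LogLineData L) (h : L.IsTrivialOver l.torus) : Frame l.toLineData h where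
  e i := dlog ℂ (L.toFn (l.U i)) (l.t i)
  κ i := 1
  exists_dd_eq i := ⟨l.c i, by rw [← l.toFn_t, dd_eq]⟩
  exists_dlog_eq {i V} a m := .of_cover (by
      rintro W W' b c ⟨k, u, hu⟩
      have h1 := congrArg (LogDiff.map (L.resPre c)) hu
      rw [LogDiff.map_dlog, map_add, map_nsmul, ← logDiff_map_comp] at h1
      refine ⟨k, Units.map (L.res c) u, ?_⟩
      rw [res_comp, Category.assoc]
      exact h1.trans (congrArg (k • LogDiff.map (L.resPre (c ≫ b ≫ a)) (dlog ℂ (L.toFn (l.U i)) (l.t i)) + ·)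
        (LogDiff.map_dlog _ _))) fun v => by
    obtain ⟨W, b, hv, k, u, hu⟩ := l.exists_eq a m v
    refine ⟨W, b, hv, k, u, ?_⟩
    have h1 (n : ℕ) (t : L.Mon W) : dlog ℂ (L.toFn W) (t ^ n) = n • dlog ℂ (L.toFn W) t := by
      induction n with
      | zero =>
        have := dlog_mul ℂ (L.toFn W) 1 1
        rw [mul_one] at this
        rw [pow_zero, zero_smul, left_eq_add.1 this]
      | succ n ih => rw [pow_succ, dlog_mul, ih, succ_nsmul]
    rw [hu, dlog_mul, h1, LogDiff.map_dlog]
    rfl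
  evalPreForm {i} τ := by
    rw [diffForm, FieldPt.evalPreForm_dlog, l.toFn_t, map_one, one_mul, genDlog]
  evalAt_ne_zero τ := by rw [map_one]; exact one_ne_zero

/-- The frame `dc` of a trivial log structure. -/
def LineData.frame (l : LineData L) (hL : L.IsTrivial) (h : L.IsTrivialOver l.torus) :
    Frame l h where
  e i := dd ℂ (L.toFn (l.U i)) (l.c i)
  κ i := l.c i
  exists_dd_eq i := ⟨1, by rw [one_smul]⟩
  exists_dlog_eq {i V} a m := .of_forall fun W b => ⟨0, (hL W (L.res b m)).unit, by
    rw [zero_smul, zero_add, IsUnit.unit_spec]⟩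
  evalPreForm {i} τ := by
    have h1 := l.evalAt_coord_ne_zero τ (𝟙 _)
    rw [resFn_id] at h1
    rw [diffForm, FieldPt.evalPreForm_dd, genDlog]
    field_simp
  evalAt_ne_zero {i} τ := by
    have h1 := l.evalAt_coord_ne_zero τ (𝟙 _)
    rwa [resFn_id] at h1

/-- On the overlap the coordinates are inverse to each other, so they vanish nowhere. -/
lemma LogLineData.isTrivialOver (l : LogLineData L) : L.IsTrivialOver l.torus := by
  intro V m v hv
  obtain ⟨W, b, a, w, rfl⟩ := l.exists_charts_of_mem_torus V v hv
  have h1 := l.nz_toFn (L.res b m) (a 0) w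
    ((isUnit_iff_nz _).1 (IsUnit.of_mul_eq_one _ (l.mul (a 0) (a (Fin.rev 0)))) w)
  rwa [toFn_res, nz_resFn] at h1

lemma LogLineData.hodge_eq_one (l : LogLineData L) : L.hodge 1 0 = 1 :=
  (l.frame l.isTrivialOver).finrank_eq_one fun i => rfl

lemma LineData.hodge_eq_zero (l : LineData L) (hL : L.IsTrivial) : L.hodge 1 0 = 0 :=
  (l.frame hL fun V m v _ => (isUnit_iff_nz _).1 ((hL V m).map (L.toFn V)) v).finrank_eq_zero
    fun i => rfl

end LogScheme

/-! ### Morphisms to the projective line given by a section -/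

namespace LogScheme

variable {L Y : LogScheme}

/-- Compatible morphisms to two étale schemes factor over their product. -/
lemma exists_common_lift {X : Scheme.{0}} {V W W' : X.Etale} (b : W ⟶ V) (b' : W' ⟶ V)
    {T : Scheme.{0}} (h : T ⟶ dom W) (h' : T ⟶ dom W') (e : h ≫ left b = h' ≫ left b') :
    ∃ (Z : X.Etale) (g : Z ⟶ W) (g' : Z ⟶ W') (r : T ⟶ dom Z), g ≫ b = g' ≫ b' ∧
      r ≫ left g = h ∧ r ≫ left g' = h' := by
  have e0 : pullback.fst (left b) (left b') ≫ proj W = pullback.snd (left b) (left b') ≫ proj W' := by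
    rw [← left_proj b', ← pullback.condition_assoc, left_proj]
  let Z : X.Etale := Scheme.Etale.mk (pullback.fst (left b) (left b') ≫ proj W)
  let g : Z ⟶ W := homOfLeft (V := Z) (pullback.fst (left b) (left b')) rfl
  let g' : Z ⟶ W' := homOfLeft (V := Z) (pullback.snd (left b) (left b')) e0.symm
  exact ⟨Z, g, g', pullback.lift h h' e, etaleHom_ext pullback.condition, pullback.lift_fst _ _ _,
    pullback.lift_snd _ _ _⟩

lemma exists_lift_at {U Z : L.X.Etale} {W : Y.X.Etale} (g : dom W ⟶ dom U) (a : Z ⟶ U) {w : dom W}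
    {z : dom Z} (h : left a z = g w) : ∃ (W' : Y.X.Etale) (b : W' ⟶ W) (r : dom W' ⟶ dom Z),
      w ∈ Set.range (left b) ∧ r ≫ left a = left b ≫ g := by
  let W' : Y.X.Etale := Scheme.Etale.mk (pullback.fst g (left a) ≫ proj W)
  let b : W' ⟶ W := homOfLeft (V := W') (pullback.fst g (left a)) rfl
  obtain ⟨x, hx, -⟩ := Scheme.Pullback.exists_preimage_pullback (f := g) (g := left a) w z h.symm
  exact ⟨W', b, pullback.snd g (left a), ⟨x, hx⟩, pullback.condition.symm⟩

lemma LineData.exists_hom_of_mem (l : LineData L) {i : Fin (1 + 1)} (V : L.X.Etale) (v : dom V)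
    (hv : proj V v ∈ Set.range (proj (l.U i))) :
    ∃ (W : L.X.Etale) (b : W ⟶ V) (_ : W ⟶ l.U i), v ∈ Set.range (left b) := by
  have := l.isOpenImmersion i
  let O : (dom V).Opens := proj V ⁻¹ᵁ (proj (l.U i)).opensRange
  obtain ⟨a⟩ := l.exists_hom (W := sub V O) i fun w => by
    rw [← left_proj (subι V O)]
    exact (Set.ext_iff.1 (range_subι V O) (left (subι V O) w)).1 ⟨w, rfl⟩
  exact ⟨sub V O, subι V O, a, (Set.ext_iff.1 (range_subι V O) v).2 hv⟩

lemma fnPull_fnPull {X : LogScheme} {U : L.X.Etale} {V : Y.X.Etale} {W : X.X.Etale}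
    (g : dom V ⟶ dom U) (h : dom W ⟶ dom V) (x : L.Fn U) :
    (fnPull h (fnPull g x : Y.Fn V) : X.Fn W) = fnPull (h ≫ g) x :=
  congr($((Scheme.Hom.comp_appTop h g).symm) x)

lemma ofUnit_unique {V : Y.X.Etale} {m : Y.Mon V} {x : (Y.Fn V)ˣ} (h : Y.toFn V m = x) :
    Y.ofUnit V x = m :=
  toFn_inj (by rw [toFn_ofUnit]; exact x.isUnit) (by rw [toFn_ofUnit, h])

lemma isUnit_ofUnit {V : Y.X.Etale} (x : (Y.Fn V)ˣ) : IsUnit (Y.ofUnit V x) :=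
  isUnit_toFn.1 (by rw [toFn_ofUnit]; exact x.isUnit)

/-- The pullback of units of `M` along a morphism of étale schemes over different bases. -/
def unitPull {U : L.X.Etale} {V : Y.X.Etale} (g : dom V ⟶ dom U) : (L.Mon U)ˣ →* Y.Mon V :=
  (Y.ofUnit V).comp (Units.map (((fnPull g : L.Fn U →+* Y.Fn V) : L.Fn U →* Y.Fn V).comp (L.toFn U)))

lemma toFn_unitPull {U : L.X.Etale} {V : Y.X.Etale} (g : dom V ⟶ dom U) (u : (L.Mon U)ˣ) :
    Y.toFn V (unitPull g u) = fnPull g (L.toFn U u) := toFn_ofUnit _ _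

lemma isUnit_unitPull {U : L.X.Etale} {V : Y.X.Etale} (g : dom V ⟶ dom U) (u : (L.Mon U)ˣ) :
    IsUnit (unitPull g u : Y.Mon V) := isUnit_ofUnit _

lemma unitPull_eq {U : L.X.Etale} {V : Y.X.Etale} {g : dom V ⟶ dom U} {u : (L.Mon U)ˣ} {m : Y.Mon V}
    (h : Y.toFn V m = fnPull g (L.toFn U u)) : unitPull g u = m := ofUnit_unique h

lemma Hom.pull_unit (f : Y.Hom L) {U : L.X.Etale} {V : Y.X.Etale} (g : dom V ⟶ dom U)
    (hg : g ≫ proj U = proj V ≫ f.f) (u : (L.Mon U)ˣ) : f.pull g hg u = unitPull g u :=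
  (unitPull_eq (f.toFn_pull' g hg u)).symm

lemma res_unitPull {U : L.X.Etale} {V W : Y.X.Etale} (g : dom V ⟶ dom U) (b : W ⟶ V)
    (u : (L.Mon U)ˣ) : Y.res b (unitPull g u) = unitPull (left b ≫ g) u := by
  refine (unitPull_eq ?_).symm
  rw [toFn_res, toFn_unitPull, resFn_fnPull]

lemma unitPull_res {U U' : L.X.Etale} {V : Y.X.Etale} (g : dom V ⟶ dom U') (a : U' ⟶ U)
    (u : (L.Mon U)ˣ) : (unitPull g (Units.map (L.res a) u) : Y.Mon V) = unitPull (g ≫ left a) u := by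
  refine unitPull_eq ?_
  rw [toFn_unitPull, ← fnPull_resFn, ← toFn_res]
  rfl

namespace LineData

variable (l : LineData L)

lemma toA1_fnPull {U : L.X.Etale} {W : Y.X.Etale} (h : dom W ⟶ dom U)
    (hh : h ≫ proj U ≫ L.str = proj W ≫ Y.str) (c : L.Fn U) :
    toA1 (fnPull h c : Y.Fn W) = h ≫ toA1 c := by
  refine toA1_eq_of_pullElem _ ?_ ?_
  · rw [Category.assoc, toA1_comp, hh]
  · have h1 : (pullElem (toA1 c) Polynomial.X : L.Fn U) = c := by rw [pullElem_toA1, aeval_X]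
    change (h ≫ toA1 c).appTop.hom _ = fnPull h c
    rw [Scheme.Hom.comp_appTop]
    exact congrArg h.appTop.hom h1

/-- The morphism to the chart `U i` with coordinate `x`. -/
def coordMap (i : Fin (1 + 1)) {W : Y.X.Etale} (x : Y.Fn W) : dom W ⟶ dom (l.U i) :=
  have := l.isIso_toA1 i
  toA1 x ≫ inv (toA1 (l.c i))

lemma coordMap_toA1 (i : Fin (1 + 1)) {W : Y.X.Etale} (x : Y.Fn W) :
    l.coordMap i x ≫ toA1 (l.c i) = toA1 x := by
  have := l.isIso_toA1 i
  rw [coordMap, Category.assoc, IsIso.inv_hom_id, Category.comp_id]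

lemma coordMap_str (i : Fin (1 + 1)) {W : Y.X.Etale} (x : Y.Fn W) :
    l.coordMap i x ≫ proj (l.U i) ≫ L.str = proj W ≫ Y.str := by
  rw [← toA1_comp x, ← toA1_comp (l.c i), ← l.coordMap_toA1 i x, Category.assoc]

lemma fnPull_coordMap (i : Fin (1 + 1)) {W : Y.X.Etale} (x : Y.Fn W) :
    fnPull (l.coordMap i x) (l.c i) = x := by
  have h1 := toA1_fnPull (l.coordMap i x) (l.coordMap_str i x) (l.c i)
  rw [coordMap_toA1] at h1
  have h2 (y : Y.Fn W) : (pullElem (toA1 y) Polynomial.X : Y.Fn W) = y := by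
    rw [pullElem_toA1, aeval_X]
  rw [← h2 (fnPull _ _), h1, h2]

lemma eq_coordMap (i : Fin (1 + 1)) {W : Y.X.Etale} {x : Y.Fn W} {h : dom W ⟶ dom (l.U i)}
    (hh : h ≫ proj (l.U i) ≫ L.str = proj W ≫ Y.str) (hx : fnPull h (l.c i) = x) :
    h = l.coordMap i x := by
  have := l.isIso_toA1 i
  rw [← cancel_mono (toA1 (l.c i)), coordMap_toA1, ← hx, toA1_fnPull h hh]

end LineData

namespace LogLineData

variable (l : LogLineData L) (i : Fin (1 + 1)) (m : Y.Mon (top Y.X))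

/-- Restriction of global sections. -/
def glob {Y : LogScheme} (W : Y.X.Etale) : Y.Mon (top Y.X) →* Y.Mon W :=
  Y.res ((isTerminalTop Y.X).from W)

lemma res_glob {V W : Y.X.Etale} (b : W ⟶ V) : Y.res b (glob V m) = glob W m := by
  rw [glob, glob, ← res_comp]
  congr 2
  exact (isTerminalTop Y.X).hom_ext _ _

/-- The morphism of schemes to the projective line with coordinate the image of `m`. -/
def sectionMap : Y.X ⟶ L.X := l.coordMap i (Y.toFn _ m) ≫ proj (l.U i)

/-- `n'` is the pullback of `n` under the morphism that maps the coordinate to `m`, as seen from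
a local expression of `n`. -/
def IsPull {U : L.X.Etale} {W : Y.X.Etale} (g : dom W ⟶ dom U) (n : L.Mon U) (n' : Y.Mon W) : Prop :=
  ∃ (Z : L.X.Etale) (a : Z ⟶ U) (a' : Z ⟶ l.U i) (r : dom W ⟶ dom Z) (k : ℕ) (u : (L.Mon Z)ˣ),
    r ≫ left a = g ∧ L.res a n = L.res a' (l.t i) ^ k * u ∧ n' = glob W m ^ k * unitPull r u

variable {l i m}

lemma toFn_glob {W : Y.X.Etale} {Z : L.X.Etale} (a : Z ⟶ l.U i) (r : dom W ⟶ dom Z)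
    (hr : r ≫ proj Z = proj W ≫ l.sectionMap i m) :
    Y.toFn W (glob W m) = fnPull r (L.toFn Z (L.res a (l.t i))) := by
  let b := (isTerminalTop Y.X).from W
  have hb : left b = proj W := (Category.comp_id _).symm.trans (left_proj b)
  have h1 : r ≫ left a = left b ≫ l.coordMap i (Y.toFn _ m) := by
    have := l.isOpenImmersion i
    rw [← cancel_mono (proj (l.U i)), Category.assoc, left_proj, hr, hb]
    exact (Category.assoc _ _ _).symm
  rw [toFn_res, fnPull_resFn, l.toFn_t, h1, ← resFn_fnPull, l.fnPull_coordMap, ← toFn_res]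
  rfl

namespace IsPull

variable {U : L.X.Etale} {W : Y.X.Etale} {g : dom W ⟶ dom U}

lemma res {n : L.Mon U} {n' : Y.Mon W} (h : l.IsPull i m g n n') {W' : Y.X.Etale} (b : W' ⟶ W) :
    l.IsPull i m (left b ≫ g) n (Y.res b n') := by
  obtain ⟨Z, a, a', r, k, u, rfl, h1, rfl⟩ := h
  refine ⟨Z, a, a', left b ≫ r, k, u, Category.assoc _ _ _, h1, ?_⟩
  rw [map_mul, map_pow, res_glob, res_unitPull]

lemma of_res {U' : L.X.Etale} {a : U ⟶ U'} {n : L.Mon U'} {n' : Y.Mon W}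
    (h : l.IsPull i m g (L.res a n) n') : l.IsPull i m (g ≫ left a) n n' := by
  obtain ⟨Z, b, a', r, k, u, rfl, h1, rfl⟩ := h
  exact ⟨Z, b ≫ a, a', r, k, u, (Category.assoc _ _ _).symm, by rw [res_comp, h1], rfl⟩

/-- Locally n = t^k u with a unit u, and the pullback has to be m^k times the pullback of u. -/
lemma exists_local (hg : g ≫ proj U = proj W ≫ l.sectionMap i m) (n : L.Mon U) (w : dom W) :
    ∃ (W' : Y.X.Etale) (b : W' ⟶ W), w ∈ Set.range (left b) ∧
      ∃ n', l.IsPull i m (left b ≫ g) n n' := by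
  have h1 : proj U (g w) = proj (l.U i) (l.coordMap i (Y.toFn _ m) (proj W w)) := congr($hg w)
  obtain ⟨Z₀, a₀, a', z₀, hz₀⟩ := l.exists_hom_of_mem (i := i) U (g w) (h1 ▸ ⟨_, rfl⟩)
  obtain ⟨Z, a, ⟨z, rfl⟩, k, u, h⟩ := l.exists_eq a' (L.res a₀ n) z₀
  obtain ⟨W', b, r, hb, hr⟩ := exists_lift_at g (a ≫ a₀) hz₀
  refine ⟨W', b, hb, _, Z, a ≫ a₀, a ≫ a', r, k, u, hr, ?_, rfl⟩
  rw [res_comp, h]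

/-- Over a common refinement two expressions of `n` differ only by moving a power of the coordinate
into the unit. The pulled-back unit is determined by its function, so it absorbs the same power of
`m`. -/
lemma unique (hg : g ≫ proj U = proj W ≫ l.sectionMap i m) {n : L.Mon U} {n₁ n₂ : Y.Mon W}
    (h₁ : l.IsPull i m g n n₁) (h₂ : l.IsPull i m g n n₂) : n₁ = n₂ := by
  obtain ⟨Z₁, a₁, a₁', r₁, k₁, u₁, e₁, h₁, rfl⟩ := h₁
  obtain ⟨Z₂, a₂, a₂', r₂, k₂, u₂, e₂, h₂, rfl⟩ := h₂
  obtain ⟨Z, g₁, g₂, r, eg, rfl, rfl⟩ := exists_common_lift a₁ a₂ r₁ r₂ (e₁.trans e₂.symm)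
  have ht : g₂ ≫ a₂' = g₁ ≫ a₁' := l.hom_unique _ _
  have hr : r ≫ proj Z = proj W ≫ l.sectionMap i m := by
    rw [← hg, ← e₁, Category.assoc, Category.assoc, left_proj, left_proj]
  have key : L.res (g₁ ≫ a₁') (l.t i) ^ k₁ * Units.map (L.res g₁) u₁ =
      L.res (g₁ ≫ a₁') (l.t i) ^ k₂ * Units.map (L.res g₂) u₂ := by
    have h1 := congrArg (L.res g₁) h₁
    have h2 := congrArg (L.res g₂) h₂
    rw [map_mul, map_pow, ← res_comp, ← res_comp] at h1 h2
    rw [← ht, ht]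
    rw [ht, ← eg] at h2
    exact h1.symm.trans h2
  rw [← unitPull_res, ← unitPull_res]
  generalize Units.map (L.res g₁) u₁ = v₁ at key
  generalize Units.map (L.res g₂) u₂ = v₂ at key
  generalize g₁ ≫ a₁' = c at key
  clear h₁ h₂
  -- The power of the coordinate is cancelled in `L`; in `Y` the function of `m` may be zero, as for
  -- the log point.
  have aux {k₁ k₂ : ℕ} (hk : k₁ ≤ k₂) {v₁ v₂ : (L.Mon Z)ˣ} (key : L.res c (l.t i) ^ k₁ * v₁ =
      L.res c (l.t i) ^ k₂ * v₂) :
      glob W m ^ k₁ * (unitPull r v₁ : Y.Mon W) = glob W m ^ k₂ * unitPull r v₂ := by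
    obtain ⟨d, rfl⟩ := Nat.exists_eq_add_of_le hk
    rw [pow_add, mul_assoc] at key ⊢
    have h3 := l.pow_mul_cancel c k₁ key
    congr 1
    refine unitPull_eq ?_
    rw [map_mul, map_pow, toFn_unitPull, toFn_glob c r hr, h3, map_mul, map_mul, map_pow, map_pow]
  obtain hk | hk := le_total k₁ k₂
  · exact aux hk key
  · exact (aux hk key.symm).symm

lemma mul {n₁ n₂ : L.Mon U} {n₁' n₂' : Y.Mon W}
    (h₁ : l.IsPull i m g n₁ n₁') (h₂ : l.IsPull i m g n₂ n₂') :
    l.IsPull i m g (n₁ * n₂) (n₁' * n₂') := by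
  obtain ⟨Z₁, a₁, a₁', r₁, k₁, u₁, e₁, h₁, rfl⟩ := h₁
  obtain ⟨Z₂, a₂, a₂', r₂, k₂, u₂, e₂, h₂, rfl⟩ := h₂
  obtain ⟨Z, g₁, g₂, r, eg, rfl, rfl⟩ := exists_common_lift a₁ a₂ r₁ r₂ (e₁.trans e₂.symm)
  have ht : g₂ ≫ a₂' = g₁ ≫ a₁' := l.hom_unique _ _
  refine ⟨Z, g₁ ≫ a₁, g₁ ≫ a₁', r, k₁ + k₂, Units.map (L.res g₁) u₁ * Units.map (L.res g₂) u₂,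
    ?_, ?_, ?_⟩
  · rw [← e₁, Category.assoc]; rfl
  · have h1 := congrArg (L.res g₁) h₁
    have h2 := congrArg (L.res g₂) h₂
    rw [map_mul, map_pow, ← res_comp, ← res_comp] at h1 h2
    rw [ht, ← eg] at h2
    rw [map_mul, h1, h2, pow_add, Units.val_mul, mul_mul_mul_comm]
    rfl
  · rw [map_mul, unitPull_res, unitPull_res, pow_add, mul_mul_mul_comm]

lemma toFn {n : L.Mon U} {n' : Y.Mon W} (hg : g ≫ proj U = proj W ≫ l.sectionMap i m)
    (h : l.IsPull i m g n n') : Y.toFn W n' = fnPull g (L.toFn U n) := by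
  obtain ⟨Z, a, a', r, k, u, rfl, h1, rfl⟩ := h
  have hr : r ≫ proj Z = proj W ≫ l.sectionMap i m := by
    rw [← hg, Category.assoc, left_proj]
  rw [← fnPull_resFn, ← toFn_res, h1, map_mul, map_mul, map_pow, map_pow, map_mul, map_pow,
    toFn_glob a' r hr, toFn_unitPull]

end IsPull

lemma glob_top {Y : LogScheme} (m : Y.Mon (top Y.X)) : glob (top Y.X) m = m := by
  rw [glob, (isTerminalTop Y.X).hom_ext ((isTerminalTop Y.X).from _) (𝟙 _), res_id]

variable (l i m) in
/-- `n'` is the pullback of `n` under the morphism that maps the coordinate to `m`. -/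
def IsLocalPull {U : L.X.Etale} {W : Y.X.Etale} (g : dom W ⟶ dom U) (n : L.Mon U) (n' : Y.Mon W) :
    Prop :=
  LocallyOn W fun W' b => l.IsPull i m (left b ≫ g) n (Y.res b n')

lemma comp_sectionMap {U : L.X.Etale} {W W' : Y.X.Etale} {g : dom W ⟶ dom U} (b : W' ⟶ W)
    (hg : g ≫ proj U = proj W ≫ l.sectionMap i m) :
    (left b ≫ g) ≫ proj U = proj W' ≫ l.sectionMap i m := by
  rw [Category.assoc, hg, ← Category.assoc, left_proj]

namespace IsLocalPull

variable {U : L.X.Etale} {W : Y.X.Etale} {g : dom W ⟶ dom U}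

lemma of_isPull {n : L.Mon U} {n' : Y.Mon W} (h : l.IsPull i m g n n') :
    l.IsLocalPull i m g n n' := .of_forall fun W' b => h.res b

lemma unique (hg : g ≫ proj U = proj W ≫ l.sectionMap i m) {n : L.Mon U} {n₁ n₂ : Y.Mon W}
    (h₁ : l.IsLocalPull i m g n n₁) (h₂ : l.IsLocalPull i m g n n₂) : n₁ = n₂ :=
  mon_ext ((h₁.and h₂).mono fun W' b h => h.1.unique (comp_sectionMap b hg) h.2)

lemma exists_eq (hg : g ≫ proj U = proj W ≫ l.sectionMap i m) (n : L.Mon U) :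
    ∃ n', l.IsLocalPull i m g n n' := by
  refine mon_glue (fun W' b n' => l.IsPull i m (left b ≫ g) n n') (fun W₁ W₂ b c n' h => h.res c)
    (fun W' b n₁ n₂ h₁ h₂ => h₁.unique (comp_sectionMap b hg) h₂)
    (.of_cover (fun W₁ W₂ b c ⟨n', h⟩ => ⟨_, h.res c⟩) (IsPull.exists_local hg n))

lemma mul {n₁ n₂ : L.Mon U} {n₁' n₂' : Y.Mon W}
    (h₁ : l.IsLocalPull i m g n₁ n₁') (h₂ : l.IsLocalPull i m g n₂ n₂') :
    l.IsLocalPull i m g (n₁ * n₂) (n₁' * n₂') :=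
  (LocallyOn.and h₁ h₂).mono fun W' b h => by
    rw [map_mul]
    exact h.1.mul h.2

lemma res {n : L.Mon U} {n' : Y.Mon W} (h : l.IsLocalPull i m g n n') {W' : Y.X.Etale} (b : W' ⟶ W) :
    l.IsLocalPull i m (left b ≫ g) n (Y.res b n') :=
  (LocallyOn.pullback h b).mono fun W'' c h => by
    rw [← res_comp]
    exact h

lemma of_res {U' : L.X.Etale} {a : U ⟶ U'} {n : L.Mon U'} {n' : Y.Mon W}
    (h : l.IsLocalPull i m g (L.res a n) n') : l.IsLocalPull i m (g ≫ left a) n n' :=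
  h.mono fun W' b h => by
    rw [← Category.assoc]
    exact h.of_res

lemma toFn {n : L.Mon U} {n' : Y.Mon W} (hg : g ≫ proj U = proj W ≫ l.sectionMap i m)
    (h : l.IsLocalPull i m g n n') : Y.toFn W n' = fnPull g (L.toFn U n) :=
  fn_ext (h.mono fun W' b h => by
    rw [← toFn_res, h.toFn (comp_sectionMap b hg), resFn_fnPull])

end IsLocalPull

variable (l i m) in
/-- The morphism that maps the coordinate on the chart `U i` to `m`. -/
def homOfSection : Y.Hom L where
  f := l.sectionMap i m
  w := (Category.assoc _ _ _).trans ((l.coordMap_str i (Y.toFn _ m)).trans (Category.id_comp _))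
  pull {U V} g hg :=
    have hs (n) := (IsLocalPull.exists_eq hg n).choose_spec
    { toFun := fun n => (IsLocalPull.exists_eq hg n).choose
      map_one' := by
        -- The value at 1 is idempotent, and it is a unit because its function is 1.
        have h := IsLocalPull.unique hg (hs 1) (by simpa only [mul_one] using (hs 1).mul (hs 1))
        obtain ⟨e⟩ : IsUnit (IsLocalPull.exists_eq hg 1).choose :=
          isUnit_toFn.1 (by rw [(hs 1).toFn hg, map_one, map_one]; exact isUnit_one)
        have h3 : IsUnit (IsLocalPull.exists_eq hg 1).choose :=
          isUnit_toFn.1 (by rw [(hs 1).toFn hg, map_one, map_one]; exact isUnit_one)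
        exact (h3.mul_left_cancel ((mul_one _).trans h)).symm
      map_mul' := fun n₁ n₂ => IsLocalPull.unique hg (hs _) ((hs n₁).mul (hs n₂)) }
  res_pull {U V V'} g hg b hg' n := IsLocalPull.unique hg'
    ((IsLocalPull.exists_eq hg n).choose_spec.res b) (IsLocalPull.exists_eq hg' n).choose_spec
  pull_res {U U' V} g hg a hg' n := IsLocalPull.unique hg'
    (IsLocalPull.exists_eq hg (L.res a n)).choose_spec.of_res
    (IsLocalPull.exists_eq hg' n).choose_spec
  toFn_pull {U V} g hg n := (IsLocalPull.exists_eq hg n).choose_spec.toFn hg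

lemma homOfSection_pull {U : L.X.Etale} {V : Y.X.Etale} (g : dom V ⟶ dom U)
    (hg : g ≫ proj U = proj V ≫ l.sectionMap i m) {n : L.Mon U} {n' : Y.Mon V}
    (h : l.IsPull i m g n n') : (l.homOfSection i m).pull g hg n = n' :=
  IsLocalPull.unique hg (IsLocalPull.exists_eq hg n).choose_spec (.of_isPull h)

lemma homOfSection_pull_t {V : Y.X.Etale} (g : dom V ⟶ dom (l.U i))
    (hg : g ≫ proj (l.U i) = proj V ≫ l.sectionMap i m) :
    (l.homOfSection i m).pull g hg (l.t i) = glob V m :=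
  homOfSection_pull g hg ⟨l.U i, 𝟙 _, 𝟙 _, g, 1, 1, Category.comp_id g, by simp, by simp⟩

/-- A morphism to the projective line that factors through a chart is determined by the pullback of
the coordinate. -/
lemma hom_ext {f f' : Y.Hom L} (h : f.f = f'.f) (s : dom (top Y.X) ⟶ dom (l.U i))
    (hs : s ≫ proj (l.U i) = proj (top Y.X) ≫ f.f)
    (hs' : s ≫ proj (l.U i) = proj (top Y.X) ≫ f'.f)
    (ht : f.pull s hs (l.t i) = f'.pull s hs' (l.t i)) : f = f' := by
  have := l.isOpenImmersion i
  refine Hom.ext' h fun {U V} g hg hg' n => mon_ext (.of_cover (fun W W' b c e => ?_) fun v => ?_)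
  · rw [res_comp, res_comp, e]
  let bt (W : Y.X.Etale) : W ⟶ top Y.X := (isTerminalTop Y.X).from W
  have hbt (F : Y.Hom L) (hsF : s ≫ proj (l.U i) = proj (top Y.X) ≫ F.f) (W : Y.X.Etale) :
      (left (bt W) ≫ s) ≫ proj (l.U i) = proj W ≫ F.f := by
    rw [Category.assoc, hsF, ← Category.assoc, left_proj]
  have h1 : proj U (g v) = proj (l.U i) (s (left (bt V) v)) :=
    congr($(hg.trans (hbt f hs V).symm) v)
  obtain ⟨Z₀, a₀, a', z₀, hz₀⟩ := l.exists_hom_of_mem (i := i) U (g v) (h1 ▸ ⟨_, rfl⟩)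
  obtain ⟨Z, a, ⟨z, rfl⟩, k, u, hk⟩ := l.exists_eq a' (L.res a₀ n) z₀
  obtain ⟨W, b, r, hb, hr⟩ := exists_lift_at g (a ≫ a₀) hz₀
  refine ⟨W, b, hb, ?_⟩
  rw [← res_comp] at hk
  -- Writing n = t^k u, the pullback is a power of the pullback of the coordinate times that of a
  -- unit, and the latter depends only on the morphism of schemes.
  have key (F : Y.Hom L) (hF : g ≫ proj U = proj V ≫ F.f) (hsF : s ≫ proj (l.U i) = proj (top Y.X) ≫ F.f) :
      Y.res b (F.pull g hF n) = glob W (F.pull s hsF (l.t i)) ^ k * unitPull r u := by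
    have hrF : r ≫ proj Z = proj W ≫ F.f := by
      rw [← left_proj (a ≫ a₀), ← Category.assoc, hr, Category.assoc, hF, ← Category.assoc, left_proj]
    have hlF : (left b ≫ g) ≫ proj U = proj W ≫ F.f := by
      rw [Category.assoc, hF, ← Category.assoc, left_proj]
    have e1 : r ≫ left (a ≫ a') = left (bt W) ≫ s := by
      rw [← cancel_mono (proj (l.U i)), Category.assoc, left_proj, hrF, hbt F hsF]
    have e2 : (r ≫ left (a ≫ a')) ≫ proj (l.U i) = proj W ≫ F.f := by
      rw [Category.assoc, left_proj, hrF]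
    rw [F.res_pull g hF b hlF, ← F.pull_eq hr (by rw [Category.assoc, left_proj, hrF]) hlF,
      ← F.pull_res r hrF (a ≫ a₀), hk, map_mul, map_pow, F.pull_unit, F.pull_res r hrF (a ≫ a') e2,
      glob, F.res_pull s hsF (bt W) (hbt F hsF W), F.pull_eq e1]
  rw [key f hg hs, key f' hg' hs', ht]

end LogLineData

end LogScheme

/-! ### Thickenings and log smoothness of the line with trivial log structure -/

namespace LogScheme

section Thickening

variable {S T : LogScheme} {i : S.Hom T}

/-- On the open complement of the image the function 1 restricts to 0 on the empty scheme. The ideal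
has square zero, so 1 = 1 · 1 = 0 there and the complement is empty. -/
lemma Hom.IsFirstOrderThickening.surjective (hi : i.IsFirstOrderThickening) :
    Function.Surjective i.f := by
  have := hi.1.1
  by_contra hs
  let O : T.X.Opens := ⟨(Set.range i.f)ᶜ, (i.f.isClosedEmbedding.isClosed_range).isOpen_compl⟩
  have hO : i.f ⁻¹ᵁ O = ⊥ := by
    ext x
    simp only [TopologicalSpace.Opens.map_coe, TopologicalSpace.Opens.coe_bot]
    exact ⟨fun hx => hx ⟨x, rfl⟩, fun hx => hx.elim⟩
  have hsub : Subsingleton Γ(S.X, i.f ⁻¹ᵁ O) := by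
    rw [hO]
    infer_instance
  have h1 : i.f.app O 1 = 0 := Subsingleton.elim _ _
  have h2 := hi.2 O 1 1 h1 h1
  rw [mul_one] at h2
  have h3 : (T.X.basicOpen (1 : Γ(T.X, O))) = ⊥ := by rw [h2, Scheme.basicOpen_zero]
  rw [Scheme.basicOpen_of_isUnit _ isUnit_one] at h3
  refine hs fun t => ?_
  by_contra ht
  have h4 : t ∈ O := ht
  rw [h3] at h4
  exact h4

lemma isClosedImmersion_baseFst (hi : IsClosedImmersion i.f) (U : T.X.Etale) :
    IsClosedImmersion (i.baseFst U) :=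
  inferInstanceAs (IsClosedImmersion (pullback.fst (proj U) i.f))

lemma exists_baseFst_eq {U : T.X.Etale} (u : dom U) (s : S.X) (h : i.f s = proj U u) :
    ∃ x, i.baseFst U x = u ∧ proj (i.base U) x = s :=
  Scheme.Pullback.exists_preimage_pullback (f := proj U) (g := i.f) u s h.symm

lemma surjective_baseFst (hi : i.IsFirstOrderThickening) (U : T.X.Etale) :
    Function.Surjective (i.baseFst U) := fun u => by
  obtain ⟨s, hs⟩ := hi.surjective (proj U u)
  obtain ⟨x, hx, -⟩ := exists_baseFst_eq u s hs
  exact ⟨x, hx⟩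

lemma surjective_fnPull_baseFst (hi : IsClosedImmersion i.f) (U : T.X.Etale) [IsAffine (dom U)] :
    Function.Surjective (fnPull (i.baseFst U) : T.Fn U →+* S.Fn (i.base U)) := by
  have := isClosedImmersion_baseFst hi U
  exact (IsClosedImmersion.isAffine_surjective_of_isAffine (i.baseFst U)).2

/-- Functoriality of the base change of étale schemes. -/
def baseMap (i : S.Hom T) {U U' : T.X.Etale} (a : U' ⟶ U) : i.base U' ⟶ i.base U :=
  homOfLeft (i.toBase U (i.baseFst U' ≫ left a) (proj (i.base U')) (by
    rw [Category.assoc, left_proj, i.baseFst_proj])) (i.toBase_proj _ _ _ _)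

lemma baseMap_baseFst (i : S.Hom T) {U U' : T.X.Etale} (a : U' ⟶ U) :
    left (baseMap i a) ≫ i.baseFst U = i.baseFst U' ≫ left a := i.toBase_fst _ _ _ _

/-- A closed immersion induces the subspace topology, so `O` is the trace of an open subset of `dom
U`, in which an affine neighbourhood is chosen. -/
lemma exists_refine (hi : i.IsFirstOrderThickening) {U : T.X.Etale} (O : (dom (i.base U)).Opens)
    {x : dom (i.base U)} (hx : x ∈ O) : ∃ (U' : T.X.Etale) (a : U' ⟶ U), IsAffine (dom U') ∧
      i.baseFst U x ∈ Set.range (left a) ∧ ∀ y, left (baseMap i a) y ∈ O := by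
  have := isClosedImmersion_baseFst hi.1.1 U
  obtain ⟨O', hO', he⟩ := (i.baseFst U).isClosedEmbedding.isInducing.isOpen_iff.1 O.isOpen
  obtain ⟨V, hV, hxV, hVO⟩ := exists_isAffineOpen_mem_and_subset (X := dom U) (x := i.baseFst U x)
    (U := ⟨O', hO'⟩) (show x ∈ i.baseFst U ⁻¹' O' by rw [he]; exact hx)
  refine ⟨sub U V, subι U V, hV, by rw [range_subι]; exact hxV, fun y => ?_⟩
  have h1 : i.baseFst U (left (baseMap i (subι U V)) y) = left (subι U V) (i.baseFst _ y) :=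
    congr($(baseMap_baseFst i (subι U V)) y)
  have h2 : left (subι U V) (i.baseFst _ y) ∈ V := by
    have := range_subι U V
    exact (Set.ext_iff.1 this _).1 ⟨_, rfl⟩
  have h3 : left (baseMap i (subι U V)) y ∈ i.baseFst U ⁻¹' O' := by
    change i.baseFst U _ ∈ O'
    rw [h1]
    exact hVO h2
  rw [he] at h3
  exact h3

/-- The restriction of a morphism to an étale scheme over the target. -/
def restrBase (i : S.Hom T) (U : T.X.Etale) : (S.restr (i.base U)).Hom (T.restr U) :=
  ((S.restrHom (i.base U)).comp i).lift U (i.baseFst U) (i.baseFst_proj U)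

/-- `U` as the terminal étale scheme over itself. -/
def toTop {X : Scheme.{0}} (U : X.Etale) : push U (top (dom U)) ⟶ U := toPush (𝟙 (dom U)) rfl

lemma restrHom_comp_pull {X L : LogScheme} (U : X.X.Etale) (f : X.Hom L) {V : L.X.Etale}
    (h : dom U ⟶ dom V) (hh : h ≫ proj V = proj U ≫ f.f)
    (hh' : h ≫ proj V = proj (top (dom U)) ≫ proj U ≫ f.f) (x : L.Mon V) :
    ((X.restrHom U).comp f).pull (V := top (dom U)) h hh' x = X.res (toTop U) (f.pull h hh x) := by
  have e : 𝟙 (dom U) ≫ h = h := Category.id_comp h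
  refine (Hom.pull_eq ((X.restrHom U).comp f) e ((congrArg (· ≫ proj V) e).trans hh') _ _).symm.trans ?_
  exact Hom.comp_pull (X.restrHom U) f (V := U) (W := top (dom U)) (𝟙 (dom U)) rfl h hh _ x

lemma restrBase_pull (i : S.Hom T) (U : T.X.Etale) (x : T.Mon U)
    (hg : i.baseFst U ≫ proj (top (dom U)) = proj (top (dom (i.base U))) ≫ i.baseFst U) :
    (restrBase i U).pull (U := top (dom U)) (V := top (dom (i.base U))) (i.baseFst U) hg
      (T.res (toTop U) x) = S.res (toTop (i.base U)) (i.pull (i.baseFst U) (i.baseFst_proj U) x) := by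
  have e : i.baseFst U ≫ 𝟙 (dom U) = i.baseFst U := Category.comp_id _
  have h0 : i.baseFst U ≫ proj U = proj (top (dom (i.base U))) ≫ proj (i.base U) ≫ i.f :=
    (i.baseFst_proj U).trans (Category.id_comp _).symm
  have h1 := Hom.pull_res ((S.restrHom (i.base U)).comp i) (V := top (dom (i.base U)))
    (U' := push U (top (dom U))) (i.baseFst U)
    ((congrArg (i.baseFst U ≫ ·) (Category.id_comp (proj U))).trans h0) (toTop U)
    ((congrArg (· ≫ proj U) e).trans h0) x
  refine h1.trans ((Hom.pull_eq ((S.restrHom (i.base U)).comp i) e _ h0 x).trans ?_)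
  exact restrHom_comp_pull (i.base U) i (i.baseFst U) (i.baseFst_proj U) h0 x

/-- Restrictions to étale schemes over `T` supply enough neighbourhoods; base change along `i`
provides the cartesian square and the strict étale maps. -/
lemma isLogSmooth_of {L : LogScheme} (hL : LocallyOfFinitePresentation L.str)
    (H : ∀ (S T : LogScheme) (i : S.Hom T) (f : S.Hom L), T.IsFine → i.IsFirstOrderThickening →
      ∀ t : T.X, ∃ U : T.X.Etale, t ∈ Set.range (proj U) ∧ ∃ g : (T.restr U).Hom L,
        (restrBase i U).comp g = (S.restrHom (i.base U)).comp f) : L.IsLogSmooth := by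
  refine ⟨hL, fun S T i f hT hi t => ?_⟩
  obtain ⟨U, ht, g, hg⟩ := H S T i f hT hi t
  exact ⟨_, _, T.restrHom U, S.restrHom (i.base U), restrBase i U, g, ht,
    restrHom_isStrictEtale U, restrHom_isStrictEtale _,
    (IsPullback.of_hasPullback (proj U) i.f).flip,
    (Hom.lift_comp ((S.restrHom (i.base U)).comp i) U (i.baseFst U) (i.baseFst_proj U)).symm, hg⟩

end Thickening

namespace LineData

variable {L : LogScheme}

/-- Locally the morphism lands in one chart and is given by a function. Functions lift along a
closed immersion into an affine scheme, and the trivial log structure of the target adds no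
condition. -/
lemma isLogSmooth (l : LineData L) (hL : LocallyOfFinitePresentation L.str) (hT : L.IsTrivial) : L.IsLogSmooth := by
  refine isLogSmooth_of hL fun S T i f _ hi t => ?_
  obtain ⟨s, rfl⟩ := hi.surjective t
  obtain ⟨j, hj⟩ := l.covers (f.f s)
  have := l.isOpenImmersion j
  obtain ⟨x, hx, hxs⟩ := exists_baseFst_eq (i := i) (U := top T.X) (i.f s) s rfl
  let O : (dom (i.base (top T.X))).Opens := (proj (i.base (top T.X)) ≫ f.f) ⁻¹ᵁ (proj (l.U j)).opensRange
  have hxO : x ∈ O := by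
    change f.f (proj (i.base (top T.X)) x) ∈ Set.range (proj (l.U j))
    rw [hxs]
    exact hj
  obtain ⟨U, a, hU, hxa, ha⟩ := exists_refine hi O hxO
  have hl (y : dom (i.base U)) : f.f (proj (i.base U) y) ∈ Set.range (proj (l.U j)) := by
    have h1 : proj (i.base (top T.X)) (left (baseMap i a) y) = proj (i.base U) y :=
      congr($(left_proj (baseMap i a)) y)
    rw [← h1]
    exact ha y
  let h : dom (i.base U) ⟶ dom (l.U j) := IsOpenImmersion.lift (proj (l.U j))
    (proj (i.base U) ≫ f.f) (by rintro _ ⟨y, rfl⟩; exact hl y)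
  have hh : h ≫ proj (l.U j) = proj (i.base U) ≫ f.f := IsOpenImmersion.lift_fac _ _ _
  obtain ⟨x', hx'⟩ := surjective_fnPull_baseFst hi.1.1 U (fnPull h (l.c j))
  have hs : h = i.baseFst U ≫ l.coordMap j x' := by
    have e1 : (i.baseFst U ≫ l.coordMap j x') ≫ proj (l.U j) ≫ L.str =
        proj (i.base U) ≫ S.str := by
      rw [Category.assoc, l.coordMap_str, ← Category.assoc, i.baseFst_proj, Category.assoc, i.w]
    have e2 : h ≫ proj (l.U j) ≫ L.str = proj (i.base U) ≫ S.str := by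
      rw [← Category.assoc, hh, Category.assoc, f.w]
    rw [l.eq_coordMap j e1 rfl, l.eq_coordMap j e2 rfl, ← fnPull_fnPull, l.fnPull_coordMap, hx']
  refine ⟨U, ?_, homOfTrivial hT (l.coordMap j x' ≫ proj (l.U j)) ?_, hT.hom_ext ?_⟩
  · obtain ⟨u, hu⟩ := hxa
    refine ⟨u, ?_⟩
    rw [← left_proj a]
    exact (congrArg (proj (top T.X)) (hu.trans hx))
  · exact (Category.assoc _ _ _).trans (l.coordMap_str j x')
  · change i.baseFst U ≫ l.coordMap j x' ≫ proj (l.U j) = proj (i.base U) ≫ f.f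
    rw [← hh, hs, Category.assoc]

end LineData

end LogScheme

/-! ### Log smoothness of the line with its two-point log structure -/

namespace LogScheme

lemma exists_product {X : Scheme.{0}} {U V : X.Etale} {u : dom U} {v : dom V}
    (h : proj U u = proj V v) : ∃ (Z : X.Etale) (a : Z ⟶ U) (_ : Z ⟶ V), u ∈ Set.range (left a) := by
  let Z : X.Etale := Scheme.Etale.mk (pullback.fst (proj U) (proj V) ≫ proj U)
  obtain ⟨x, hx, -⟩ := Scheme.Pullback.exists_preimage_pullback (f := proj U) (g := proj V) u v h
  exact ⟨Z, homOfLeft (V := Z) (pullback.fst (proj U) (proj V)) rfl,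
    homOfLeft (V := Z) (pullback.snd (proj U) (proj V)) pullback.condition.symm, x, hx⟩

lemma exists_fibre {X : Scheme.{0}} {V W W' : X.Etale} (b : W ⟶ V) (b' : W' ⟶ V) {w : dom W}
    {w' : dom W'} (h : left b w = left b' w') :
    ∃ (Z : X.Etale) (g : Z ⟶ W) (g' : Z ⟶ W'), g ≫ b = g' ≫ b' ∧ w ∈ Set.range (left g) := by
  have e0 : pullback.snd (left b) (left b') ≫ proj W' = pullback.fst (left b) (left b') ≫ proj W := by
    rw [← left_proj b', ← pullback.condition_assoc, left_proj]
  let Z : X.Etale := Scheme.Etale.mk (pullback.fst (left b) (left b') ≫ proj W)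
  obtain ⟨x, hx, -⟩ := Scheme.Pullback.exists_preimage_pullback (f := left b) (g := left b') w w' h
  exact ⟨Z, homOfLeft (V := Z) (pullback.fst (left b) (left b')) rfl,
    homOfLeft (V := Z) (pullback.snd (left b) (left b')) e0, etaleHom_ext pullback.condition, x, hx⟩

lemma isUnit_of_locally {X : LogScheme} {V : X.X.Etale} {m : X.Mon V}
    (h : LocallyOn V fun W b => IsUnit (X.res b m)) : IsUnit m := by
  refine isUnit_toFn.1 ((isUnit_iff_nz _).2 fun v => ?_)
  obtain ⟨W, b, ⟨w, rfl⟩, hb⟩ := h.exists_mem v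
  have h1 := (isUnit_iff_nz _).1 (hb.map (X.toFn W)) w
  rwa [toFn_res, nz_resFn] at h1

/-- Locally n comes from an element p of a cancellative chart, up to a unit. The injectivity clause,
applied to p = p · w, gives p r = p s with s = w r. Then r = s, and the unit r cancels. -/
lemma IsFine.eq_one_of_eq_mul {T : LogScheme} (hT : T.IsFine) {U : T.X.Etale} {n w : T.Mon U}
    (hw : IsUnit w) (h : n = n * w) : w = 1 := by
  refine mon_ext (.of_cover (fun W W' b c e => ?_) fun u => ?_)
  · rw [res_comp, res_comp, e]
  obtain ⟨U₁, ⟨u₁, hu₁⟩, P, _, β, ⟨hP, hc⟩, hβ⟩ := hT (proj U u)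
  obtain ⟨Z, a, b, z, rfl⟩ := exists_product hu₁.symm
  obtain ⟨W, c, ⟨x, rfl⟩, p, v, hp⟩ := (hβ.1 Z b (T.res a n)).exists_mem z
  have h1 := congrArg (T.res (c ≫ a)) h
  rw [map_mul, res_comp, hp, mul_right_comm] at h1
  have h2 := v.isUnit.mul_right_cancel h1
  obtain ⟨W', d, ⟨x', rfl⟩, r, s, hr, hs, hrs, he⟩ :=
    (hβ.2 W (c ≫ b) p p (hw.map (T.res (c ≫ a))).unit h2).exists_mem x
  refine ⟨W', d ≫ c ≫ a, ⟨x', rfl⟩, ?_⟩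
  obtain rfl := mul_left_cancel hrs
  rw [IsUnit.unit_spec, ← res_comp] at he
  rw [map_one]
  exact (hr.mul_right_cancel ((one_mul _).trans he)).symm

/-- By strictness the quotient of the two units comes locally from a unit of `T` that fixes `n`, and
such a unit is 1. -/
lemma Hom.IsStrict.unit_unique {S T : LogScheme} {i : S.Hom T} (hi : i.IsStrict) (hT : T.IsFine)
    {V : S.X.Etale} {U : T.X.Etale} {g : dom V ⟶ dom U} (hg : g ≫ proj U = proj V ≫ i.f)
    {n : T.Mon U} {v v' : S.Mon V} (hv : IsUnit v) (hv' : IsUnit v')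
    (h : i.pull g hg n * v = i.pull g hg n * v') : v = v' := by
  obtain ⟨v, rfl⟩ := hv
  obtain ⟨v', rfl⟩ := hv'
  have h1 : i.pull g hg n = i.pull g hg n * ((v' * v⁻¹ : (S.Mon V)ˣ) : S.Mon V) := by
    rw [Units.val_mul, ← mul_assoc, ← h, Units.mul_inv_cancel_right]
  have h2 : ((v' * v⁻¹ : (S.Mon V)ˣ) : S.Mon V) = 1 := mon_ext ((hi.2 U V g hg n n _ h1).mono (by
    rintro W b ⟨U', a, g', hg', w, e1, e2, e3⟩
    rw [← e3, hT.eq_one_of_eq_mul w.isUnit e2, map_one, map_one]))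
  rw [Units.val_mul] at h2
  have h3 := congrArg (· * (v : S.Mon V)) h2
  simp only [Units.inv_mul_cancel_right, one_mul] at h3
  exact h3.symm

namespace LogLineData

variable {L : LogScheme} (l : LogLineData L) {S T : LogScheme} {i : S.Hom T}

include l

/-- Locally on a fine thickening the pullback of the coordinate lifts. -/
lemma exists_lift_t (hT : T.IsFine) (hi : i.IsFirstOrderThickening) (f : S.Hom L) (t : T.X) :
    ∃ (U : T.X.Etale) (j : Fin (1 + 1)) (h : dom (i.base U) ⟶ dom (l.U j))
      (hh : h ≫ proj (l.U j) = proj (i.base U) ≫ f.f) (m : T.Mon U), t ∈ Set.range (proj U) ∧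
      i.pull (i.baseFst U) (i.baseFst_proj U) m = f.pull h hh (l.t j) := by
  obtain ⟨s, rfl⟩ := hi.surjective t
  obtain ⟨j, c₀, hc₀⟩ := l.covers (f.f s)
  have := l.isOpenImmersion j
  obtain ⟨s₀, -, hs₀⟩ := exists_baseFst_eq (i := f) c₀ s hc₀.symm
  -- Strictness of `i` writes the pullback of the coordinate locally as a section `n` from `T` times
  -- a unit.
  obtain ⟨W, b, ⟨s₁, rfl⟩, U₁, g, hg, n, u, hu⟩ := (hi.1.2.1 (f.base (l.U j))
    (f.pull (f.baseFst (l.U j)) (f.baseFst_proj _) (l.t j))).exists_mem s₀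
  let γ : W ⟶ i.base U₁ := homOfLeft (i.toBase U₁ g (proj W) hg) (i.toBase_proj _ _ _ _)
  have hγ : left γ ≫ i.baseFst U₁ = g := i.toBase_fst _ _ _ _
  -- `W` is étale over `S` and need not come from `T`. Its image in the base change of `U₁` is open,
  -- and `U` is chosen so that its base change lands in that image.
  let O : (dom (i.base U₁)).Opens := ⟨Set.range (left γ), (left γ).isOpenMap.isOpen_range⟩
  obtain ⟨U, a, hU, hxa, ha⟩ := exists_refine hi O (x := left γ s₁) ⟨s₁, rfl⟩
  have hl (y : dom (i.base U)) : f.f (proj (i.base U) y) ∈ Set.range (proj (l.U j)) := by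
    obtain ⟨w, hw⟩ := ha y
    have h1 : proj (i.base U₁) (left (baseMap i a) y) = proj (i.base U) y :=
      congr($(left_proj (baseMap i a)) y)
    have h2 : proj (i.base U₁) (left γ w) = proj W w := congr($(left_proj γ) w)
    have h3 : proj (f.base (l.U j)) (left b w) = proj W w := congr($(left_proj b) w)
    have h4 : proj (l.U j) (f.baseFst (l.U j) (left b w)) = f.f (proj (f.base (l.U j)) (left b w)) :=
      congr($(f.baseFst_proj (l.U j)) (left b w))
    rw [← h1, ← hw, h2, ← h3, ← h4]
    exact ⟨_, rfl⟩
  let h : dom (i.base U) ⟶ dom (l.U j) := IsOpenImmersion.lift (proj (l.U j))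
    (proj (i.base U) ≫ f.f) (by rintro _ ⟨y, rfl⟩; exact hl y)
  have hh : h ≫ proj (l.U j) = proj (i.base U) ≫ f.f := IsOpenImmersion.lift_fac _ _ _
  let n' := i.pull (i.baseFst U) (i.baseFst_proj U) (T.res a n)
  have hloc (y : dom (i.base U)) : ∃ (W' : S.X.Etale) (c : W' ⟶ i.base U),
      y ∈ Set.range (left c) ∧ ∃ v, IsUnit v ∧
        S.res c (f.pull h hh (l.t j)) = S.res c n' * v := by
    obtain ⟨w, hw⟩ := ha y
    obtain ⟨W', c, d, e, hy⟩ := exists_fibre (baseMap i a) γ hw.symm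
    have e' : left c ≫ left (baseMap i a) = left d ≫ left γ := congrArg left e
    have e1 : left c ≫ i.baseFst U ≫ left a = left d ≫ g := by
      rw [← baseMap_baseFst, ← Category.assoc, e', Category.assoc, hγ]
    have hd : (left d ≫ g) ≫ proj U₁ = proj W' ≫ i.f := by
      rw [Category.assoc, hg, ← Category.assoc, left_proj]
    have e2 : left c ≫ h = left (d ≫ b) ≫ f.baseFst (l.U j) := by
      rw [← cancel_mono (proj (l.U j)), Category.assoc, hh, Category.assoc, f.baseFst_proj,
        ← Category.assoc, ← Category.assoc, left_proj, left_proj]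
    have hc : (left c ≫ h) ≫ proj (l.U j) = proj W' ≫ f.f := by
      rw [Category.assoc, hh, ← Category.assoc, left_proj]
    have hc' : (left c ≫ i.baseFst U) ≫ proj U = proj W' ≫ i.f := by
      rw [Category.assoc, i.baseFst_proj, ← Category.assoc, left_proj]
    have e3 : (left c ≫ i.baseFst U) ≫ left a = left d ≫ g := (Category.assoc _ _ _).trans e1
    refine ⟨W', c, hy, S.res d u, u.isUnit.map _, ?_⟩
    have h1 := congrArg (S.res d) hu
    rw [← res_comp, f.res_pull _ _ (d ≫ b) (e2 ▸ hc), map_mul, i.res_pull _ _ d hd] at h1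
    rw [f.res_pull _ _ c hc, f.pull_eq e2 hc (e2 ▸ hc), h1, i.res_pull _ _ c hc',
      i.pull_res _ hc' a (e3 ▸ hd), i.pull_eq e3]
  -- The unit comparing the pullback of the coordinate with `n'` is unique because `T` is fine, so
  -- the local units glue over the whole base change of `U`.
  obtain ⟨v, hv⟩ := mon_glue (V := i.base U) (fun W' c v => IsUnit v ∧
      S.res c (f.pull h hh (l.t j)) = S.res c n' * v)
    (fun W₁ W₂ c d v ⟨hv, e⟩ => ⟨hv.map _, by rw [res_comp, e, map_mul, ← res_comp]⟩)
    (fun W₁ c v v' ⟨hv, e⟩ ⟨hv', e'⟩ => by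
      have hc : (left c ≫ i.baseFst U) ≫ proj U = proj W₁ ≫ i.f := by
        rw [Category.assoc, i.baseFst_proj, ← Category.assoc, left_proj]
      rw [e, i.res_pull _ _ c hc] at e'
      exact hi.1.2.unit_unique hT hc hv hv' e')
    (.of_cover (fun W₁ W₂ c d ⟨v, hv, e⟩ =>
      ⟨_, hv.map (S.res d), by rw [res_comp, e, map_mul, ← res_comp]⟩) hloc)
  have hvu : IsUnit v := isUnit_of_locally (hv.mono fun W' c hc => hc.1)
  have hve : f.pull h hh (l.t j) = n' * v := mon_ext (hv.mono fun W' c hc => by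
    rw [hc.2, map_mul])
  -- `U` is affine, so the function of `v` lifts. The lift is invertible since the base change of
  -- the thickening is surjective on points.
  obtain ⟨x, hx⟩ := surjective_fnPull_baseFst hi.1.1 U (S.toFn _ v)
  have hxu : IsUnit x := (isUnit_iff_nz _).2 fun y => by
    obtain ⟨y, rfl⟩ := surjective_baseFst hi U y
    rw [← nz_fnPull (Y := S) (V := i.base U), hx]
    exact (isUnit_iff_nz _).1 (hvu.map _) y
  refine ⟨U, j, h, hh, T.res a n * T.ofUnit U hxu.unit, ?_, ?_⟩
  · obtain ⟨y, hy⟩ := hxa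
    refine ⟨y, ?_⟩
    have h1 : proj U₁ (left a y) = proj U y := congr($(left_proj a) y)
    have h2 : i.baseFst U₁ (left γ s₁) = g s₁ := congr($hγ s₁)
    have h3 : proj U₁ (g s₁) = i.f (proj W s₁) := congr($hg s₁)
    have h4 : proj (f.base (l.U j)) (left b s₁) = proj W s₁ := congr($(left_proj b) s₁)
    rw [← h1, hy, h2, h3, ← h4, hs₀]
  · rw [map_mul, hve]
    congr 1
    refine toFn_inj ?_ ?_
    · exact isUnit_toFn.2 ((isUnit_ofUnit _).map _)
    · rw [i.toFn_pull', toFn_ofUnit, IsUnit.unit_spec, hx]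

/-- The lifted section `m` of the coordinate defines the extension `homOfSection`. By `hom_ext`,
agreement with the given morphism needs to be checked only on schemes and on the coordinate. -/
lemma isLogSmooth (hL : LocallyOfFinitePresentation L.str) : L.IsLogSmooth := by
  refine isLogSmooth_of hL fun S T i f hT hi t => ?_
  obtain ⟨U, j, h, hh, m, ht, hm⟩ := l.exists_lift_t hT hi f t
  let m' : (T.restr U).Mon (top (dom U)) := T.res (toTop U) m
  let x' : (T.restr U).Fn (top (dom U)) := (T.restr U).toFn _ m'
  have hx' : x' = T.toFn U m :=
    (T.toFn_res (toTop U) m).trans congr($(Scheme.Hom.id_appTop (X := dom U)) (T.toFn U m))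
  have hs : i.baseFst U ≫ l.coordMap j x' = h := by
    have e1 : (i.baseFst U ≫ l.coordMap j x') ≫ proj (l.U j) ≫ L.str =
        proj (i.base U) ≫ S.str := by
      have := l.coordMap_str j x'
      refine (Category.assoc _ _ _).trans ((congrArg (i.baseFst U ≫ ·) (this.trans
        (Category.id_comp _))).trans ?_)
      change i.baseFst U ≫ proj U ≫ T.str = _
      rw [← Category.assoc, i.baseFst_proj, Category.assoc, i.w]
    have e2 : h ≫ proj (l.U j) ≫ L.str = proj (i.base U) ≫ S.str := by
      rw [← Category.assoc, hh, Category.assoc, f.w]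
    rw [l.eq_coordMap j e1 rfl, l.eq_coordMap j e2 rfl]
    congr 1
    refine (fnPull_fnPull _ _ _).symm.trans ?_
    have e3 := congrArg (S.toFn _) hm
    rw [i.toFn_pull', f.toFn_pull', l.toFn_t] at e3
    exact (congrArg (fnPull (i.baseFst U)) ((l.fnPull_coordMap j x').trans hx')).trans e3
  have hcl : l.coordMap j x' ≫ proj (l.U j) = proj (top (dom U)) ≫ l.sectionMap j m' :=
    (Category.id_comp _).symm
  refine ⟨U, ht, l.homOfSection j m', ?_⟩
  have hf : ((restrBase i U).comp (l.homOfSection j m')).f =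
      ((S.restrHom (i.base U)).comp f).f := by
    refine Eq.trans ?_ hh
    rw [← hs]
    exact (Category.assoc _ _ _).symm
  have h1 : h ≫ proj (l.U j) =
      proj (top (dom (i.base U))) ≫ ((S.restrHom (i.base U)).comp f).f :=
    hh.trans (Category.id_comp _).symm
  have h2 : h ≫ proj (l.U j) =
      proj (top (dom (i.base U))) ≫ ((restrBase i U).comp (l.homOfSection j m')).f :=
    h1.trans (congrArg (proj (top (dom (i.base U))) ≫ ·) hf.symm)
  refine l.hom_ext hf h h2 h1 ?_
  have hg : i.baseFst U ≫ proj (top (dom U)) = proj (top (dom (i.base U))) ≫ i.baseFst U :=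
    (Category.comp_id _).trans (Category.id_comp _).symm
  have e1 := Hom.comp_pull (restrBase i U) (l.homOfSection j m') (V := top (dom U))
    (W := top (dom (i.base U))) (i.baseFst U) hg (l.coordMap j x') hcl
    ((congrArg (· ≫ proj (l.U j)) hs).trans h2) (l.t j)
  have e0 := (homOfSection_pull_t (l.coordMap j x') hcl).trans (glob_top m')
  have e2 := Hom.pull_eq ((restrBase i U).comp (l.homOfSection j m')) (V := top (dom (i.base U)))
    hs ((congrArg (· ≫ proj (l.U j)) hs).trans h2) h2 (l.t j)
  refine e2.symm.trans ((e1.trans (congrArg _ e0)).trans ((restrBase_pull i U m hg).trans ?_))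
  rw [hm]
  exact (restrHom_comp_pull (i.base U) f h hh h1 (l.t j)).symm

end LogLineData

end LogScheme

namespace LogScheme

/-! ### The point with its trivial log structure -/

/-- The point `Spec ℂ` with the trivial log structure. -/
def point : LogScheme := divLog (Spec (.of ℂ)) (𝟙 _) ⊤

instance : Subsingleton point.X := inferInstanceAs (Subsingleton (Spec (.of ℂ)))

lemma isTrivial_point : point.IsTrivial := divLog_isTrivial _ _

/-- The complex points of an étale scheme over `Spec ℂ`. -/
abbrev CPt (V : point.X.Etale) : Type := FieldPt (L := point) ℂ ⊤ V

lemma spec_map_algebraMap_self :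
    Spec.map (CommRingCat.ofHom (algebraMap ℂ ℂ)) = 𝟙 (Spec (.of ℂ)) := Spec.map_id _

namespace CPt

variable {V : point.X.Etale}

lemma pt_proj (y : CPt V) : y.pt ≫ proj V = 𝟙 (Spec (.of ℂ)) := by
  exact (congrArg (y.pt ≫ ·) (Category.comp_id (proj V))).symm.trans
    (y.pt_str.trans spec_map_algebraMap_self)

/-- A complex point as a morphism of étale schemes. -/
def hom (y : CPt V) : top point.X ⟶ V := homOfLeft (V := top point.X) y.pt y.pt_proj

/-- The complex point of the point. -/
def base : CPt (top point.X) where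
  pt := 𝟙 (Spec (.of ℂ))
  pt_str := spec_map_algebraMap_self.symm
  mem := trivial

lemma eq_base (y : CPt (top point.X)) : y = base :=
  FieldPt.ext ((Category.comp_id _).symm.trans y.pt_proj)

lemma base_map (y : CPt V) : base.map y.hom = y := FieldPt.ext (Category.id_comp _)

lemma exists_eq (v : dom V) : ∃ y : CPt V, v ∈ Set.range (left y.hom) := by
  obtain ⟨y, hy, hy'⟩ := Scheme.exists_fac_of_etale_of_isSepClosed (proj V) (𝟙 (Spec (.of ℂ))) v
    (Subsingleton.elim _ _)
  refine ⟨⟨y, ?_, trivial⟩, (default : Spec (.of ℂ)), hy'⟩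
  rw [spec_map_algebraMap_self, ← hy]
  exact congrArg (y ≫ ·) (Category.comp_id (proj V))

lemma bijective_evalAt_base : Function.Bijective base.evalAt := by
  have h : Function.Bijective (Scheme.ΓSpecIso (.of ℂ)).hom.hom :=
    ConcreteCategory.bijective_of_isIso (Scheme.ΓSpecIso (.of ℂ)).hom
  have h2 (x : point.Fn (top point.X)) : base.evalAt x = (Scheme.ΓSpecIso (.of ℂ)).hom.hom x :=
    congrArg _ congr($(Scheme.Hom.id_appTop (X := Spec (.of ℂ))) x)
  exact (funext h2 : ⇑base.evalAt = _) ▸ h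

/-- The complex points of `V` are maps from the terminal object of the site and cover `V`. On each
of them functions are complex numbers, and arbitrary values glue. -/
lemma bijective_evalAt : Function.Bijective
    (RingHom.pi fun y : CPt V => (y.evalAt : point.Fn V →+* ℂ)) := by
  constructor
  · intro f g h
    refine fn_ext (X := point) (.of_cover (fun W W' b c e => by rw [resFn_comp, resFn_comp, e]) fun v => ?_)
    obtain ⟨y, hy⟩ := exists_eq v
    refine ⟨_, y.hom, hy, bijective_evalAt_base.1 ?_⟩
    rw [← FieldPt.evalAt_map, ← FieldPt.evalAt_map, base_map]
    exact congrFun h y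
  · intro F
    obtain ⟨f, hf⟩ := fn_glue (X := point) (V := V)
      (fun W b f => ∀ y : CPt W, y.evalAt f = F (y.map b))
      (fun W W' b c f hf y => by rw [← FieldPt.evalAt_map, hf, FieldPt.map_comp])
      (fun W b f g hf hg => fn_ext (X := point)
        (.of_cover (fun W W' b c e => by rw [resFn_comp, resFn_comp, e]) fun v => by
          obtain ⟨y, hy⟩ := exists_eq v
          refine ⟨_, y.hom, hy, bijective_evalAt_base.1 ?_⟩
          rw [← FieldPt.evalAt_map, ← FieldPt.evalAt_map, hf, hg]))
      (.of_cover (fun W W' b c ⟨f, hf⟩ => ⟨point.resFn c f, fun y => by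
          rw [← FieldPt.evalAt_map, hf, FieldPt.map_comp]⟩) fun v => by
        obtain ⟨y, hy⟩ := exists_eq v
        obtain ⟨f, hf⟩ := bijective_evalAt_base.2 (F y)
        exact ⟨_, y.hom, hy, f, fun τ => by rw [eq_base τ, hf, base_map]⟩)
    refine ⟨f, funext fun y => ?_⟩
    obtain ⟨W, b, σ, hb, rfl⟩ := y.exists_mem hf
    exact (FieldPt.evalAt_map b σ f).trans (hb σ)

end CPt

/-- Functions on étale schemes over `Spec ℂ` are the functions on their complex points. -/
def ptEquiv (V : point.X.Etale) : point.Fn V ≃+* (CPt V → ℂ) :=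
  .ofBijective _ CPt.bijective_evalAt

/-! ### The standard log point -/

/-- The monoid `ℕ × ℂˣ`. -/
abbrev PtMon : Type := Multiplicative ℕ × ℂˣ

/-- The map `ℕ × ℂˣ → ℂ` of the standard log point. -/
def ptMonHom : PtMon →* ℂ where
  toFun m := if m.1 = 1 then m.2 else 0
  map_one' := by simp
  map_mul' m n := by
    have h : m.1 * n.1 = 1 ↔ m.1 = 1 ∧ n.1 = 1 :=
      (Nat.add_eq_zero_iff : m.1.toAdd + n.1.toAdd = 0 ↔ _)
    by_cases h1 : m.1 = 1 <;> by_cases h2 : n.1 = 1 <;> simp [h, h1, h2]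

lemma ptMonHom_one_mk (z : ℂˣ) : ptMonHom (1, z) = z :=
  (if_pos rfl : (if (1 : Multiplicative ℕ) = 1 then (z : ℂ) else 0) = z)

/-- The presheaf of `ℕ × ℂˣ`-valued functions on complex points. -/
def logPointPresheaf : point.X.Etaleᵒᵖ ⥤ CommMonCat.{0} where
  obj V := CommMonCat.of (CPt V.unop → PtMon)
  map b := CommMonCat.ofHom
    { toFun := fun f y => f (y.map b.unop), map_one' := rfl, map_mul' := fun _ _ => rfl }
  map_id V := CommMonCat.hom_ext (MonoidHom.ext fun f => funext fun τ =>
    congrArg f (FieldPt.map_id τ))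
  map_comp b c := CommMonCat.hom_ext (MonoidHom.ext fun f => funext fun τ =>
    congrArg f (FieldPt.map_comp _ _ _))

/-- The map from `ℕ × ℂˣ`-valued functions to functions. -/
def logPointMap (V : point.X.Etale) : (CPt V → PtMon) →* point.Fn V :=
  ((ptEquiv V).symm : (CPt V → ℂ) →* point.Fn V).comp
    (MonoidHom.pi fun y => ptMonHom.comp (Pi.evalMonoidHom _ y))

lemma evalAt_logPointMap {V : point.X.Etale} (m : CPt V → PtMon) (y : CPt V) :
    y.evalAt (logPointMap V m) = ptMonHom (m y) :=
  congrFun ((ptEquiv V).apply_symm_apply fun y => ptMonHom (m y)) y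

lemma fn_ext_evalAt {V : point.X.Etale} {f g : point.Fn V}
    (h : ∀ y : CPt V, y.evalAt f = y.evalAt g) : f = g :=
  (ptEquiv V).injective (funext h)

lemma ptMonHom_ne_zero {m : PtMon} (h : ptMonHom m ≠ 0) : m.1 = 1 ∧ ptMonHom m = m.2 := by
  by_cases h1 : m.1 = 1
  · exact ⟨h1, if_pos h1⟩
  · exact absurd (if_neg h1) h

/-- The standard log point: `Spec ℂ` with the log structure `ℕ × ℂˣ`. -/
def logPoint : LogScheme where
  X := point.X
  str := point.str
  M := ⟨logPointPresheaf, isSheaf_commMonCat (isSheaf_ptFun (L := point) ⊤ ℂ PtMon)⟩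
  α :=
    { app := fun V => CommMonCat.ofHom (logPointMap V.unop)
      naturality := fun V W b => CommMonCat.hom_ext (MonoidHom.ext fun f =>
        fn_ext_evalAt fun y => (evalAt_logPointMap _ y).trans
          ((FieldPt.evalAt_map b.unop y (logPointMap _ f)).symm.trans
            (evalAt_logPointMap f _)).symm) }
  unit V x hx := by
    -- A non-zero value of `ptMonHom` forces exponent zero and determines the component in ℂˣ.
    have hx' (y : CPt V) : y.evalAt x ≠ 0 := ((show IsUnit (x : point.Fn V) from hx).map y.evalAt).ne_zero
    refine ⟨fun y => (1, Units.mk0 _ (hx' y)), fn_ext_evalAt fun y => ?_, fun m hm => funext fun y => ?_⟩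
    · exact (evalAt_logPointMap _ y).trans (ptMonHom_one_mk _)
    · have h1 : ptMonHom (m y) = y.evalAt x :=
        (evalAt_logPointMap m y).symm.trans (congrArg y.evalAt hm)
      obtain ⟨h2, h3⟩ := ptMonHom_ne_zero (h1 ▸ hx' y)
      exact Prod.ext h2 (Units.ext (h3.symm.trans h1))

namespace logPoint

/-- The sections of the log structure of the log point are functions on complex points. -/
def val {V : point.X.Etale} (m : logPoint.Mon V) : CPt V → PtMon := m

lemma val_ext {V : point.X.Etale} {m n : logPoint.Mon V} (h : ∀ y, val m y = val n y) : m = n :=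
  funext h

lemma val_unit {V : point.X.Etale} {m : logPoint.Mon V} (hm : IsUnit m) (y : CPt V) :
    (val m y).1 = 1 := by
  obtain ⟨u, rfl⟩ := hm
  have h : val (u : logPoint.Mon V) y * val ((u⁻¹ : (logPoint.Mon V)ˣ) : logPoint.Mon V) y = 1 :=
    congrFun (congrArg val u.mul_inv) y
  have h1 := congrArg Prod.fst h
  exact (Nat.add_eq_zero_iff.1 (congrArg Multiplicative.toAdd h1)).1

/-- The generator of the log structure of the log point. -/
def gen : logPoint.Mon (top logPoint.X) := fun _ : CPt (top point.X) => (.ofAdd 1, 1)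

/-- The constant section with values in `ℂˣ`. -/
def const (z : ℂˣ) : (logPoint.Mon (top logPoint.X))ˣ :=
  ⟨fun _ : CPt (top point.X) => (1, z), fun _ : CPt (top point.X) => (1, z⁻¹),
    funext fun _ => Prod.ext (one_mul 1) (mul_inv_cancel z),
    funext fun _ => Prod.ext (one_mul 1) (inv_mul_cancel z)⟩

lemma exists_hom {V : logPoint.X.Etale} (v : dom V) :
    ∃ b : top logPoint.X ⟶ V, v ∈ Set.range (left b) :=
  have ⟨y, hy⟩ := CPt.exists_eq (V := V) v
  ⟨y.hom, hy⟩

lemma top_hom (b : top logPoint.X ⟶ top logPoint.X) : b = 𝟙 _ := (isTerminalTop _).hom_ext _ _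

lemma ofAdd_one_pow (k : ℕ) : (((.ofAdd 1, 1) : PtMon) ^ k) = (.ofAdd k, 1) :=
  Prod.ext ((ofAdd_nsmul k 1).symm.trans (congrArg Multiplicative.ofAdd (mul_one k))) (one_pow k)

/-- Sections over the point are generated by `gen` and the constants. -/
lemma eq_gen_pow_mul (m : logPoint.Mon (top logPoint.X)) :
    ∃ (k : ℕ) (z : ℂˣ), m = gen ^ k * const z := by
  refine ⟨(val m CPt.base).1.toAdd, (val m CPt.base).2, val_ext fun y => ?_⟩
  rw [CPt.eq_base y]
  refine .trans ?_ (congrArg (· * ((1, (val m CPt.base).2) : PtMon))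
    (ofAdd_one_pow (val m CPt.base).1.toAdd).symm)
  exact Prod.ext (mul_one _).symm (one_mul _).symm

/-- Units have exponent zero at every complex point, so the decomposition ℕ × ℂˣ separates the power
of `gen` from the unit. The point `w` provides a complex point at which the exponents are compared.
-/
lemma eq_of_glob_gen_pow {W : logPoint.X.Etale} (w : dom W) {k k' : ℕ} {u u' : logPoint.Mon W}
    (hu : IsUnit u) (hu' : IsUnit u')
    (h : logPoint.res ((isTerminalTop _).from W) gen ^ k * u =
      logPoint.res ((isTerminalTop _).from W) gen ^ k' * u') : k = k' ∧ u = u' := by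
  have h1 (y : CPt W) : (Multiplicative.ofAdd k * (val u y).1 : Multiplicative ℕ) =
      Multiplicative.ofAdd k' * (val u' y).1 ∧ (val u y).2 = (val u' y).2 := by
    have h2 : ((.ofAdd 1, 1) : PtMon) ^ k * val u y = ((.ofAdd 1, 1) : PtMon) ^ k' * val u' y :=
      congrFun (congrArg val h) y
    rw [ofAdd_one_pow, ofAdd_one_pow] at h2
    refine ⟨congrArg Prod.fst h2, ?_⟩
    simpa using congrArg Prod.snd h2
  obtain ⟨y, -⟩ := CPt.exists_eq (V := W) w
  have h3 := (h1 y).1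
  rw [val_unit hu, val_unit hu', mul_one, mul_one] at h3
  exact ⟨Multiplicative.ofAdd.injective h3, val_ext fun y =>
    Prod.ext ((val_unit hu y).trans (val_unit hu' y).symm) (h1 y).2⟩

lemma evalAt_zero {V : point.X.Etale} (y : CPt V) : y.evalAt (0 : point.Fn V) = 0 := map_zero _

lemma toFn_gen : logPoint.toFn _ gen = 0 := by
  refine fn_ext_evalAt fun y => (evalAt_logPointMap (V := top point.X) _ y).trans ?_
  exact (if_neg (by decide) : (if (Multiplicative.ofAdd 1 : Multiplicative ℕ) = 1 then
    ((1 : ℂˣ) : ℂ) else 0) = 0).trans (evalAt_zero (V := top point.X) y).symm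

lemma isChart : logPoint.IsChart (top logPoint.X) (powersHom _ gen) := by
  refine ⟨fun V b m => .of_cover ?_ fun v => ?_, fun V b p q u h => .of_cover ?_ fun v => ?_⟩
  · rintro W W' c d ⟨p, u, h⟩
    exact ⟨p, Units.map (logPoint.res d) u, by
      rw [res_comp, h, map_mul, ← res_comp, Category.assoc]; rfl⟩
  · obtain ⟨c, hc⟩ := exists_hom v
    obtain ⟨k, z, hk⟩ := eq_gen_pow_mul (logPoint.res c m)
    refine ⟨_, c, hc, .ofAdd k, const z, hk.trans ?_⟩
    rw [top_hom (c ≫ b), res_id]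
    rfl
  · rintro W W' c d ⟨r, s, hr, hs, e, e'⟩
    refine ⟨r, s, ?_, ?_, e, ?_⟩
    · rw [Category.assoc, res_comp]; exact hr.map _
    · rw [Category.assoc, res_comp]; exact hs.map _
    · rw [Category.assoc, res_comp, e', map_mul, ← res_comp, ← res_comp]
  · have hb : b = (isTerminalTop _).from V := (isTerminalTop _).hom_ext _ _
    obtain ⟨h1, h2⟩ := eq_of_glob_gen_pow v (k := p.toAdd) (k' := q.toAdd) isUnit_one u.isUnit (by
      rw [← hb, mul_one, ← map_pow, ← map_pow]
      exact h)
    refine ⟨V, 𝟙 V, ⟨v, rfl⟩, 1, 1, ?_, ?_, ?_, ?_⟩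
    · rw [map_one, map_one]; exact isUnit_one
    · rw [map_one, map_one]; exact isUnit_one
    · rw [mul_one, mul_one]; exact congrArg Multiplicative.ofAdd h1
    · rw [map_one, map_one, mul_one, ← h2, map_one]

lemma isFs : logPoint.IsFs := fun x =>
  ⟨top logPoint.X, ⟨x, rfl⟩, _, _, _, isFsMonoid_nat, isChart⟩

end logPoint

end LogScheme

/-! ### The log point as a strict closed subscheme of the line -/

namespace LogScheme

lemma strict_left_comp {X Y : LogScheme} (f : X.Hom Y) {U : Y.X.Etale} {W W' : X.X.Etale}
    {g : dom W ⟶ dom U} (hg : g ≫ proj U = proj W ≫ f.f) (c : W' ⟶ W) :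
    (left c ≫ g) ≫ proj U = proj W' ≫ f.f := by
  rw [Category.assoc, hg, ← Category.assoc, left_proj]

variable {L : LogScheme}

/-- The inclusion of the log point at the origin of a chart is strict. -/
lemma LogLineData.homOfSection_gen_isStrict (l : LogLineData L) (i : Fin (1 + 1)) :
    (l.homOfSection i logPoint.gen).IsStrict := by
  refine ⟨fun V m => .of_cover ?_ fun v => ?_, fun U V g hg n n' u e => .of_cover ?_ fun v => ?_⟩
  · rintro W W' b c ⟨U, g, hg, n, u, h⟩
    refine ⟨U, left c ≫ g, strict_left_comp _ hg c, n, Units.map (logPoint.res c) u, ?_⟩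
    rw [res_comp, h, map_mul, Hom.res_pull _ g hg c (strict_left_comp _ hg c)]
    rfl
  -- A section over the point is a power of `gen` times a constant, and `gen` is the pullback of the
  -- coordinate.
  · obtain ⟨c, hc⟩ := logPoint.exists_hom v
    obtain ⟨k, z, hk⟩ := logPoint.eq_gen_pow_mul (logPoint.res c m)
    have hg : l.coordMap i (logPoint.toFn _ logPoint.gen) ≫ proj (l.U i) =
      proj (top logPoint.X) ≫ l.sectionMap i logPoint.gen := (Category.id_comp _).symm
    refine ⟨_, c, hc, l.U i, _, hg, l.t i ^ k, logPoint.const z, hk.trans ?_⟩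
    rw [map_pow, l.homOfSection_pull_t _ hg, glob_top]
  · rintro W W' b c ⟨U', a, g', hg', w, e₁, e₂, e₃⟩
    refine ⟨U', a, left c ≫ g', strict_left_comp _ hg' c, w, ?_, e₂, ?_⟩
    · rw [Category.assoc, e₁, ← Category.assoc]; rfl
    · rw [res_comp, ← e₃, Hom.res_pull]
  · obtain ⟨W₁, b₁, ⟨v₁, rfl⟩, N₁, h₁⟩ := IsPull.exists_local hg n v
    have hg₁ := strict_left_comp _ hg b₁
    obtain ⟨W, b₂, ⟨w, rfl⟩, N', h'⟩ := IsPull.exists_local hg₁ n' v₁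
    have hb := strict_left_comp _ hg (b₂ ≫ b₁)
    have key := congrArg (logPoint.res (b₂ ≫ b₁)) e
    have e₁ : left (b₂ ≫ b₁) ≫ g = left b₂ ≫ left b₁ ≫ g := Category.assoc _ _ _
    have h₁ := e₁ ▸ h₁.res b₂
    have h₂ := e₁ ▸ h'
    rw [map_mul, Hom.res_pull _ _ _ _ hb, Hom.res_pull _ _ _ _ hb, l.homOfSection_pull _ hb h₁,
      l.homOfSection_pull _ hb h₂] at key
    obtain ⟨Z₁, a₁, a₁', r₁, k₁, u₁, f₁, h₁, hN₁⟩ := h₁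
    obtain ⟨Z₂, a₂, a₂', r₂, k₂, u₂, f₂, h₂, hN₂⟩ := h₂
    obtain ⟨Z, g₁, g₂, r, eg, rfl, rfl⟩ := exists_common_lift a₁ a₂ r₁ r₂ (f₁.trans f₂.symm)
    have ht : g₂ ≫ a₂' = g₁ ≫ a₁' := l.hom_unique _ _
    -- Both pullbacks are now powers of `gen` times units; uniqueness of this decomposition makes
    -- the exponents equal.
    rw [hN₁, hN₂, ← unitPull_res, ← unitPull_res, mul_assoc] at key
    obtain ⟨rfl, hu⟩ := logPoint.eq_of_glob_gen_pow w (isUnit_unitPull _ _)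
      ((isUnit_unitPull _ _).mul (u.isUnit.map _)) key
    have hr : r ≫ proj Z = proj W ≫ (l.homOfSection i logPoint.gen).f := by
      rw [← hb, e₁, ← f₁, Category.assoc, Category.assoc, left_proj, left_proj]
    have h1 := congrArg (L.res g₁) h₁
    have h2 := congrArg (L.res g₂) h₂
    rw [map_mul, map_pow, ← res_comp, ← res_comp] at h1 h2
    rw [ht, ← eg] at h2
    -- With equal powers of the coordinate, `n` and `n'` differ by the quotient of their unit parts.
    refine ⟨W, b₂ ≫ b₁, ⟨w, rfl⟩, Z, g₁ ≫ a₁, r, hr,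
      (Units.map (L.res g₂) u₂)⁻¹ * Units.map (L.res g₁) u₁, ?_, ?_, ?_⟩
    · rw [e₁, ← f₁, Category.assoc]; rfl
    · rw [h1, h2, mul_assoc]
      congr 1
      exact (congrArg Units.val (mul_inv_cancel_left (Units.map (L.res g₂) u₂)
        (Units.map (L.res g₁) u₁))).symm
    · rw [Hom.pull_unit, ← (isUnit_unitPull r (Units.map (L.res g₂) u₂)).mul_right_inj, ← hu,
        ← map_mul, mul_inv_cancel_left]

end LogScheme

/-! ### Additivity on the projective line -/

namespace LogScheme

lemma eq_of_X_mem {p q : PrimeSpectrum ℂ[X]} (hp : Polynomial.X ∈ p.asIdeal)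
    (hq : Polynomial.X ∈ q.asIdeal) : p = q := by
  have h : (Ideal.span {(Polynomial.X : ℂ[X])}).IsMaximal :=
    PrincipalIdealRing.isMaximal_of_irreducible Polynomial.irreducible_X
  have key (r : PrimeSpectrum ℂ[X]) (hr : Polynomial.X ∈ r.asIdeal) :
      r.asIdeal = Ideal.span {(Polynomial.X : ℂ[X])} :=
    (h.eq_of_le r.2.ne_top ((Ideal.span_singleton_le_iff_mem _).2 hr)).symm
  exact PrimeSpectrum.ext ((key p hp).trans (key q hq).symm)

variable {L Y : LogScheme}

lemma eq_or_eq_rev : ∀ i j : Fin (1 + 1), j = i ∨ j = i.rev := by decide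

namespace LineData

variable (l : LineData L)

lemma eq_of_not_nz {i : Fin (1 + 1)} {v v' : dom (l.U i)} (hv : ¬ NZ (l.c i) v)
    (hv' : ¬ NZ (l.c i) v') : v = v' := by
  have := l.isIso_toA1 i
  have h (w : dom (l.U i)) := nz_iff_of_pullElem (L := L) (toA1 (l.c i)) Polynomial.X
    (by rw [pullElem_toA1, aeval_X]) w
  rw [h, not_not] at hv hv'
  exact (toA1 (l.c i)).homeomorph.injective (eq_of_X_mem hv hv')

/-- The origin of a chart is the vanishing locus of the coordinate. -/
lemma range_coordMap_zero [Nonempty Y.X] (i : Fin (1 + 1)) (x : Y.Fn (top Y.X)) (hx : x = 0) :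
    Set.range (l.coordMap i x) = {v | ¬ NZ (l.c i) v} := by
  have h (y : dom (top Y.X)) : ¬ NZ (l.c i) (l.coordMap i x y) := by
    rw [← nz_fnPull, fnPull_coordMap, hx]
    intro h
    have h2 := Scheme.basicOpen_zero (dom (top Y.X)) ⊤
    exact (h2.le h : _)
  ext v
  refine ⟨?_, fun hv => ?_⟩
  · rintro ⟨y, rfl⟩
    exact h y
  · exact ⟨Classical.arbitrary Y.X, l.eq_of_not_nz (h _) hv⟩

/-- The complement of the origin of a chart is the opposite chart. -/
lemma range_coordMap_zero_proj [Nonempty Y.X] (i : Fin (1 + 1)) (x : Y.Fn (top Y.X)) (hx : x = 0) :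
    Set.range (l.coordMap i x ≫ proj (l.U i)) = (Set.range (proj (l.U i.rev)))ᶜ := by
  have h : Set.range (l.coordMap i x ≫ proj (l.U i)) =
      proj (l.U i) '' Set.range (l.coordMap i x) := by
    rw [← Set.range_comp]
    rfl
  rw [h, l.range_coordMap_zero i x hx]
  ext v
  refine ⟨?_, fun hv => ?_⟩
  · rintro ⟨w, hw, rfl⟩ h'
    obtain ⟨W, a, a', w', rfl⟩ := l.exists_hom_of_mem (i := i.rev) (l.U i) w h'
    have h2 : IsUnit (L.resFn a (l.c i)) := IsUnit.of_mul_eq_one _ (l.mul a a')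
    exact hw ((nz_resFn _ _ _).1 ((isUnit_iff_nz _).1 h2 w'))
  · obtain ⟨j, w, rfl⟩ := l.covers v
    obtain rfl | rfl := eq_or_eq_rev i j
    · exact ⟨w, fun h => hv (l.mem_range w h), rfl⟩
    · exact absurd ⟨w, rfl⟩ hv

lemma isClosedImmersion_of_comp_eq {T S R : Scheme.{0}} {f : T ⟶ S} {g : S ⟶ R} {h : T ⟶ R}
    [IsClosedImmersion h] [IsSeparated g] (e : f ≫ g = h) : IsClosedImmersion f := by
  subst e
  exact IsClosedImmersion.of_comp f g

/-- A closed immersion that factors through a separated morphism has a closed immersion as its first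
factor. For the point and the log point the structure morphism is even an isomorphism. -/
lemma isClosedImmersion_coordMap_proj [IsClosedImmersion Y.str] [IsSeparated L.str] (i : Fin (1 + 1))
    (x : Y.Fn (top Y.X)) : IsClosedImmersion (l.coordMap i x ≫ proj (l.U i)) :=
  isClosedImmersion_of_comp_eq (T := Y.X) (h := Y.str) (g := L.str)
    ((Category.assoc _ _ _).trans ((l.coordMap_str i x).trans (Category.id_comp _)))

lemma isAffine_U (i : Fin (1 + 1)) : IsAffine (dom (l.U i)) :=
  have := l.isIso_toA1 i
  .of_isIso (toA1 (l.c i))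

lemma isClosedImmersion_coordMap [IsClosedImmersion Y.str] (i : Fin (1 + 1)) (x : Y.Fn (top Y.X)) :
    IsClosedImmersion (l.coordMap i x) := by
  have := l.isAffine_U i
  exact isClosedImmersion_of_comp_eq (T := Y.X) (h := Y.str) (g := proj (l.U i) ≫ L.str)
    ((l.coordMap_str i x).trans (Category.id_comp _))

end LineData

/-- Restriction of a log variety to an affine étale scheme. -/
def _root_.LogGeom.LogVar.restrAffine (X : LogVar) (V : X.X.Etale) (h : IsAffine (dom V)) : LogVar where
  __ := X.toLogScheme.restr V
  isFs := X.isFs.restr V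
  locallyOfFiniteType :=
    have := X.locallyOfFiniteType
    inferInstanceAs (LocallyOfFiniteType (proj V ≫ X.str))
  quasiCompact := inferInstanceAs (QuasiCompact ((proj V ≫ X.str : dom V ⟶ Spec (.of ℂ))))
  isSeparated := inferInstanceAs (IsSeparated ((proj V ≫ X.str : dom V ⟶ Spec (.of ℂ))))

instance : IsIso point.str := inferInstanceAs (IsIso (𝟙 (Spec (.of ℂ))))

instance : IsIso logPoint.str := inferInstanceAs (IsIso point.str)

instance : Nonempty point.X := inferInstanceAs (Nonempty (Spec (.of ℂ)))

instance : Nonempty logPoint.X := inferInstanceAs (Nonempty point.X)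

/-- The point as a log variety. -/
def pointVar : LogVar where
  __ := point
  isFs := isTrivial_point.isFs
  locallyOfFiniteType := inferInstanceAs (LocallyOfFiniteType point.str)
  quasiCompact := inferInstanceAs (QuasiCompact point.str)
  isSeparated := inferInstanceAs (IsSeparated point.str)

/-- The standard log point as a log variety. -/
def logPointVar : LogVar where
  __ := logPoint
  isFs := logPoint.isFs
  locallyOfFiniteType := inferInstanceAs (LocallyOfFiniteType logPoint.str)
  quasiCompact := inferInstanceAs (QuasiCompact logPoint.str)
  isSeparated := inferInstanceAs (IsSeparated logPoint.str)

/-- The projective line with a log structure as a log variety. -/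
def lineVar (D : (Proj lineGrading).Opens) (h : (line D).IsFs) : LogVar where
  __ := line D
  isFs := h
  locallyOfFiniteType := inferInstanceAs (LocallyOfFiniteType lineStr)
  quasiCompact := inferInstanceAs (QuasiCompact lineStr)
  isSeparated := inferInstanceAs (IsSeparated lineStr)

/-- The projective line with its trivial log structure. -/
def trivialLine : LogVar := lineVar ⊤ (divLog_isTrivial _ _).isFs

/-- The projective line with the log structure given by `0` and `∞`. -/
def logLine : LogVar := lineVar torus logLineData.isFs

lemma isProjective_line (D : (Proj lineGrading).Opens) : (line D).IsProjective :=
  ⟨1, 𝟙 (Proj lineGrading), inferInstanceAs (IsClosedImmersion (𝟙 (Proj lineGrading))),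
    Category.id_comp _⟩

lemma locallyOfFinitePresentation_lineStr : LocallyOfFinitePresentation lineStr := inferInstance

lemma logLine_isLogSmooth : logLine.IsLogSmooth :=
  logLineData.isLogSmooth locallyOfFinitePresentation_lineStr

lemma trivialLine_isLogSmooth : trivialLine.IsLogSmooth :=
  (lineData ⊤).isLogSmooth locallyOfFinitePresentation_lineStr (divLog_isTrivial _ _)

lemma isTrivial_restr_locus (l : LogLineData L) (i : Fin (1 + 1)) :
    (L.restr (locus (l.c i))).IsTrivial := fun V m => by
  let a : push (locus (l.c i)) V ⟶ l.U i :=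
    toPush (U' := locus (l.c i)) (proj V) rfl ≫ locusι (l.c i)
  have h (v : dom (push (locus (l.c i)) V)) : NZ (L.resFn a (l.c i)) v := by
    rw [resFn_comp, nz_resFn]
    exact (isUnit_iff_nz _).1 (isUnit_resFn_locusι (l.c i)) _
  exact (isUnit_toFn (X := L) (m := m)).1 ((isUnit_iff_nz _).2 fun v => l.nz_toFn m a v (h v))

lemma isAffine_locus (l : LineData L) (i : Fin (1 + 1)) : IsAffine (dom (locus (l.c i))) := by
  have := l.isAffine_U i
  exact (isAffineOpen_top (dom (l.U i))).basicOpen (l.c i)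

/-- The complement of `0` in the line with its two-point log structure. -/
def logAffineLine : LogVar := logLine.restrAffine (logLineData.U 0) (logLineData.isAffine_U 0)

/-- The affine line. -/
def affineLine : LogVar := trivialLine.restrAffine ((lineData ⊤).U 0) ((lineData ⊤).isAffine_U 0)

/-- The multiplicative group. -/
def multGroup : LogVar :=
  logLine.restrAffine (locus (logLineData.c 0)) (isAffine_locus logLineData.toLineData 0)

lemma isTrivial_multGroup : multGroup.IsTrivial := isTrivial_restr_locus logLineData 0

lemma isTrivial_affineLine : affineLine.IsTrivial := (divLog_isTrivial _ _ : (line ⊤).IsTrivial).restr _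

/-- Additivity along strict closed immersions and the complementary open immersions. -/
def IsAdditive {A : Type} [Add A] (φ : LogVar → A) : Prop :=
  ∀ (X Z U : LogVar) (i : Z.Hom X.toLogScheme) (j : U.Hom X.toLogScheme),
    i.IsStrictClosedImmersion → j.IsStrictOpenImmersion →
    Set.range j.f = (Set.range i.f)ᶜ → φ X = φ Z + φ U

namespace IsAdditive

variable {A : Type} [AddCommGroup A] {φ : LogVar → A}

/-- The origin of chart 1 is removed; its complement is chart 0. -/
lemma logLine_eq (hφ : IsAdditive φ) : φ logLine = φ logPointVar + φ logAffineLine := by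
  refine hφ logLine logPointVar logAffineLine (logLineData.homOfSection 1 logPoint.gen)
    ((line torus).restrHom (logLineData.U 0)) ⟨?_, logLineData.homOfSection_gen_isStrict 1⟩
    ⟨logLineData.isOpenImmersion 0, restrHom_isStrict _⟩ ?_
  · have : IsSeparated (line torus).str := inferInstanceAs (IsSeparated lineStr)
    exact logLineData.isClosedImmersion_coordMap_proj (Y := logPoint) 1 _
  · have h := logLineData.range_coordMap_zero_proj (Y := logPoint) 1 _ logPoint.toFn_gen
    exact (compl_eq_comm.1 h.symm).symm

/-- The origin of chart 0 is removed; its complement is the non-vanishing locus of the coordinate.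
-/
lemma logAffineLine_eq (hφ : IsAdditive φ) : φ logAffineLine = φ logPointVar + φ multGroup := by
  refine hφ logAffineLine logPointVar multGroup
    ((logLineData.homOfSection 0 logPoint.gen).lift (logLineData.U 0)
      (logLineData.coordMap 0 (logPoint.toFn _ logPoint.gen)) rfl)
    (((line torus).restrHom (locus (logLineData.c 0))).lift (logLineData.U 0)
      (left (locusι (logLineData.c 0))) (left_proj _))
    ⟨?_, Hom.lift_isStrict (logLineData.homOfSection_gen_isStrict 0) _ _ _⟩
    ⟨?_, Hom.lift_isStrict (restrHom_isStrict _) _ _ _⟩ ?_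
  · exact logLineData.isClosedImmersion_coordMap (Y := logPoint) 0 _
  · exact inferInstanceAs (IsOpenImmersion (left (subι _ _)))
  · have h := logLineData.range_coordMap_zero (Y := logPoint) 0 _ logPoint.toFn_gen
    refine Eq.trans ?_ (congrArg compl h.symm)
    ext v
    exact (range_locusι (logLineData.c 0) v).trans not_not.symm

lemma trivialLine_eq (hφ : IsAdditive φ) : φ trivialLine = φ pointVar + φ affineLine := by
  let l : LineData (line ⊤) := lineData ⊤
  have hL : (line ⊤).IsTrivial := divLog_isTrivial _ _
  have : IsSeparated (line ⊤).str := inferInstanceAs (IsSeparated lineStr)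
  refine hφ trivialLine pointVar affineLine
    (homOfTrivial (X := line ⊤) (Y := point) hL (l.coordMap 1 (0 : point.Fn (top point.X)) ≫ proj (l.U 1))
      ((Category.assoc _ _ _).trans ((l.coordMap_str 1 _).trans (Category.id_comp _))))
    ((line ⊤).restrHom (l.U 0)) ⟨l.isClosedImmersion_coordMap_proj 1 _, hL.isStrict isTrivial_point _⟩
    ⟨l.isOpenImmersion 0, restrHom_isStrict _⟩ ?_
  have h := l.range_coordMap_zero_proj (Y := point) 1 0 rfl
  exact (compl_eq_comm.1 h.symm).symm

/-- `multGroup` is cut out of the log line but has trivial log structure, so it also embeds strictly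
in the affine line. Using the very same log variety in both decompositions lets it cancel, without
invariance of φ under isomorphism. -/
lemma affineLine_eq (hφ : IsAdditive φ) : φ affineLine = φ pointVar + φ multGroup := by
  let l : LineData (line ⊤) := lineData ⊤
  have hA : ((line ⊤).restr (l.U 0)).IsTrivial := isTrivial_affineLine
  refine hφ affineLine pointVar multGroup
    (homOfTrivial (X := (line ⊤).restr (l.U 0)) (Y := point) hA (l.coordMap 0 (0 : point.Fn (top point.X)))
      ((l.coordMap_str 0 _).trans (Category.id_comp _)))
    (homOfTrivial (X := (line ⊤).restr (l.U 0)) (Y := (line torus).restr (locus (logLineData.c 0))) hA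
      (left (locusι (logLineData.c 0)))
      ((Category.assoc _ _ _).symm.trans (congrArg (· ≫ lineStr) (left_proj (locusι (logLineData.c 0))))))
    ⟨l.isClosedImmersion_coordMap 0 _, hA.isStrict isTrivial_point _⟩
    ⟨inferInstanceAs (IsOpenImmersion (left (subι _ _))), hA.isStrict isTrivial_multGroup _⟩ ?_
  have h := l.range_coordMap_zero (Y := point) 0 0 rfl
  refine Eq.trans ?_ (congrArg compl h.symm)
  ext v
  exact (range_locusι (logLineData.c 0) v).trans not_not.symm

lemma logLine_sub (hφ : IsAdditive φ) : φ logLine - φ trivialLine = 2 • (φ logPointVar - φ pointVar) := by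
  rw [hφ.logLine_eq, hφ.logAffineLine_eq, hφ.trivialLine_eq, hφ.affineLine_eq]
  abel

end IsAdditive

/-- An additive function does not agree with the log `e`-polynomial. -/
lemma IsAdditive.false {φ : LogVar → MvPolynomial (Fin 2) ℤ} (h1 : IsAdditive φ)
    (h2 : ∀ X : LogVar, Smooth X.str → X.IsLogSmooth → X.IsProjective →
      (φ X : MvPowerSeries (Fin 2) ℤ) = X.ePoly) : False := by
  have hS : Smooth lineStr := inferInstance
  have e1 := h2 logLine hS logLine_isLogSmooth (isProjective_line _)
  have e2 := h2 trivialLine hS trivialLine_isLogSmooth (isProjective_line _)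
  -- The exponent with p = 1 and q = 0 picks out the dimension of the space of global log one-forms.
  have key := congrArg (MvPolynomial.coeff (Finsupp.single 0 1)) (IsAdditive.logLine_sub h1)
  have c1 : MvPolynomial.coeff (Finsupp.single 0 1) (φ logLine) = 1 := by
    have h := logLineData.hodge_eq_one
    have h3 := congrArg (MvPowerSeries.coeff (Finsupp.single 0 1)) e1
    rw [MvPolynomial.coeff_coe] at h3
    refine h3.trans ?_
    change ((line torus).hodge ((Finsupp.single (0 : Fin 2) 1) 0) ((Finsupp.single (0 : Fin 2) 1) 1) : ℤ) = 1
    simp [h]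
  have c2 : MvPolynomial.coeff (Finsupp.single 0 1) (φ trivialLine) = 0 := by
    have h := (lineData ⊤).hodge_eq_zero (divLog_isTrivial _ _)
    have h3 := congrArg (MvPowerSeries.coeff (Finsupp.single 0 1)) e2
    rw [MvPolynomial.coeff_coe] at h3
    refine h3.trans ?_
    change ((line ⊤).hodge ((Finsupp.single (0 : Fin 2) 1) 0) ((Finsupp.single (0 : Fin 2) 1) 1) : ℤ) = 0
    simp [h]
  rw [MvPolynomial.coeff_sub, c1, c2, sub_zero, MvPolynomial.coeff_smul] at key
  rw [nsmul_eq_mul] at key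
  push_cast at key
  -- The coefficient 1 would be twice an integer.
  omega

end LogScheme
end LogGeom

end

theorem proposition3 :
    ¬ ∃ φ : LogGeom.LogVar → MvPolynomial (Fin 2) ℤ,
      (∀ (X Z U : LogGeom.LogVar) (i : Z.Hom X.toLogScheme) (j : U.Hom X.toLogScheme),
        i.IsStrictClosedImmersion → j.IsStrictOpenImmersion →
        Set.range j.f = (Set.range i.f)ᶜ → φ X = φ Z + φ U) ∧
      (∀ X : LogGeom.LogVar, AlgebraicGeometry.Smooth X.str → X.IsLogSmooth → X.IsProjective →
        (φ X : MvPowerSeries (Fin 2) ℤ) = X.ePoly) := by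
  rintro ⟨φ, h1, h2⟩
  exact LogGeom.LogScheme.IsAdditive.false h1 h2
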